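/- **Setup.** Let $\mathbb F$ be a field of characteristic $0$ containing two elements $q_1,q_2$ that are algebraically independent over $\mathbb Q$ (e.g. $\mathbb F=\mathbb Q(q_1,q_2)$), put $q=q_1q_2$, let $r\ge 0$ be an integer and let $u_1,\dots,u_r\in\mathbb F$. Let $\mathcal H_r$ be the $\mathbb F$-algebra generated by $b^i_n$ ($1\le i\le r$, $n\in\mathbb Z\setminus 0$) with relations, for all $n>0$, $$[b^i_{-n},b^j_n]=n(1-q_1^n)(1-q_2^n)\cdot\begin{cases}1-q^{-n}& i<j\\ 1& i=j\\ 0& i>j,\end{cases}$$ all other commutators of generators being zero. The normally ordered monomials (all $b^i_n$ with $n<0$ to the left of all $b^i_n$ with $n>0$) form a basis of $\mathcal H_r$; let $\widehat{\mathcal H}_r\supset\mathcal H_r$ be the space of formal infinite linear combinations of these basis vectors. The product of two elements $\sum_m A_me_m$, $\sum_n B_ne_n$ of $\widehat{\mathcal H}_r$ is $\sum_{m,n}A_mB_n\,e_me_n$ ($e_me_n\in\mathcal H_r$); it is well defined if for each basis vector only finitely many pairs $(m,n)$ contribute a nonzero term to its coefficient. Infinite sums in $\widehat{\mathcal H}_r$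 are likewise taken coefficientwise. Put $$p_n=\sum_{i=1}^r b^i_nq^{n(i-1)}\ (n\neq 0),\qquad \Lambda^i(x)=u_i\exp\Big[\sum_{n\ge1}\frac{b^i_{-n}}{nx^{-n}}\Big]\exp\Big[\sum_{n\ge1}\frac{b^i_n}{nx^n}\Big],$$ $$W_k(x)=\sum_{d\in\mathbb Z}\frac{W_{d,k}}{x^d}=\sum_{1\le i_1<\dots<i_k\le r}:\Lambda^{i_1}(x)\Lambda^{i_2}\Big(\frac xq\Big)\cdots\Lambda^{i_k}\Big(\frac x{q^{k-1}}\Big):\qquad(k\ge0),$$ where $:\ :$ denotes normal ordering (so $W_0(x)=1$ and $W_k(x)=0$ for $k>r$). Let $\delta(x)=\sum_{n\in\mathbb Z}x^n$, and $$\zeta(x)=\frac{(1-q_1x)(1-q_2x)}{(1-x)(1-qx)},\qquad \theta(s)=\frac{(1-q_1)(1-q_2)}{1-q}\,\zeta(q)\cdots\zeta(q^{s-1})\quad(s\ge1),$$ $$f_{kk'}(z)=\exp\Big[\sum_{n\ge1}\frac{z^n}{n}\cdot\frac{(1-q_1^n)(1-q_2^n)(q^{\max(0,k-k')n}-q^{kn})}{1-q^n}\Big]\in\mathbb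 F[[z]].$$ **Proposition.** All products of elements of $\widehat{\mathcal H}_r$ and all infinite sums below are well defined, and with $c=q^r$ one has, for all $n>0$ and $k,k'\ge0$: $$[W_k(x),p_{-n}]=-\frac{(1-q_1^n)(1-q_2^n)(1-q^{kn})}{1-q^n}\,x^{-n}W_k(x),$$ $$[W_k(x),p_n]=\frac{(1-q_1^n)(1-q_2^n)(q^{-kn}-1)c^n}{1-q^n}\,x^nW_k(x),$$ $$W_k(x)W_{k'}(y)f_{kk'}\Big(\frac yx\Big)-W_{k'}(y)W_k(x)f_{k'k}\Big(\frac xy\Big)$$ $$=\sum_{i=\max(0,k'-k)+1}^{k'}\delta\Big(\frac y{xq^i}\Big)\Big[W_{k'-i}(x)W_{k+i}(y)f_{k'-i,k+i}\Big(\frac yx\Big)\Big|_{x=y/q^i}\Big]\theta(\min(i,k-k'+i))$$ $$-\sum_{i=\max(0,k-k')+1}^{k}\delta\Big(\frac x{yq^i}\Big)\Big[W_{k-i}(y)W_{k'+i}(x)f_{k-i,k'+i}\Big(\frac xy\Big)\Big|_{y=x/q^i}\Big]\theta(\min(i,k'-k+i)).$$ Here $f(y/x)$ is expanded in nonnegative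 powers of $y/x$ and $f(x/y)$ in nonnegative powers of $x/y$. The restriction $[G(x,y)|_{x=y/q^i}]$ means: for each basis vector of $\widehat{\mathcal H}_r$ and each $d$, the part of the corresponding coefficient of $G$ of total degree $-d$ in $(x,y)$ is $y^{-d}$ times the expansion, at $y/x=0$, of a rational function of $y/x$ which is regular at $y/x=q^i$, and this rational function is evaluated at $y/x=q^i$ (and similarly with $x$ and $y$ exchanged); that these rational functions exist and are regular there is part of the claim. -/

import Mathlib

open scoped LaurentPolynomial PowerSeries

namespace DeformedW

noncomputable section

/-! ### The deformed Heisenberg algebra -/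

/-- The nonzero integers, labelling the modes of the bosonic fields. -/
abbrev Mode : Type := {n : ℤ // n ≠ 0}

/-- Labels of the generators `b_n^i` (`n` a nonzero integer, `i` one of `r` colours, numbered from
`0`).  The lexicographic order compares the modes `n` first, so that the creation operators
(`n < 0`) come before the annihilation operators (`n > 0`). -/
abbrev Idx (r : ℕ) : Type := Mode ×ₗ Fin r

/-- The label of `b_n^i`. -/
def idx {r : ℕ} (n : Mode) (i : Fin r) : Idx r := toLex (n, i)

/-- The mode `n` of the label of `b_n^i`. -/
def mode {r : ℕ} (g : Idx r) : ℤ := (ofLex g).1.1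

/-- The colour `i` of the label of `b_n^i`. -/
def colour {r : ℕ} (g : Idx r) : Fin r := (ofLex g).2

/-- The value of `[b_{-n}^i, b_n^j]` for `n > 0`, where `q = q₁ q₂`. -/
def pairing {K : Type*} [Field K] (q₁ q₂ : K) {r : ℕ} (n : ℤ) (i j : Fin r) : K :=
  n * (1 - q₁ ^ n) * (1 - q₂ ^ n) *
    (if i < j then 1 - (q₁ * q₂) ^ (-n) else if i = j then 1 else 0)

/-- The scalar `[b_g, b_h]` for two arbitrary generators. -/
def bracket {K : Type*} [Field K] (q₁ q₂ : K) {r : ℕ} (g h : Idx r) : K :=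
  if mode g + mode h = 0 then
    if 0 < mode h then pairing q₁ q₂ (mode h) (colour g) (colour h)
    else -pairing q₁ q₂ (mode g) (colour h) (colour g)
  else 0

/-- The defining relations of the deformed Heisenberg algebra: `b_g b_h - b_h b_g = [b_g, b_h]`. -/
inductive HeisRel {K : Type*} [Field K] (q₁ q₂ : K) (r : ℕ) :
    FreeAlgebra K (Idx r) → FreeAlgebra K (Idx r) → Prop
  | comm (g h : Idx r) :
      HeisRel q₁ q₂ r
        (FreeAlgebra.ι K g * FreeAlgebra.ι K h - FreeAlgebra.ι K h * FreeAlgebra.ι K g)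
        (algebraMap K (FreeAlgebra K (Idx r)) (bracket q₁ q₂ g h))

/-- The deformed Heisenberg algebra of type `gl_r`, presented by generators and relations. -/
abbrev Heis {K : Type*} [Field K] (q₁ q₂ : K) (r : ℕ) : Type _ := RingQuot (HeisRel q₁ q₂ r)

/-- The generator `b_g` of the deformed Heisenberg algebra. -/
def gen {K : Type*} [Field K] (q₁ q₂ : K) {r : ℕ} (g : Idx r) : Heis q₁ q₂ r :=
  RingQuot.mkAlgHom K (HeisRel q₁ q₂ r) (FreeAlgebra.ι K g)

/-- The normally ordered monomial attached to a multiplicity function `m` on the generators: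
the product of the generators `b_g`, each taken `m g` times, creation operators to the left of
annihilation operators. -/
def normalMonomial {K : Type*} [Field K] (q₁ q₂ : K) {r : ℕ} (m : Idx r →₀ ℕ) : Heis q₁ q₂ r :=
  (((Finsupp.toMultiset m).sort (· ≤ ·)).map (gen q₁ q₂)).prod

/-! ### The normally ordered monomials form a basis -/

section Basis

variable {K : Type*} [Field K] (q₁ q₂ : K) {r : ℕ}

theorem bracket_antisymm (g h : Idx r) : bracket q₁ q₂ g h = -bracket q₁ q₂ h g := by
  have hg : mode g ≠ 0 := (ofLex g).1.2
  unfold bracket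
  by_cases h0 : mode g + mode h = 0
  · have h0' : mode h + mode g = 0 := by omega
    rw [if_pos h0, if_pos h0']
    by_cases hh : 0 < mode h
    · rw [if_pos hh, if_neg (by omega), neg_neg]
    · rw [if_neg hh, if_pos (by omega)]
  · rw [if_neg h0, if_neg (by omega), neg_zero]

theorem gen_mul_gen (g h : Idx r) :
    gen q₁ q₂ g * gen q₁ q₂ h = gen q₁ q₂ h * gen q₁ q₂ g + bracket q₁ q₂ g h • 1 := by
  have := RingQuot.mkAlgHom_rel K (HeisRel.comm (q₁ := q₁) (q₂ := q₂) g h)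
  rw [map_sub, map_mul, map_mul, AlgHom.commutes, Algebra.algebraMap_eq_smul_one] at this
  unfold gen
  rw [← this]
  abel

/-- The derivation of the algebra of symbols by which an annihilation operator acts; it is zero
for a creation operator. -/
def contraction (g : Idx r) : Derivation K (MvPolynomial (Idx r) K) (MvPolynomial (Idx r) K) :=
  MvPolynomial.mkDerivation K fun h =>
    if 0 < mode g then MvPolynomial.C (bracket q₁ q₂ g h) else 0

/-- Left multiplication by `b_g`, written on symbols. -/
def genAction (g : Idx r) : Module.End K (MvPolynomial (Idx r) K) :=
  LinearMap.mulLeft K (MvPolynomial.X g) + (contraction q₁ q₂ g : _ →ₗ[K] _)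

theorem genAction_apply (g : Idx r) (p : MvPolynomial (Idx r) K) :
    genAction q₁ q₂ g p = MvPolynomial.X g * p + contraction q₁ q₂ g p := rfl

theorem contraction_X (g h : Idx r) :
    contraction q₁ q₂ g (MvPolynomial.X h) =
      MvPolynomial.C (if 0 < mode g then bracket q₁ q₂ g h else 0) := by
  unfold contraction
  rw [MvPolynomial.mkDerivation_X]
  split_ifs <;> simp

theorem contraction_comm (g h : Idx r) (p : MvPolynomial (Idx r) K) :
    contraction q₁ q₂ g (contraction q₁ q₂ h p) =
      contraction q₁ q₂ h (contraction q₁ q₂ g p) := by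
  have : ⁅contraction q₁ q₂ g, contraction q₁ q₂ h⁆ = 0 := by
    apply MvPolynomial.derivation_ext
    intro i
    rw [Derivation.commutator_apply, contraction_X, contraction_X, MvPolynomial.derivation_C,
      MvPolynomial.derivation_C]
    simp
  have h2 := congrArg (fun D => D p) this
  simp only [Derivation.commutator_apply, Derivation.coe_zero, Pi.zero_apply] at h2
  exact sub_eq_zero.mp h2

theorem genAction_comm (g h : Idx r) (p : MvPolynomial (Idx r) K) :
    genAction q₁ q₂ g (genAction q₁ q₂ h p) =
      genAction q₁ q₂ h (genAction q₁ q₂ g p) + bracket q₁ q₂ g h • p := by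
  have hg : mode g ≠ 0 := (ofLex g).1.2
  have hh : mode h ≠ 0 := (ofLex h).1.2
  have key : bracket q₁ q₂ g h = (if 0 < mode g then bracket q₁ q₂ g h else 0) -
      (if 0 < mode h then bracket q₁ q₂ h g else 0) := by
    by_cases h0 : mode g + mode h = 0
    · by_cases h1 : 0 < mode g
      · rw [if_pos h1, if_neg (by omega), sub_zero]
      · rw [if_neg h1, if_pos (by omega), zero_sub, bracket_antisymm]
    · have e1 : bracket q₁ q₂ g h = 0 := if_neg h0
      have e2 : bracket q₁ q₂ h g = 0 := if_neg (by omega)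
      simp [e1, e2]
  have : bracket q₁ q₂ g h • p = MvPolynomial.C (bracket q₁ q₂ g h) * p := by
    rw [MvPolynomial.smul_eq_C_mul]
  rw [this, key]
  simp only [genAction_apply, map_add, Derivation.leibniz, contraction_X, smul_eq_mul, map_sub,
    contraction_comm q₁ q₂ g h p]
  ring

theorem lift_genAction_rel {x y : FreeAlgebra K (Idx r)} (hxy : HeisRel q₁ q₂ r x y) :
    FreeAlgebra.lift K (genAction q₁ q₂) x = FreeAlgebra.lift K (genAction q₁ q₂) y := by
  obtain ⟨g, h⟩ := hxy
  refine LinearMap.ext fun p => ?_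
  rw [map_sub, map_mul, map_mul, FreeAlgebra.lift_ι_apply, FreeAlgebra.lift_ι_apply,
    AlgHom.commutes, LinearMap.sub_apply, Module.End.mul_apply, Module.End.mul_apply,
    Module.algebraMap_end_apply, genAction_comm q₁ q₂ g h, add_sub_cancel_left]

/-- The left regular representation of the deformed Heisenberg algebra on symbols. -/
def symbolRep : Heis q₁ q₂ r →ₐ[K] Module.End K (MvPolynomial (Idx r) K) :=
  RingQuot.liftAlgHom K
    ⟨FreeAlgebra.lift K (genAction q₁ q₂), fun _ _ hxy => lift_genAction_rel q₁ q₂ hxy⟩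

theorem symbolRep_gen (g : Idx r) : symbolRep q₁ q₂ (gen q₁ q₂ g) = genAction q₁ q₂ g := by
  simp [symbolRep, gen]

/-- The linear map sending the symbol `X^m` to the normally ordered monomial of `m`. -/
def quantize : MvPolynomial (Idx r) K →ₗ[K] Heis q₁ q₂ r :=
  (MvPolynomial.basisMonomials (Idx r) K).constr K (normalMonomial q₁ q₂)

theorem quantize_monomial (m : Idx r →₀ ℕ) :
    quantize q₁ q₂ (MvPolynomial.monomial m 1) = normalMonomial q₁ q₂ m := by
  have := (MvPolynomial.basisMonomials (Idx r) K).constr_basis K (normalMonomial q₁ q₂) m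
  rwa [MvPolynomial.coe_basisMonomials] at this

theorem bracket_eq_zero_of_pos {g h : Idx r} (hg : 0 < mode g) (hgh : g ≤ h) :
    bracket q₁ q₂ g h = 0 := by
  have : mode g ≤ mode h := by
    rcases Prod.Lex.le_iff.mp hgh with h1 | h1
    · exact le_of_lt h1
    · exact le_of_eq (congrArg Subtype.val h1.1)
  exact if_neg (by omega)

theorem contraction_monomial_of_le {g : Idx r} {m : Idx r →₀ ℕ} (hm : ∀ h ∈ m.support, g ≤ h) :
    contraction q₁ q₂ g (MvPolynomial.monomial m 1) = 0 := by
  unfold contraction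
  rw [MvPolynomial.mkDerivation_monomial, one_smul]
  refine Finset.sum_eq_zero fun h hh => ?_
  dsimp only
  by_cases hg : 0 < mode g
  · rw [if_pos hg, bracket_eq_zero_of_pos q₁ q₂ hg (hm h hh), map_zero, smul_zero]
  · rw [if_neg hg, smul_zero]

theorem genAction_monomial_of_le {g : Idx r} {m : Idx r →₀ ℕ} (hm : ∀ h ∈ m.support, g ≤ h) :
    genAction q₁ q₂ g (MvPolynomial.monomial m 1) =
      MvPolynomial.monomial (Finsupp.single g 1 + m) 1 := by
  rw [genAction_apply, contraction_monomial_of_le q₁ q₂ hm, add_zero, MvPolynomial.X,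
    MvPolynomial.monomial_mul, one_mul]

theorem normalMonomial_cons {g : Idx r} {m : Idx r →₀ ℕ} (hm : ∀ h ∈ m.support, g ≤ h) :
    normalMonomial q₁ q₂ (Finsupp.single g 1 + m) = gen q₁ q₂ g * normalMonomial q₁ q₂ m := by
  unfold normalMonomial
  rw [map_add, Finsupp.toMultiset_single, one_smul, Multiset.singleton_add,
    Multiset.sort_cons, List.map_cons, List.prod_cons]
  intro b hb
  exact hm b (by rwa [← Finsupp.mem_toMultiset])

theorem quantize_genAction_of_le {g : Idx r} {m : Idx r →₀ ℕ} (hm : ∀ h ∈ m.support, g ≤ h) :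
    quantize q₁ q₂ (genAction q₁ q₂ g (MvPolynomial.monomial m 1)) =
      gen q₁ q₂ g * quantize q₁ q₂ (MvPolynomial.monomial m 1) := by
  rw [genAction_monomial_of_le q₁ q₂ hm, quantize_monomial, quantize_monomial,
    normalMonomial_cons q₁ q₂ hm]

theorem quantize_genAction_of_forall {g : Idx r} {p : MvPolynomial (Idx r) K}
    (hp : ∀ m ∈ p.support, ∀ h ∈ m.support, g ≤ h) :
    quantize q₁ q₂ (genAction q₁ q₂ g p) = gen q₁ q₂ g * quantize q₁ q₂ p := by
  have e : p = ∑ m ∈ p.support, p.coeff m • MvPolynomial.monomial m (1 : K) := by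
    conv_lhs => rw [p.as_sum]
    refine Finset.sum_congr rfl fun m _ => ?_
    rw [MvPolynomial.smul_monomial, smul_eq_mul, mul_one]
  rw [e]
  simp only [map_sum, map_smul, Finset.mul_sum, mul_smul_comm]
  refine Finset.sum_congr rfl fun m hm => ?_
  rw [quantize_genAction_of_le q₁ q₂ (hp m hm)]

theorem support_genAction {a g : Idx r} (hag : a ≤ g) {m : Idx r →₀ ℕ}
    (hm : ∀ h ∈ m.support, a ≤ h) :
    ∀ s ∈ (genAction q₁ q₂ g (MvPolynomial.monomial m 1)).support, ∀ h ∈ s.support, a ≤ h := by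
  classical
  intro s hs
  rw [genAction_apply] at hs
  rcases Finset.mem_union.mp (MvPolynomial.support_add hs) with h1 | h1
  · rw [MvPolynomial.X, MvPolynomial.monomial_mul, one_mul] at h1
    have := Finset.mem_singleton.mp (MvPolynomial.support_monomial_subset h1)
    subst this
    intro h hh
    rcases Finset.mem_union.mp (Finsupp.support_add hh) with h2 | h2
    · have := Finset.mem_singleton.mp (Finsupp.support_single_subset h2)
      rwa [this]
    · exact hm h h2
  · unfold contraction at h1
    rw [MvPolynomial.mkDerivation_monomial, one_smul] at h1
    obtain ⟨i, -, h3⟩ := Finset.mem_biUnion.mp (MvPolynomial.support_sum h1)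
    have h4 : s = m - Finsupp.single i 1 := by
      dsimp only at h3
      split_ifs at h3
      · rw [smul_eq_mul, mul_comm, MvPolynomial.C_mul_monomial] at h3
        exact Finset.mem_singleton.mp (MvPolynomial.support_monomial_subset h3)
      · simp at h3
    subst h4
    intro h hh
    exact hm h (Finsupp.support_tsub hh)

theorem quantize_genAction_monomial (n : ℕ) : ∀ (g : Idx r) (m : Idx r →₀ ℕ), m.degree = n →
    quantize q₁ q₂ (genAction q₁ q₂ g (MvPolynomial.monomial m 1)) =
      gen q₁ q₂ g * quantize q₁ q₂ (MvPolynomial.monomial m 1) := by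
  induction n with
  | zero =>
    intro g m hm
    have : m = 0 := (Finsupp.degree_eq_zero_iff m).mp hm
    subst this
    exact quantize_genAction_of_le q₁ q₂ (by simp)
  | succ n ih =>
    intro g m hm
    by_cases hall : ∀ h ∈ m.support, g ≤ h
    · exact quantize_genAction_of_le q₁ q₂ hall
    · push Not at hall
      obtain ⟨h₀, hh₀, hlt₀⟩ := hall
      have hne : m.support.Nonempty := ⟨h₀, hh₀⟩
      set a := m.support.min' hne with ha
      have ham : a ∈ m.support := m.support.min'_mem hne
      have hag : a ≤ g := (m.support.min'_le _ hh₀).trans hlt₀.le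
      have hsplit : Finsupp.single a 1 + (m - Finsupp.single a 1) = m := by
        apply add_tsub_cancel_of_le
        rw [Finsupp.single_le_iff]
        exact Nat.one_le_iff_ne_zero.mpr (Finsupp.mem_support_iff.mp ham)
      set m' := m - Finsupp.single a 1 with hm'
      have hm'le : ∀ h ∈ m'.support, a ≤ h := fun h hh =>
        m.support.min'_le _ (Finsupp.support_tsub hh)
      have hdeg : m'.degree = n := by
        have := congrArg Finsupp.degree hsplit
        rw [map_add, Finsupp.degree_single, hm] at this
        omega
      rw [← hsplit, ← genAction_monomial_of_le q₁ q₂ hm'le, genAction_comm, map_add, map_smul,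
        quantize_genAction_of_forall q₁ q₂ (support_genAction q₁ q₂ hag hm'le), ih g m' hdeg,
        quantize_genAction_of_le q₁ q₂ hm'le, ← mul_assoc, ← mul_assoc, gen_mul_gen q₁ q₂ g a,
        add_mul, smul_mul_assoc, one_mul]

theorem quantize_genAction (g : Idx r) (p : MvPolynomial (Idx r) K) :
    quantize q₁ q₂ (genAction q₁ q₂ g p) = gen q₁ q₂ g * quantize q₁ q₂ p := by
  have : quantize q₁ q₂ ∘ₗ genAction q₁ q₂ g =
      LinearMap.mulLeft K (gen q₁ q₂ g) ∘ₗ quantize q₁ q₂ := by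
    refine (MvPolynomial.basisMonomials (Idx r) K).ext fun m => ?_
    simpa using quantize_genAction_monomial q₁ q₂ _ g m rfl
  exact LinearMap.congr_fun this p

theorem quantize_symbolRep (x : Heis q₁ q₂ r) (p : MvPolynomial (Idx r) K) :
    quantize q₁ q₂ (symbolRep q₁ q₂ x p) = x * quantize q₁ q₂ p := by
  obtain ⟨y, rfl⟩ := RingQuot.mkAlgHom_surjective K (HeisRel q₁ q₂ r) x
  induction y using FreeAlgebra.induction generalizing p with
  | grade0 c =>
    rw [AlgHom.commutes, AlgHom.commutes, Module.algebraMap_end_apply, map_smul, Algebra.smul_def]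
  | grade1 g =>
    have := symbolRep_gen q₁ q₂ g
    unfold gen at this
    rw [this, quantize_genAction]
    rfl
  | mul a b ha hb =>
    rw [map_mul, map_mul, Module.End.mul_apply, ha, hb, mul_assoc]
  | add a b ha hb =>
    rw [map_add, map_add, LinearMap.add_apply, map_add, ha, hb, add_mul]

theorem symbolRep_normalMonomial (m : Idx r →₀ ℕ) :
    symbolRep q₁ q₂ (normalMonomial q₁ q₂ m) 1 = MvPolynomial.monomial m 1 := by
  have aux : ∀ l : List (Idx r), l.Pairwise (· ≤ ·) →
      symbolRep q₁ q₂ ((l.map (gen q₁ q₂)).prod) 1 =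
        MvPolynomial.monomial (Multiset.toFinsupp (l : Multiset (Idx r))) 1 := by
    intro l
    induction l with
    | nil => simp
    | cons g t ih =>
      intro hl
      rw [List.pairwise_cons] at hl
      rw [List.map_cons, List.prod_cons, map_mul, Module.End.mul_apply, ih hl.2, symbolRep_gen,
        genAction_monomial_of_le]
      · rw [← Multiset.cons_coe, ← Multiset.singleton_add, Multiset.toFinsupp_add,
          Multiset.toFinsupp_singleton]
      · intro h hh
        rw [Multiset.toFinsupp_support, Multiset.mem_toFinset, Multiset.mem_coe] at hh
        exact hl.1 h hh
  unfold normalMonomial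
  rw [aux _ (Multiset.pairwise_sort _ _), Multiset.sort_eq, Finsupp.toMultiset_toFinsupp]

/-- The deformed Heisenberg algebra is, as a vector space, the space of symbols: the normally
ordered monomial of `m` corresponds to `X^m`. -/
def symbolEquiv (r : ℕ) : Heis q₁ q₂ r ≃ₗ[K] MvPolynomial (Idx r) K :=
  LinearEquiv.ofLinearMap
    ((LinearMap.applyₗ (1 : MvPolynomial (Idx r) K)) ∘ₗ (symbolRep q₁ q₂).toLinearMap)
    (quantize q₁ q₂)
    (by
      refine (MvPolynomial.basisMonomials (Idx r) K).ext fun m => ?_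
      simp [quantize_monomial, symbolRep_normalMonomial])
    (by
      ext1 x
      have h1 : quantize q₁ q₂ (1 : MvPolynomial (Idx r) K) = 1 := by
        have := quantize_monomial q₁ q₂ (r := r) 0
        simpa [normalMonomial] using this
      simpa [h1] using quantize_symbolRep q₁ q₂ x 1)

/-- The basis of the deformed Heisenberg algebra consisting of the normally ordered monomials. -/
def heisBasis (r : ℕ) : Module.Basis (Idx r →₀ ℕ) K (Heis q₁ q₂ r) :=
  (MvPolynomial.basisMonomials (Idx r) K).map (symbolEquiv q₁ q₂ r).symm

theorem heisBasis_apply (m : Idx r →₀ ℕ) : heisBasis q₁ q₂ r m = normalMonomial q₁ q₂ m := by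
  rw [← quantize_monomial, heisBasis, Module.Basis.map_apply, MvPolynomial.coe_basisMonomials]
  rfl

end Basis

/-! ### The completion -/

/-- The completed deformed Heisenberg algebra: formal infinite linear combinations of the
normally ordered monomials.  The power series `∑ A_m X^m` stands for `∑ A_m · normalMonomial m`.
The (commutative) multiplication of power series is therefore the normally ordered product
`: A B :`; the genuine product, extending that of `Heis`, is `starMul` below. -/
abbrev HeisHat (K : Type*) [Field K] (r : ℕ) : Type _ := MvPowerSeries (Idx r) K

/-- The inclusion of the deformed Heisenberg algebra in its completion. -/
def toHat {K : Type*} [Field K] (q₁ q₂ : K) {r : ℕ} (x : Heis q₁ q₂ r) : HeisHat K r :=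
  fun l => (heisBasis q₁ q₂ r).repr x l

/-- The contribution of the `m`-th term of `A` and of the `n`-th term of `B` to the coefficient
of the `l`-th basis vector in the product of `A` and `B`. -/
def starTerm {K : Type*} [Field K] (q₁ q₂ : K) {r : ℕ} (A B : HeisHat K r) (l : Idx r →₀ ℕ)
    (mn : (Idx r →₀ ℕ) × (Idx r →₀ ℕ)) : K :=
  MvPowerSeries.coeff mn.1 A * MvPowerSeries.coeff mn.2 B *
    (heisBasis q₁ q₂ r).repr (normalMonomial q₁ q₂ mn.1 * normalMonomial q₁ q₂ mn.2) l

/-- The product of `A` and `B` is well defined in the completion: each of its coefficients is a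
sum with finitely many nonzero terms. -/
def StarSummable {K : Type*} [Field K] (q₁ q₂ : K) {r : ℕ} (A B : HeisHat K r) : Prop :=
  ∀ l, (Function.support (starTerm q₁ q₂ A B l)).Finite

/-- The product of `A` and `B` in the completion (meaningful when `StarSummable A B`). -/
def starMul {K : Type*} [Field K] (q₁ q₂ : K) {r : ℕ} (A B : HeisHat K r) : HeisHat K r :=
  fun l => ∑ᶠ mn, starTerm q₁ q₂ A B l mn

/-- The commutator `[A, B]` in the completion. -/
def starComm {K : Type*} [Field K] (q₁ q₂ : K) {r : ℕ} (A B : HeisHat K r) : HeisHat K r :=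
  starMul q₁ q₂ A B - starMul q₁ q₂ B A

/-! ### Bosons and currents -/

/-- The boson `p_n`, the sum of `b_n^i q^{n(i-1)}` over the colours `1 ≤ i ≤ r`. -/
def boson {K : Type*} [Field K] (q₁ q₂ : K) (r : ℕ) (n : Mode) : Heis q₁ q₂ r :=
  ∑ i : Fin r, ((q₁ * q₂) ^ (n.1 * (i : ℤ))) • gen q₁ q₂ (idx n i)

/-- The field `b^i(c x)`, i.e. the sum of `b_n^i / (|n| (c x)^n)` over all nonzero integers `n`,
as an infinite linear combination of generators whose coefficients are Laurent polynomials in the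
variable `x` (denoted by `T`). -/
def bosonField {K : Type*} [Field K] {r : ℕ} (c : K) (i : Fin r) :
    MvPowerSeries (Idx r) K[T;T⁻¹] :=
  fun l => ∑ᶠ n : Mode, MvPowerSeries.coeff l
    (MvPowerSeries.monomial (Finsupp.single (idx n i) 1)
      (LaurentPolynomial.C (c ^ (-n.1) / (n.1.natAbs : K)) * LaurentPolynomial.T (-n.1)))

/-- The normally ordered exponential `Λ^i(c x) = u_i : exp [b^i(c x)] :`. -/
def vertex {K : Type*} [Field K] [CharZero K] {r : ℕ} (u : Fin r → K) (c : K) (i : Fin r) :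
    MvPowerSeries (Idx r) K[T;T⁻¹] :=
  MvPowerSeries.C (LaurentPolynomial.C (u i)) * (PowerSeries.exp ℚ).subst (bosonField c i)

open Classical in
/-- The current `W_k(x)`: the sum over `i_1 < ... < i_k` of the normally ordered products
`: Λ^{i_1}(x) Λ^{i_2}(x / q) ... Λ^{i_k}(x / q^{k-1}) :`. -/
def wCurrent {K : Type*} [Field K] [CharZero K] (q₁ q₂ : K) {r : ℕ} (u : Fin r → K) (k : ℕ) :
    MvPowerSeries (Idx r) K[T;T⁻¹] :=
  ∑ i : Fin k → Fin r with StrictMono i,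
    ∏ s : Fin k, vertex u ((q₁ * q₂) ^ (-(s : ℤ))) (i s)

/-- The mode `W_{d,k}`, i.e. the coefficient of `x^{-d}` in `W_k(x)`. -/
def wMode {K : Type*} [Field K] [CharZero K] (q₁ q₂ : K) {r : ℕ} (u : Fin r → K) (k : ℕ) (d : ℤ) :
    HeisHat K r :=
  fun l => (MvPowerSeries.coeff l (wCurrent q₁ q₂ u k)).coeff (-d)

/-! ### The structure functions -/

/-- `ζ(x) = (1 - q₁ x)(1 - q₂ x) / ((1 - x)(1 - q x))`. -/
def zeta {K : Type*} [Field K] (q₁ q₂ x : K) : K :=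
  ((1 - q₁ * x) * (1 - q₂ * x)) / ((1 - x) * (1 - q₁ * q₂ * x))

/-- `θ(s) = (1 - q₁)(1 - q₂) / (1 - q) · ζ(q) ⋯ ζ(q^{s-1})`, for `s ≥ 1`. -/
def theta {K : Type*} [Field K] (q₁ q₂ : K) (s : ℕ) : K :=
  (1 - q₁) * (1 - q₂) / (1 - q₁ * q₂) * ∏ t ∈ Finset.Ico 1 s, zeta q₁ q₂ ((q₁ * q₂) ^ t)

/-- The power series `f_{k k'}(z)`; the truncated difference `k - k'` is `max(0, k - k')`. -/
def fSeries {K : Type*} [Field K] [CharZero K] (q₁ q₂ : K) (k k' : ℕ) : K⟦X⟧ :=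
  (PowerSeries.exp ℚ).subst (PowerSeries.mk fun n : ℕ =>
    (1 - q₁ ^ n) * (1 - q₂ ^ n) * ((q₁ * q₂) ^ ((k - k') * n) - (q₁ * q₂) ^ (k * n)) /
      (n * (1 - (q₁ * q₂) ^ n)))

/-! ### Formal distributions with coefficients in the completion

A family `A : ℤ → HeisHat K r` stands for `∑ A_d x^{-d}`, and `G : ℤ → ℤ → HeisHat K r` stands for
`∑ G_{a,b} x^{-a} y^{-b}`. -/

/-- The `n`-th term of the coefficient of `x^{-a} y^{-b}` in `A(x) B(y) f(y/x)`, where `f(y/x)` is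
expanded in nonnegative powers of `y/x`. -/
def currentTerm {K : Type*} [Field K] (q₁ q₂ : K) {r : ℕ} (A B : ℤ → HeisHat K r) (f : K⟦X⟧)
    (a b : ℤ) (n : ℕ) : HeisHat K r :=
  PowerSeries.coeff n f • starMul q₁ q₂ (A (a - n)) (B (b + n))

/-- `A(x) B(y) f(y/x)` is well defined: all products of modes are, and every coefficient of
`x^{-a} y^{-b}` is a sum which is finite on each basis vector. -/
def CurrentSummable {K : Type*} [Field K] (q₁ q₂ : K) {r : ℕ} (A B : ℤ → HeisHat K r)
    (f : K⟦X⟧) : Prop :=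
  (∀ a b, StarSummable q₁ q₂ (A a) (B b)) ∧
    ∀ a b l, (Function.support fun n : ℕ =>
      MvPowerSeries.coeff l (currentTerm q₁ q₂ A B f a b n)).Finite

/-- The formal distribution `A(x) B(y) f(y/x)` (meaningful when `CurrentSummable A B f`). -/
def currentMul {K : Type*} [Field K] (q₁ q₂ : K) {r : ℕ} (A B : ℤ → HeisHat K r) (f : K⟦X⟧)
    (a b : ℤ) : HeisHat K r :=
  fun l => ∑ᶠ n : ℕ, MvPowerSeries.coeff l (currentTerm q₁ q₂ A B f a b n)

/-- `Z(y) = G(x, y)|_{x = y/c}`.  On each basis vector, the coefficient of `y^{-d}` in `G`, as a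
series in `z = y/x`, is the expansion at `z = 0` of a rational function `R` which is regular at
`z = c`, and the corresponding coefficient of `Z` is the value `R(c)`. -/
def IsRestriction {K : Type*} [Field K] {r : ℕ} (G : ℤ → ℤ → HeisHat K r) (c : K)
    (Z : ℤ → HeisHat K r) : Prop :=
  ∀ (d : ℤ) (l : Idx r →₀ ℕ), ∃ R : RatFunc K,
    (∀ a : ℤ, MvPowerSeries.coeff l (G a (d - a)) = (R : LaurentSeries K).coeff a) ∧
    R.denom.eval c ≠ 0 ∧ R.eval (RingHom.id K) c = MvPowerSeries.coeff l (Z d)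

/-- The coefficient of `x^{-a} y^{-b}` in `δ(y / (x c)) Z(y)`, where `δ(t) = ∑ t^n` over all
integers `n`. -/
def deltaMul {K : Type*} [Field K] {r : ℕ} (c : K) (Z : ℤ → HeisHat K r) (a b : ℤ) :
    HeisHat K r :=
  c ^ (-a) • Z (a + b)

end

end DeformedW

open DeformedW

/-!
Each current `W_k(x)` is a sum, over the sets `I` of `k` colours, of normally ordered exponentials of
linear combinations of the generators.  Writing the multiplication of the algebra on symbols, where
an annihilation operator acts as a multiplication plus a derivation, shows that an annihilation
operator acts on an exponential as its symbol plus a scalar.  Hence the product of two exponentials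
is their normally ordered product times a scalar series in `z = y / x`, the contraction factor
(`coeff_starMul_expMode`), and the commutator with a boson multiplies an exponential by a scalar, in
which the sum over the colours of the boson telescopes (`starComm_wMode_boson_neg`,
`starComm_wMode_boson_pos`).

The exponent of the contraction factor of the terms `I` and `J` of `W_k(x)` and `W_{k'}(y)`
telescopes too: together with `f_{k k'}(z)` it equals the product of `ζ(q^h z)` over the colours `i` in
`I \ J`, where `h` is the number of elements of `I` below `i` minus that of `J`, divided by a product
of functions `ζ(q^s z)` depending only on `k` and `k'` (`expWeight_mul_fSeries`).  So each coefficient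
of `W_k(x) W_{k'}(y) f_{k k'}(z)` is the expansion at `z = 0` of an explicit rational function
(`coeff_currentMul_wMode`), a sum over pairs of sets of colours.  The functional equation
`ζ(1 / (q z)) = ζ(z)` implies that the product in the opposite order is the expansion at `z = ∞` of the
same rational function (`currentFunc_symm`).  The difference of the two expansions of a rational
function with simple poles is the sum over its nonzero poles of the residue times a delta function
(`expansionDiff_eq_sum`), and it remains to find the poles and the residues.

They come from a recursion over the colours.  Let `A(s, t)` be the sum over pairs of sets of sizes `s`
and `t` of colours below a given one; adding a colour expresses it by four such sums
(`pathSum_succ`).  By induction, `A(s, t)` is regular at `z = q^m` for `m ≥ 0` and `s - t ≤ -m`, and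
otherwise has at most a simple pole there, with residue `θ(s - t + m)` times the value of
`A(t - m, s + m)` (`regAt_pathSum`).  The reason is that at `y = q^m x` the exponentials of the pairs of
sizes `(s, t)` and `(t - m, s + m)` are located at the same points; the factors `ζ` of the two recursions
match by the functional equation and `θ(n + 1) = θ(n) ζ(q^n)`.  At `s - t = -m` two terms of the
recursion have poles, and these cancel because the residues of `ζ` at `1` and `q⁻¹` are opposite.
The value of `A(k' - i, k + i)` at `z = q^i` is the restriction in the quadratic relation, and the
poles at `z = q^{-i}` follow by exchanging the two currents.
-/

namespace DeformedW

noncomputable section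

/-! ### Exponentials of linear series -/

section FormalExponential

variable {σ : Type*} (K : Type*) {R : Type*} [Field K] [CommRing R] [Algebra K R]

/-- The exponential of the linear series `∑ γ_g X_g`, written out coefficient by coefficient so that
it makes sense over every algebra over a field `K` of characteristic zero, from which the inverse
factorials are taken. -/
def mvExp (γ : σ → R) : MvPowerSeries σ R :=
  fun l => l.prod fun g k => algebraMap K R ((k.factorial : K)⁻¹) * γ g ^ k

theorem coeff_mvExp (γ : σ → R) (l : σ →₀ ℕ) :
    MvPowerSeries.coeff l (mvExp K γ) =
      l.prod fun g k => algebraMap K R ((k.factorial : K)⁻¹) * γ g ^ k := rfl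

theorem constantCoeff_mvExp (γ : σ → R) :
    MvPowerSeries.constantCoeff (mvExp K γ) = 1 := by
  rw [← MvPowerSeries.coeff_zero_eq_constantCoeff_apply, coeff_mvExp, Finsupp.prod_zero_index]

theorem coeff_mvExp_eq_prod (γ : σ → R) (l : σ →₀ ℕ) (s : Finset σ) (hs : l.support ⊆ s) :
    MvPowerSeries.coeff l (mvExp K γ) =
      ∏ g ∈ s, algebraMap K R (((l g).factorial : K)⁻¹) * γ g ^ l g := by
  rw [coeff_mvExp, Finsupp.prod_of_support_subset _ hs]
  simp

/-- Exponentials commute with homomorphisms applied to the coefficients of the exponent. -/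
theorem map_coeff_mvExp {S : Type*} [CommRing S] [Algebra K S] (f : R →ₐ[K] S) (γ : σ → R)
    (l : σ →₀ ℕ) :
    f (MvPowerSeries.coeff l (mvExp K γ)) = MvPowerSeries.coeff l (mvExp K fun g => f (γ g)) := by
  simp [coeff_mvExp, Finsupp.prod, map_prod]

/-- Rescaling the variables of an exponential. -/
theorem coeff_mvExp_mul (c γ : σ → R) (l : σ →₀ ℕ) :
    MvPowerSeries.coeff l (mvExp K fun g => c g * γ g) =
      (l.prod fun g k => c g ^ k) * MvPowerSeries.coeff l (mvExp K γ) := by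
  simp only [coeff_mvExp, Finsupp.prod, ← Finset.prod_mul_distrib]
  exact Finset.prod_congr rfl fun _ _ => by ring

theorem coeff_mvExp_eq_zero (γ : σ → R) {l : σ →₀ ℕ} {g : σ} (hg : l g ≠ 0) (h : γ g = 0) :
    MvPowerSeries.coeff l (mvExp K γ) = 0 := by
  rw [coeff_mvExp]
  refine Finset.prod_eq_zero (Finsupp.mem_support_iff.mpr hg) ?_
  simp [h, zero_pow hg]

/-- The linear series `∑ γ_g X_g`. -/
def linearSeries (γ : σ → R) : MvPowerSeries σ R := by
  classical
  exact fun l => ∑ g ∈ l.support, if l = Finsupp.single g 1 then γ g else 0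

theorem coeff_linearSeries_single (γ : σ → R) (g : σ) :
    MvPowerSeries.coeff (Finsupp.single g 1) (linearSeries γ) = γ g := by
  classical
  show ∑ g' ∈ (Finsupp.single g 1).support, _ = _
  rw [Finsupp.support_single _ one_ne_zero]
  simp

theorem coeff_linearSeries_of_degree_ne_one (γ : σ → R) {l : σ →₀ ℕ} (hl : l.degree ≠ 1) :
    MvPowerSeries.coeff l (linearSeries γ) = 0 := by
  classical
  refine Finset.sum_eq_zero fun g _ => if_neg ?_
  rintro rfl
  simp at hl

theorem constantCoeff_linearSeries (γ : σ → R) :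
    MvPowerSeries.constantCoeff (linearSeries γ) = 0 := by
  rw [← MvPowerSeries.coeff_zero_eq_constantCoeff_apply]
  exact coeff_linearSeries_of_degree_ne_one γ (by simp)

theorem pderiv_linearSeries (γ : σ → R) (h : σ) :
    MvPowerSeries.pderiv R h (linearSeries γ) = MvPowerSeries.C (γ h) := by
  classical
  ext l
  rw [MvPowerSeries.coeff_pderiv, MvPowerSeries.coeff_C]
  split_ifs with hl
  · subst hl
    simp [coeff_linearSeries_single]
  · rw [coeff_linearSeries_of_degree_ne_one, zero_mul]
    rw [map_add, Finsupp.degree_single]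
    intro h0
    exact hl ((Finsupp.degree_eq_zero_iff l).mp (by omega))

variable [CharZero K]

theorem natCast_mul_coeff_mvExp (γ : σ → R) (l : σ →₀ ℕ) (h : σ) :
    ((l h + 1 : ℕ) : R) * MvPowerSeries.coeff (l + Finsupp.single h 1) (mvExp K γ) =
      γ h * MvPowerSeries.coeff l (mvExp K γ) := by
  classical
  have h1 : (l + Finsupp.single h 1).support ⊆ insert h l.support := by
    intro g hg
    by_contra hc
    rw [Finset.mem_insert, not_or, Finsupp.notMem_support_iff] at hc
    rw [Finsupp.mem_support_iff, Finsupp.add_apply, hc.2,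
      Finsupp.single_apply, if_neg (Ne.symm hc.1)] at hg
    exact hg rfl
  rw [coeff_mvExp_eq_prod K γ _ _ h1, coeff_mvExp_eq_prod K γ l _ (Finset.subset_insert h _),
    ← Finset.mul_prod_erase _ _ (Finset.mem_insert_self h _),
    ← Finset.mul_prod_erase _ _ (Finset.mem_insert_self h _)]
  rw [Finset.prod_congr (g := fun g => algebraMap K R (((l g).factorial : K)⁻¹) * γ g ^ l g) rfl
    fun g hg => ?_]
  swap
  · simp [Ne.symm (Finset.ne_of_mem_erase hg)]
  have h3 : ((l h + 1 : ℕ) : R) = algebraMap K R ((l h + 1 : ℕ) : K) := by simp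
  have h4 : ((l h + 1 : ℕ) : K) ≠ 0 := Nat.cast_ne_zero.mpr (Nat.succ_ne_zero _)
  have h5 : ((l h + 1 : ℕ) : R) * algebraMap K R (((l h + 1).factorial : K)⁻¹) =
      algebraMap K R (((l h).factorial : K)⁻¹) := by
    rw [h3, ← map_mul, Nat.factorial_succ, Nat.cast_mul, mul_inv, mul_inv_cancel_left₀ h4]
  rw [Finsupp.add_apply, Finsupp.single_eq_same, ← mul_assoc, ← mul_assoc, h5, pow_succ]
  ring

theorem pderiv_mvExp (γ : σ → R) (h : σ) :
    MvPowerSeries.pderiv R h (mvExp K γ) = MvPowerSeries.C (γ h) * mvExp K γ := by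
  ext l
  rw [MvPowerSeries.coeff_pderiv, MvPowerSeries.coeff_C_mul, ← natCast_mul_coeff_mvExp]
  push_cast
  ring

theorem isUnit_natCast_succ (K : Type*) {R : Type*} [Field K] [CharZero K] [CommRing R]
    [Algebra K R] (n : ℕ) : IsUnit ((n + 1 : ℕ) : R) := by
  have h3 : ((n + 1 : ℕ) : R) = algebraMap K R ((n + 1 : ℕ) : K) := by simp
  rw [h3]
  exact (isUnit_iff_ne_zero.mpr (Nat.cast_ne_zero.mpr (Nat.succ_ne_zero _))).map _

theorem exists_eq_add_single {l : σ →₀ ℕ} (hl : l ≠ 0) :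
    ∃ (l' : σ →₀ ℕ) (h : σ), l = l' + Finsupp.single h 1 := by
  obtain ⟨h, hh⟩ := Finsupp.ne_iff.mp hl
  refine ⟨l - Finsupp.single h 1, h, ?_⟩
  rw [tsub_add_cancel_of_le]
  rw [Finsupp.single_le_iff]
  exact Nat.one_le_iff_ne_zero.mpr hh

/-- An exponential is determined by its constant term and its logarithmic derivatives. -/
theorem eq_mvExp (γ : σ → R) {F : MvPowerSeries σ R} (h0 : MvPowerSeries.constantCoeff F = 1)
    (h1 : ∀ h, MvPowerSeries.pderiv R h F = MvPowerSeries.C (γ h) * F) : F = mvExp K γ := by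
  have key : ∀ n : ℕ, ∀ l : σ →₀ ℕ, l.degree = n →
      MvPowerSeries.coeff l F = MvPowerSeries.coeff l (mvExp K γ) := by
    intro n
    induction n with
    | zero =>
      intro l hl
      have : l = 0 := (Finsupp.degree_eq_zero_iff l).mp hl
      subst this
      simp [constantCoeff_mvExp, h0]
    | succ n ih =>
      intro l hl
      have : l ≠ 0 := by
        rintro rfl
        simp at hl
      obtain ⟨l', h, rfl⟩ := exists_eq_add_single this
      rw [map_add, Finsupp.degree_single] at hl
      have e := congrArg (MvPowerSeries.coeff l') (h1 h)
      rw [MvPowerSeries.coeff_pderiv, MvPowerSeries.coeff_C_mul, ih l' (by omega),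
        ← natCast_mul_coeff_mvExp, mul_comm] at e
      refine (isUnit_natCast_succ K (R := R) (l' h)).mul_left_cancel ?_
      rw [← e]
      push_cast
      ring
  ext l
  exact key _ l rfl

theorem mvExp_add (α β : σ → R) : mvExp K (α + β) = mvExp K α * mvExp K β := by
  symm
  apply eq_mvExp
  · simp [constantCoeff_mvExp]
  · intro h
    rw [Derivation.leibniz, pderiv_mvExp, pderiv_mvExp, Pi.add_apply, map_add, smul_eq_mul,
      smul_eq_mul]
    ring

theorem mvExp_zero : mvExp K (0 : σ → R) = 1 := by
  symm
  apply eq_mvExp <;> simp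

theorem mvExp_sum {ι : Type*} (s : Finset ι) (α : ι → σ → R) :
    mvExp K (∑ i ∈ s, α i) = ∏ i ∈ s, mvExp K (α i) := by
  classical
  induction s using Finset.induction_on with
  | empty => simp [mvExp_zero]
  | insert a s ha ih => rw [Finset.sum_insert ha, Finset.prod_insert ha, mvExp_add, ih]

theorem eq_linearSeries (γ : σ → R) {F : MvPowerSeries σ R}
    (h1 : ∀ g, MvPowerSeries.coeff (Finsupp.single g 1) F = γ g)
    (h0 : ∀ l : σ →₀ ℕ, l.degree ≠ 1 → MvPowerSeries.coeff l F = 0) : F = linearSeries γ := by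
  ext l
  by_cases hl : l.degree = 1
  · obtain ⟨l', h, rfl⟩ := exists_eq_add_single (l := l) (by rintro rfl; simp at hl)
    rw [map_add, Finsupp.degree_single, Nat.add_eq_right, Finsupp.degree_eq_zero_iff] at hl
    rw [hl, zero_add, h1, coeff_linearSeries_single]
  · rw [h0 l hl, coeff_linearSeries_of_degree_ne_one γ hl]

theorem coeff_linearSeries_pow (γ : σ → R) (d : ℕ) (l : σ →₀ ℕ) :
    MvPowerSeries.coeff l (linearSeries γ ^ d) =
      if l.degree = d then (d.factorial : R) * MvPowerSeries.coeff l (mvExp K γ) else 0 := by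
  induction d generalizing l with
  | zero =>
    classical
    rw [pow_zero, MvPowerSeries.coeff_one]
    simp only [Finsupp.degree_eq_zero_iff]
    split_ifs with hl
    · subst hl
      simp [constantCoeff_mvExp]
    · rfl
  | succ d ih =>
    by_cases hl : l = 0
    · subst hl
      simp [constantCoeff_linearSeries]
    · obtain ⟨l', h, rfl⟩ := exists_eq_add_single hl
      have e := congrArg (MvPowerSeries.coeff l') (MvPowerSeries.pderiv_pow (R := R) (i := h)
        (linearSeries γ) (d + 1))
      rw [MvPowerSeries.coeff_pderiv, pderiv_linearSeries, Nat.add_sub_cancel, mul_comm _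
        (MvPowerSeries.C _), MvPowerSeries.coeff_C_mul,
        show ((d + 1 : ℕ) : MvPowerSeries σ R) = MvPowerSeries.C ((d + 1 : ℕ) : R) by simp,
        MvPowerSeries.coeff_C_mul, ih] at e
      refine (isUnit_natCast_succ K (R := R) (l' h)).mul_left_cancel ?_
      rw [mul_comm]
      push_cast at e ⊢
      rw [e, map_add, Finsupp.degree_single]
      simp only [Nat.add_right_cancel_iff]
      split_ifs
      · have := natCast_mul_coeff_mvExp K γ l' h
        push_cast at this
        rw [Nat.factorial_succ]
        push_cast
        linear_combination (-(d + 1) * d.factorial : R) * this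
      · simp

/-- Substituting a linear series into the exponential series gives `mvExp`. -/
theorem exp_subst_linearSeries [Algebra ℚ R] (γ : σ → R) :
    (PowerSeries.exp ℚ).subst (linearSeries γ) = mvExp K γ := by
  ext l
  rw [PowerSeries.coeff_subst
    (PowerSeries.HasSubst.of_constantCoeff_zero (constantCoeff_linearSeries γ)),
    finsum_eq_single _ l.degree]
  · rw [coeff_linearSeries_pow K, if_pos rfl, PowerSeries.coeff_exp, eq_ratCast, Rat.cast_id,
      Algebra.smul_def, ← mul_assoc]
    have : ((l.degree.factorial : ℕ) : R) = algebraMap ℚ R (l.degree.factorial : ℚ) := by simp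
    rw [this, ← map_mul, one_div, inv_mul_cancel₀, map_one, one_mul]
    exact Nat.cast_ne_zero.mpr (Nat.factorial_ne_zero _)
  · intro d hd
    rw [coeff_linearSeries_pow K, if_neg (Ne.symm hd), smul_zero]

end FormalExponential

/-! ### The coefficients of the modes of the currents -/

section Currents

/-- The weight `∑ m_g · mode g` of a multiplicity function. -/
def weight (r : ℕ) : (Idx r →₀ ℕ) →+ ℤ := Finsupp.weight mode

theorem weight_single {r : ℕ} (g : Idx r) (k : ℕ) :
    weight r (Finsupp.single g k) = k * mode g := by
  simp [weight, Finsupp.weight_apply]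

theorem weight_eq_sum {r : ℕ} (l : Idx r →₀ ℕ) :
    weight r l = l.sum fun g k => (k : ℤ) * mode g := by
  simp [weight, Finsupp.weight_apply]

variable {K : Type*} [Field K] {r : ℕ}

/-- The coefficient of `b_g` in the field `b^i(c x)` at `x = 1`. -/
def fieldCoeff (c : K) (i : Fin r) (g : Idx r) : K :=
  if colour g = i then c ^ (-mode g) / ((mode g).natAbs : K) else 0

theorem bosonField_eq_linearSeries (c : K) (i : Fin r) :
    bosonField c i = linearSeries fun g : Idx r =>
      (LaurentPolynomial.T (-mode g) * LaurentPolynomial.C (fieldCoeff c i g) : K[T;T⁻¹]) := by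
  classical
  apply eq_linearSeries
  · intro g
    show ∑ᶠ n : Mode, _ = _
    rw [finsum_eq_single _ (ofLex g).1]
    · rw [MvPowerSeries.coeff_monomial]
      unfold fieldCoeff colour
      by_cases h : (ofLex g).2 = i
      · have : g = idx (ofLex g).1 i := by
          rw [← h]; rfl
        rw [if_pos h, if_pos (by rw [← this]), mul_comm]
        rfl
      · rw [if_neg h, if_neg, map_zero, mul_zero]
        intro h1
        have := Finsupp.single_left_injective (one_ne_zero) h1
        exact h (by rw [this]; rfl)
    · intro n hn
      rw [MvPowerSeries.coeff_monomial, if_neg]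
      intro h1
      have := Finsupp.single_left_injective (one_ne_zero) h1
      exact hn (by rw [this]; rfl)
  · intro l hl
    show ∑ᶠ n : Mode, _ = _
    refine finsum_eq_zero_of_forall_eq_zero fun n => ?_
    rw [MvPowerSeries.coeff_monomial, if_neg]
    rintro rfl
    simp at hl

theorem vertex_eq_mvExp [CharZero K] (u : Fin r → K) (c : K) (i : Fin r) :
    vertex u c i = MvPowerSeries.C (LaurentPolynomial.C (u i)) *
      mvExp K fun g : Idx r =>
        (LaurentPolynomial.T (-mode g) * LaurentPolynomial.C (fieldCoeff c i g) : K[T;T⁻¹]) := by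
  rw [vertex, bosonField_eq_linearSeries, exp_subst_linearSeries K]

theorem prod_T_pow (l : Idx r →₀ ℕ) :
    (l.prod fun g k => (LaurentPolynomial.T (-mode g) : K[T;T⁻¹]) ^ k) =
      LaurentPolynomial.T (-weight r l) := by
  classical
  rw [weight_eq_sum, Finsupp.prod, Finsupp.sum]
  induction l.support using Finset.induction_on with
  | empty => simp
  | insert a s ha ih =>
    rw [Finset.prod_insert ha, Finset.sum_insert ha, ih, LaurentPolynomial.T_pow, neg_add,
      LaurentPolynomial.T_add]
    ring_nf

open Classical in
/-- A mode of a current is the part of one weight of a sum of exponentials: the exponent of each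
term depends on `x` only through the factor `x^{-n}` of a generator `b_n^i`, so that the monomial of
`l` carries `x^{-weight l}`. -/
theorem coeff_wMode_eq_sum_strictMono [CharZero K] (q₁ q₂ : K) (u : Fin r → K) (k : ℕ) (d : ℤ)
    (l : Idx r →₀ ℕ) :
    MvPowerSeries.coeff l (wMode q₁ q₂ u k d) = if weight r l = d then
      ∑ i : Fin k → Fin r with StrictMono i, (∏ s, u (i s)) *
        MvPowerSeries.coeff l (mvExp K (∑ s : Fin k, fieldCoeff ((q₁ * q₂) ^ (-(s : ℤ))) (i s)))
      else 0 := by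
  have key : MvPowerSeries.coeff l (wCurrent q₁ q₂ u k) =
      LaurentPolynomial.T (-weight r l) * LaurentPolynomial.C
        (∑ i : Fin k → Fin r with StrictMono i, (∏ s, u (i s)) * MvPowerSeries.coeff l
          (mvExp K (∑ s : Fin k, fieldCoeff ((q₁ * q₂) ^ (-(s : ℤ))) (i s)))) := by
    rw [wCurrent, map_sum, map_sum, Finset.mul_sum]
    refine Finset.sum_congr rfl fun i _ => ?_
    simp only [vertex_eq_mvExp]
    rw [Finset.prod_mul_distrib, ← map_prod, ← map_prod, MvPowerSeries.coeff_C_mul,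
      ← mvExp_sum]
    have e : (∑ s : Fin k, fun g : Idx r => (LaurentPolynomial.T (-mode g) * LaurentPolynomial.C
        (fieldCoeff ((q₁ * q₂) ^ (-(s : ℤ))) (i s) g) : K[T;T⁻¹])) =
        fun g : Idx r => LaurentPolynomial.T (-mode g) * (Algebra.ofId K K[T;T⁻¹])
          ((∑ s : Fin k, fieldCoeff ((q₁ * q₂) ^ (-(s : ℤ))) (i s)) g) := by
      funext g
      rw [Finset.sum_apply, Finset.sum_apply, map_sum, Finset.mul_sum]
      rfl
    rw [e, coeff_mvExp_mul, ← map_coeff_mvExp, prod_T_pow, map_mul, mul_left_comm]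
    rfl
  show (MvPowerSeries.coeff l (wCurrent q₁ q₂ u k)).coeff (-d) = _
  rw [key, mul_comm, ← LaurentPolynomial.single_eq_C_mul_T]
  split_ifs with h
  · rw [h]
    exact Finsupp.single_eq_same
  · exact Finsupp.single_eq_of_ne (by omega)

/-- The number of elements of `I` below `i`. -/
def below (I : Finset (Fin r)) (i : Fin r) : ℕ := (I.filter (· < i)).card

/-- The coefficients of the exponent of `: ∏ Λ^{i_s}(x / q^{s-1}) :` at `x = 1`, where
`i_1 < i_2 < ...` are the elements of `I`. -/
def setCoeff (q : K) (I : Finset (Fin r)) (g : Idx r) : K :=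
  if colour g ∈ I then q ^ (mode g * below I (colour g)) / ((mode g).natAbs : K) else 0

theorem below_image {k : ℕ} {i : Fin k → Fin r} (hi : StrictMono i) (s : Fin k) :
    below (Finset.univ.image i) (i s) = s := by
  have : (Finset.univ.image i).filter (· < i s) = (Finset.univ.filter (· < s)).image i := by
    ext a
    simp only [Finset.mem_filter, Finset.mem_image, Finset.mem_univ, true_and]
    constructor
    · rintro ⟨⟨b, rfl⟩, h⟩
      exact ⟨b, hi.lt_iff_lt.mp h, rfl⟩
    · rintro ⟨b, h, rfl⟩
      exact ⟨⟨b, rfl⟩, hi h⟩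
  rw [below, this, Finset.card_image_of_injective _ hi.injective]
  have : Finset.univ.filter (· < s) = Finset.Iio s := by
    ext; simp
  rw [this, Fin.card_Iio]

theorem sum_fieldCoeff {k : ℕ} (q : K) {i : Fin k → Fin r} (hi : StrictMono i) :
    (∑ s : Fin k, fieldCoeff (q ^ (-(s : ℤ))) (i s)) = setCoeff q (Finset.univ.image i) := by
  funext g
  rw [Finset.sum_apply]
  unfold fieldCoeff setCoeff
  split_ifs with h
  · obtain ⟨s, -, hs⟩ := Finset.mem_image.mp h
    rw [Finset.sum_eq_single s]
    · rw [if_pos hs.symm, ← hs, below_image hi, ← zpow_mul, neg_mul_neg, mul_comm]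
    · intro t _ ht
      rw [if_neg]
      rw [← hs]
      exact fun h => ht (hi.injective h.symm)
    · simp
  · refine Finset.sum_eq_zero fun s _ => if_neg ?_
    intro h'
    exact h (h' ▸ Finset.mem_image_of_mem _ (Finset.mem_univ _))

/-- The increasing sequences of colours in the definition of `W_k` are replaced by sets of colours. -/
theorem coeff_wMode [CharZero K] (q₁ q₂ : K) (u : Fin r → K) (k : ℕ) (d : ℤ)
    (l : Idx r →₀ ℕ) :
    MvPowerSeries.coeff l (wMode q₁ q₂ u k d) = if weight r l = d then
      ∑ I ∈ Finset.powersetCard k Finset.univ, (∏ i ∈ I, u i) *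
        MvPowerSeries.coeff l (mvExp K (setCoeff (q₁ * q₂) I))
      else 0 := by
  classical
  rw [coeff_wMode_eq_sum_strictMono]
  congr 1
  refine Finset.sum_bij (fun i _ => Finset.univ.image i) ?_ ?_ ?_ ?_
  · intro i hi
    rw [Finset.mem_filter] at hi
    rw [Finset.mem_powersetCard, Finset.card_image_of_injective _ hi.2.injective]
    simp
  · intro i hi j hj h
    rw [Finset.mem_filter] at hi hj
    refine (hi.2.range_inj hj.2).mp ?_
    have := congrArg (fun s : Finset (Fin r) => (s : Set (Fin r))) h
    simpa using this
  · intro I hI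
    rw [Finset.mem_powersetCard] at hI
    refine ⟨I.orderEmbOfFin hI.2, ?_, ?_⟩
    · simpa using (I.orderEmbOfFin hI.2).strictMono
    · apply Finset.coe_injective
      simp
  · intro i hi
    rw [Finset.mem_filter] at hi
    rw [sum_fieldCoeff _ hi.2, Finset.prod_image fun a _ b _ h => hi.2.injective h]

end Currents

/-! ### Structure constants in the basis of normally ordered monomials -/

section StructureConstants

variable {r : ℕ}

theorem mode_ne_zero (g : Idx r) : mode g ≠ 0 := (ofLex g).1.2

theorem mode_le_of_le {g h : Idx r} (hgh : g ≤ h) : mode g ≤ mode h := by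
  rcases Prod.Lex.le_iff.mp hgh with h1 | h1
  · exact le_of_lt h1
  · exact le_of_eq (congrArg Subtype.val h1.1)

theorem eq_of_mode_eq_of_colour_eq {g h : Idx r} (h1 : mode g = mode h)
    (h2 : colour g = colour h) : g = h :=
  toLex.symm.injective (Prod.ext (Subtype.ext h1) h2)

/-- The label of `b_{-n}^i`, where `n` is the mode of `g`. -/
def opp (g : Idx r) (i : Fin r) : Idx r := idx ⟨-mode g, neg_ne_zero.mpr (mode_ne_zero g)⟩ i

theorem mode_opp (g : Idx r) (i : Fin r) : mode (opp g i) = -mode g := rfl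

theorem eq_opp {g h : Idx r} (hgh : mode h = -mode g) : h = opp g (colour h) :=
  eq_of_mode_eq_of_colour_eq hgh rfl

theorem opp_injective (g : Idx r) : Function.Injective (opp g) := fun i j h => by
  exact congrArg colour h

variable {K : Type*} [Field K] (q₁ q₂ : K)

theorem bracket_eq_zero {g h : Idx r} (hgh : mode h ≠ -mode g) : bracket q₁ q₂ g h = 0 :=
  if_neg (by omega)

theorem derivation_sum_apply {R A M ι : Type*} [CommSemiring R] [CommSemiring A]
    [AddCommMonoid M] [Algebra R A] [Module A M] [Module R M] (s : Finset ι)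
    (D : ι → Derivation R A M) (a : A) : (∑ i ∈ s, D i) a = ∑ i ∈ s, D i a := by
  have := congrFun (map_sum (Derivation.coeFnAddMonoidHom (R := R) (A := A) (M := M)) D s) a
  rw [Finset.sum_apply] at this
  exact this

/-- The action of a generator on symbols, as a differential operator. -/
theorem contraction_apply (g : Idx r) (p : MvPolynomial (Idx r) K) :
    contraction q₁ q₂ g p = if 0 < mode g then
      ∑ i, bracket q₁ q₂ g (opp g i) • MvPolynomial.pderiv (opp g i) p else 0 := by
  classical
  have : contraction q₁ q₂ g = if 0 < mode g then
      ∑ i, bracket q₁ q₂ g (opp g i) • MvPolynomial.pderiv (opp g i) else 0 := by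
    apply MvPolynomial.derivation_ext
    intro h
    rw [contraction_X]
    split_ifs with hg
    · rw [derivation_sum_apply]
      simp only [Derivation.smul_apply, MvPolynomial.pderiv_X]
      by_cases hh : mode h = -mode g
      · obtain ⟨i, rfl⟩ : ∃ i, h = opp g i := ⟨_, eq_opp hh⟩
        rw [Finset.sum_eq_single i]
        · simp [MvPolynomial.smul_eq_C_mul]
        · intro j _ hj
          rw [Pi.single_eq_of_ne, smul_zero]
          exact fun h => hj (opp_injective g h).symm
        · simp
      · rw [bracket_eq_zero _ _ hh, map_zero, Finset.sum_eq_zero]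
        intro i _
        rw [Pi.single_eq_of_ne, smul_zero]
        rintro rfl
        exact hh rfl
    · simp
  rw [this]
  split_ifs with hg
  · rw [derivation_sum_apply]
    rfl
  · rfl

theorem coeff_genAction (g : Idx r) (p : MvPolynomial (Idx r) K) (l : Idx r →₀ ℕ) :
    MvPolynomial.coeff l (genAction q₁ q₂ g p) =
      (if Finsupp.single g 1 ≤ l then MvPolynomial.coeff (l - Finsupp.single g 1) p else 0) +
      (if 0 < mode g then ∑ i, bracket q₁ q₂ g (opp g i) *
        ((l (opp g i) + 1 : ℕ) * MvPolynomial.coeff (l + Finsupp.single (opp g i) 1) p) else 0) := by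
  rw [genAction_apply, MvPolynomial.coeff_add, MvPolynomial.X, MvPolynomial.coeff_monomial_mul',
    contraction_apply]
  simp only [one_mul]
  congr 1
  split_ifs
  · rw [MvPolynomial.coeff_sum]
    refine Finset.sum_congr rfl fun i _ => ?_
    rw [MvPolynomial.coeff_smul, MvPolynomial.coeff_pderiv, smul_eq_mul]
    push_cast
    ring
  · simp

/-- The coefficient at the normally ordered monomial of `l` of the product of those of `m`
and `n`. -/
def structConst (l m n : Idx r →₀ ℕ) : K :=
  (heisBasis q₁ q₂ r).repr (normalMonomial q₁ q₂ m * normalMonomial q₁ q₂ n) l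

theorem repr_eq_coeff (x : Heis q₁ q₂ r) (l : Idx r →₀ ℕ) :
    (heisBasis q₁ q₂ r).repr x l = MvPolynomial.coeff l (symbolRep q₁ q₂ x 1) := by
  rw [heisBasis, Module.Basis.map_repr]
  rfl

theorem structConst_eq_coeff (l m n : Idx r →₀ ℕ) :
    structConst q₁ q₂ l m n = MvPolynomial.coeff l
      (symbolRep q₁ q₂ (normalMonomial q₁ q₂ m) (MvPolynomial.monomial n 1)) := by
  rw [structConst, repr_eq_coeff, map_mul, Module.End.mul_apply, symbolRep_normalMonomial]

/-- Multiplication by an ordered product of generators is homogeneous, can only increase the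
multiplicity of an annihilation operator of the right factor, and can only increase that of a
creation operator of the left factor. -/
theorem coeff_symbolRep_ne_zero {L : List (Idx r)} (hL : L.Pairwise (· ≤ ·))
    {n : Idx r →₀ ℕ} {l : Idx r →₀ ℕ}
    (h : MvPolynomial.coeff l (symbolRep q₁ q₂ (L.map (gen q₁ q₂)).prod
      (MvPolynomial.monomial n 1)) ≠ 0) :
    weight r l = (L.map mode).sum + weight r n ∧ (∀ g, 0 < mode g → n g ≤ l g) ∧
      ∀ g, mode g < 0 → (L : Multiset (Idx r)).count g ≤ l g := by
  induction L generalizing l with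
  | nil =>
    rw [List.map_nil, List.prod_nil, map_one, Module.End.one_apply, MvPolynomial.coeff_monomial]
      at h
    have : n = l := by
      by_contra hc
      exact h (if_neg hc)
    subst this
    simp
  | cons g t ih =>
    rw [List.pairwise_cons] at hL
    rw [List.map_cons, List.prod_cons, map_mul, Module.End.mul_apply, symbolRep_gen,
      coeff_genAction] at h
    by_cases h1 : Finsupp.single g 1 ≤ l ∧ MvPolynomial.coeff (l - Finsupp.single g 1)
      (symbolRep q₁ q₂ (t.map (gen q₁ q₂)).prod (MvPolynomial.monomial n 1)) ≠ 0
    · obtain ⟨i1, i2, i3⟩ := ih hL.2 h1.2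
      have hl : l = (l - Finsupp.single g 1) + Finsupp.single g 1 :=
        (tsub_add_cancel_of_le h1.1).symm
      refine ⟨?_, ?_, ?_⟩
      · rw [hl, map_add, i1, weight_single, List.map_cons, List.sum_cons]
        push_cast
        ring
      · intro g' hg'
        exact (i2 g' hg').trans (by simp)
      · intro g' hg'
        rw [hl, Finsupp.add_apply, ← Multiset.cons_coe, Multiset.count_cons]
        refine add_le_add (i3 g' hg') ?_
        rw [Finsupp.single_apply]
        simp only [eq_comm, le_refl]
    · have h2 : (if Finsupp.single g 1 ≤ l then MvPolynomial.coeff (l - Finsupp.single g 1)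
          (symbolRep q₁ q₂ (t.map (gen q₁ q₂)).prod (MvPolynomial.monomial n 1)) else 0) = 0 := by
        split_ifs with h3
        · by_contra h4
          exact h1 ⟨h3, h4⟩
        · rfl
      rw [h2, zero_add] at h
      have hg : 0 < mode g := by
        by_contra hc
        exact h (if_neg hc)
      rw [if_pos hg] at h
      obtain ⟨i, -, hi⟩ := Finset.exists_ne_zero_of_sum_ne_zero h
      obtain ⟨i1, i2, i3⟩ := ih hL.2 (right_ne_zero_of_mul (right_ne_zero_of_mul hi))
      refine ⟨?_, ?_, ?_⟩
      · rw [map_add, weight_single, mode_opp] at i1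
        rw [List.map_cons, List.sum_cons]
        push_cast at i1
        linarith
      · intro g' hg'
        have := i2 g' hg'
        rwa [Finsupp.add_apply, Finsupp.single_apply, if_neg, add_zero] at this
        rintro rfl
        rw [mode_opp] at hg'
        omega
      · intro g' hg'
        rw [Multiset.count_eq_zero_of_notMem]
        · exact Nat.zero_le _
        · intro hmem
          have : mode g ≤ mode g' := by
            rcases List.mem_cons.mp (Multiset.mem_coe.mp hmem) with rfl | h5
            · exact le_rfl
            · exact mode_le_of_le (hL.1 g' h5)
          omega

@[to_additive]
theorem map_prod_sort {M : Type*} [CommMonoid M] (f : Idx r → M) (m : Idx r →₀ ℕ) :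
    (((Finsupp.toMultiset m).sort (· ≤ ·)).map f).prod = m.prod fun g k => f g ^ k := by
  rw [← Multiset.prod_coe, ← Multiset.map_coe, Multiset.sort_eq, Finsupp.toMultiset_map,
    Finsupp.prod_toMultiset, Finsupp.prod_mapDomain_index (fun _ => pow_zero _)
      (fun _ _ _ => pow_add _ _ _)]

/-- Which products of basis vectors may involve the basis vector of `l`; this makes the products of
homogeneous elements of the completion well defined. -/
theorem structConst_ne_zero {l m n : Idx r →₀ ℕ} (h : structConst q₁ q₂ l m n ≠ 0) :
    weight r l = weight r m + weight r n ∧ (∀ g, 0 < mode g → n g ≤ l g) ∧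
      ∀ g, mode g < 0 → m g ≤ l g := by
  rw [structConst_eq_coeff, normalMonomial] at h
  obtain ⟨h1, h2, h3⟩ := coeff_symbolRep_ne_zero q₁ q₂ (Multiset.pairwise_sort _ _) h
  refine ⟨?_, h2, fun g hg => ?_⟩
  · rw [h1]
    congr 1
    rw [map_sum_sort, weight_eq_sum]
    simp
  · have := h3 g hg
    rwa [Multiset.sort_eq, Finsupp.count_toMultiset] at this

/-- The scalar by which an annihilation operator `b_g` differs from multiplication by its symbol
on the exponential `mvExp K β`; it is zero for a creation operator. -/
def annihilate (β : Idx r → K) (g : Idx r) : K :=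
  if 0 < mode g then ∑ i, bracket q₁ q₂ g (opp g i) * β (opp g i) else 0

theorem pderiv_prod_eq_zero {h : Idx r} {t : List (Idx r)} (ht : h ∉ t) (c : Idx r → K) :
    MvPowerSeries.pderiv K h
      (t.map fun g => (MvPowerSeries.X g + MvPowerSeries.C (c g) : HeisHat K r)).prod = 0 := by
  induction t with
  | nil => simp
  | cons g t ih =>
    rw [List.mem_cons, not_or] at ht
    rw [List.map_cons, List.prod_cons, Derivation.leibniz, ih ht.2, map_add,
      MvPowerSeries.pderiv_X_of_ne (Ne.symm ht.1), MvPowerSeries.pderiv_C]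
    simp

/-- Acting by an ordered product of generators on an exponential: each `b_g` multiplies by
`X_g + annihilate β g`.  The coefficient at `l` of the result depends on finitely many coefficients
only, which are collected in the row `w` of the operator. -/
theorem exists_row [CharZero K] (β : Idx r → K) {L : List (Idx r)} (hL : L.Pairwise (· ≤ ·))
    (l : Idx r →₀ ℕ) :
    ∃ w : (Idx r →₀ ℕ) →₀ K,
      (∀ n, MvPolynomial.coeff l (symbolRep q₁ q₂ (L.map (gen q₁ q₂)).prod
        (MvPolynomial.monomial n 1)) = w n) ∧
      Finsupp.linearCombination K (fun n => MvPowerSeries.coeff n (mvExp K β)) w =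
        MvPowerSeries.coeff l ((L.map fun g => MvPowerSeries.X g +
          MvPowerSeries.C (annihilate q₁ q₂ β g)).prod * mvExp K β) := by
  classical
  induction L generalizing l with
  | nil =>
    refine ⟨Finsupp.single l 1, fun n => ?_, ?_⟩
    · rw [List.map_nil, List.prod_nil, map_one, Module.End.one_apply,
        MvPolynomial.coeff_monomial, Finsupp.single_apply]
      simp only [eq_comm]
    · simp
  | cons g t ih =>
    rw [List.pairwise_cons] at hL
    choose w hw1 hw2 using ih hL.2
    refine ⟨(if Finsupp.single g 1 ≤ l then w (l - Finsupp.single g 1) else 0) +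
      (if 0 < mode g then ∑ i, bracket q₁ q₂ g (opp g i) •
        (((l (opp g i) + 1 : ℕ) : K) • w (l + Finsupp.single (opp g i) 1)) else 0),
      fun n => ?_, ?_⟩
    · rw [List.map_cons, List.prod_cons, map_mul, Module.End.mul_apply, symbolRep_gen,
        coeff_genAction, Finsupp.add_apply]
      simp only [hw1]
      congr 1
      · split_ifs <;> rfl
      · split_ifs
        · rw [Finsupp.finsetSum_apply]
          rfl
        · rfl
    · rw [map_add, List.map_cons, List.prod_cons, mul_assoc, add_mul, map_add,
        MvPowerSeries.X, MvPowerSeries.coeff_monomial_mul, MvPowerSeries.coeff_C_mul]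
      simp only [one_mul]
      congr 1
      · split_ifs
        · exact hw2 _
        · exact map_zero _
      · rw [annihilate]
        split_ifs with hg
        · rw [map_sum, Finset.sum_mul]
          refine Finset.sum_congr rfl fun i _ => ?_
          rw [map_smul, map_smul, hw2, smul_eq_mul, smul_eq_mul, mul_assoc]
          congr 1
          -- The list is ordered, so the creation operator `opp g i` does not occur to the right of
          -- the annihilation operator `g`: the derivative passes through to the exponential.
          have hnot : opp g i ∉ t := fun hmem => by
            have := mode_le_of_le (hL.1 _ hmem)
            rw [mode_opp] at this
            omega
          have e := congrArg (MvPowerSeries.coeff l) (Derivation.leibniz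
            (MvPowerSeries.pderiv K (opp g i)) (t.map fun g => (MvPowerSeries.X g +
              MvPowerSeries.C (annihilate q₁ q₂ β g) : HeisHat K r)).prod (mvExp K β))
          rw [pderiv_prod_eq_zero hnot, pderiv_mvExp, smul_zero, add_zero,
            MvPowerSeries.coeff_pderiv, smul_eq_mul, mul_left_comm,
            MvPowerSeries.coeff_C_mul] at e
          change _ = β (opp g i) * MvPowerSeries.coeff l ((t.map fun g => MvPowerSeries.X g +
            MvPowerSeries.C (annihilate q₁ q₂ β g)).prod * mvExp K β)
          rw [← e, mul_comm]
          push_cast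
          rfl
        · simp

/-- Acting by a normally ordered monomial on an exponential. -/
theorem exists_structConst_row [CharZero K] (β : Idx r → K) (l m : Idx r →₀ ℕ) :
    ∃ w : (Idx r →₀ ℕ) →₀ K, (∀ n, structConst q₁ q₂ l m n = w n) ∧
      Finsupp.linearCombination K (fun n => MvPowerSeries.coeff n (mvExp K β)) w =
        MvPowerSeries.coeff l ((m.prod fun g k => (MvPowerSeries.X g +
          MvPowerSeries.C (annihilate q₁ q₂ β g)) ^ k) * mvExp K β) := by
  obtain ⟨w, h1, h2⟩ := exists_row q₁ q₂ β (Multiset.pairwise_sort (Finsupp.toMultiset m) _) l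
  refine ⟨w, fun n => ?_, ?_⟩
  · rw [structConst_eq_coeff, normalMonomial, h1]
  · rw [h2, map_prod_sort]

/-- The product of a normally ordered monomial and an exponential. -/
theorem finsum_mul_structConst [CharZero K] (β : Idx r → K) (l m : Idx r →₀ ℕ) :
    ∑ᶠ n, MvPowerSeries.coeff n (mvExp K β) * structConst q₁ q₂ l m n =
        MvPowerSeries.coeff l ((m.prod fun g k => (MvPowerSeries.X g +
          MvPowerSeries.C (annihilate q₁ q₂ β g)) ^ k) * mvExp K β) := by
  obtain ⟨w, h1, h2⟩ := exists_structConst_row q₁ q₂ β l m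
  rw [← h2, Finsupp.linearCombination_apply, Finsupp.sum]
  rw [finsum_eq_sum_of_support_subset (s := w.support)]
  · refine Finset.sum_congr rfl fun n _ => ?_
    rw [h1, smul_eq_mul, mul_comm]
  · intro n hn
    rw [Function.mem_support, h1] at hn
    exact Finsupp.mem_support_iff.mpr (right_ne_zero_of_mul hn)

end StructureConstants

/-! ### Products of homogeneous elements of the completion -/

section Finiteness

variable {r : ℕ}

/-- The total weight `∑ m_g · |mode g|`. -/
def absWeight (r : ℕ) : (Idx r →₀ ℕ) →+ ℕ := Finsupp.weight fun g => (mode g).natAbs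

theorem absWeight_mono {m n : Idx r →₀ ℕ} (h : m ≤ n) : absWeight r m ≤ absWeight r n := by
  rw [← tsub_add_cancel_of_le h, map_add]
  exact Nat.le_add_left _ _

theorem mul_natAbs_le_absWeight (m : Idx r →₀ ℕ) (g : Idx r) :
    m g * (mode g).natAbs ≤ absWeight r m := by
  have : Finsupp.single g (m g) ≤ m := Finsupp.single_le_iff.mpr le_rfl
  have h := absWeight_mono this
  rwa [absWeight, Finsupp.weight_single, smul_eq_mul] at h

theorem finite_natAbs_mode_le (N : ℕ) : {g : Idx r | (mode g).natAbs ≤ N}.Finite := by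
  have hinj : Function.Injective fun g : Idx r => (mode g, colour g) := by
    intro g h hgh
    have h1 : mode g = mode h := congrArg (fun p : ℤ × Fin r => p.1) hgh
    have h2 : colour g = colour h := congrArg (fun p : ℤ × Fin r => p.2) hgh
    exact eq_of_mode_eq_of_colour_eq h1 h2
  refine Set.Finite.of_finite_image ?_ hinj.injOn
  refine Set.Finite.subset ((Set.finite_Icc (-(N : ℤ)) N).prod (Set.finite_univ (α := Fin r))) ?_
  rintro _ ⟨g, hg, rfl⟩
  rw [Set.mem_ofPred_eq] at hg
  refine ⟨?_, Set.mem_univ _⟩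
  simp only [Set.mem_Icc]
  omega

theorem finite_absWeight_le (N : ℕ) : {m : Idx r →₀ ℕ | absWeight r m ≤ N}.Finite := by
  classical
  refine Set.Finite.subset
    (Set.finite_Iic (∑ g ∈ (finite_natAbs_mode_le (r := r) N).toFinset, Finsupp.single g N)) ?_
  intro m hm g
  rw [Set.mem_ofPred_eq] at hm
  have h1 := (mul_natAbs_le_absWeight m g).trans hm
  have h2 : 1 ≤ (mode g).natAbs := by
    have := mode_ne_zero g
    omega
  rw [Finsupp.finsetSum_apply]
  by_cases h3 : m g = 0
  · rw [h3]; exact Nat.zero_le _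
  · have h4 : g ∈ (finite_natAbs_mode_le (r := r) N).toFinset := by
      rw [Set.Finite.mem_toFinset, Set.mem_ofPred_eq]
      nlinarith [Nat.pos_of_ne_zero h3]
    refine le_trans ?_ (Finset.single_le_sum (fun _ _ => Nat.zero_le _) h4)
    rw [Finsupp.single_eq_same]
    nlinarith

theorem weight_eq_sub (m : Idx r →₀ ℕ) : weight r m =
    absWeight r (m.filter fun g => 0 < mode g) -
      absWeight r (m.filter fun g => ¬ 0 < mode g) := by
  induction m using Finsupp.induction_linear with
  | zero => simp [Finsupp.filter_zero]
  | add f g hf hg =>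
    rw [map_add, hf, hg, Finsupp.filter_add, Finsupp.filter_add, map_add, map_add]
    push_cast
    ring
  | single g k =>
    have hs : ∀ k, absWeight r (Finsupp.single g k) = k * (mode g).natAbs := fun k => by
      rw [absWeight, Finsupp.weight_single, smul_eq_mul]
    rw [weight_single]
    by_cases hg : 0 < mode g
    · rw [Finsupp.filter_single_of_pos (fun g => 0 < mode g) hg,
        Finsupp.filter_single_of_neg (fun g => ¬ 0 < mode g) (not_not.mpr hg), hs, map_zero]
      push_cast
      rw [abs_of_pos hg]
      ring
    · rw [Finsupp.filter_single_of_neg (fun g => 0 < mode g) hg,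
        Finsupp.filter_single_of_pos (fun g => ¬ 0 < mode g) hg, hs, map_zero]
      push_cast
      rw [abs_of_nonpos (not_lt.mp hg)]
      ring

theorem absWeight_eq_add (m : Idx r →₀ ℕ) : absWeight r m =
    absWeight r (m.filter fun g => 0 < mode g) +
      absWeight r (m.filter fun g => ¬ 0 < mode g) := by
  rw [← map_add, Finsupp.filter_add_filter_not]

theorem filter_le_of {p : Idx r → Prop} [DecidablePred p] {m l : Idx r →₀ ℕ}
    (h : ∀ g, p g → m g ≤ l g) : m.filter p ≤ l := by
  intro g
  by_cases hg : p g
  · rw [Finsupp.filter_apply_pos _ _ hg]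
    exact h g hg
  · rw [Finsupp.filter_apply_neg _ _ hg]
    exact Nat.zero_le _

/-- When the multiplicities of the creation operators are bounded, the weight bounds those of the
annihilation operators. -/
theorem finite_weight_eq_of_neg_le (l : Idx r →₀ ℕ) (a : ℤ) :
    {m : Idx r →₀ ℕ | weight r m = a ∧ ∀ g, mode g < 0 → m g ≤ l g}.Finite := by
  refine (finite_absWeight_le (a + 2 * absWeight r l).toNat).subset ?_
  rintro m ⟨h1, h2⟩
  have h3 := absWeight_mono (filter_le_of (p := fun g => ¬ 0 < mode g) (m := m) (l := l)
    fun g hg => h2 g (by have := mode_ne_zero g; omega))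
  have h4 := weight_eq_sub m
  have h5 := absWeight_eq_add m
  rw [Set.mem_ofPred_eq]
  omega

theorem finite_weight_eq_of_pos_le (l : Idx r →₀ ℕ) (b : ℤ) :
    {n : Idx r →₀ ℕ | weight r n = b ∧ ∀ g, 0 < mode g → n g ≤ l g}.Finite := by
  refine (finite_absWeight_le (2 * absWeight r l - b).toNat).subset ?_
  rintro m ⟨h1, h2⟩
  have h3 := absWeight_mono (filter_le_of (p := fun g => 0 < mode g) (m := m) (l := l) h2)
  have h4 := weight_eq_sub m
  have h5 := absWeight_eq_add m
  rw [Set.mem_ofPred_eq]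
  omega

theorem finite_weight_eq_of_nonneg (a : ℤ) :
    {m : Idx r →₀ ℕ | weight r m = a ∧ ∀ g, mode g < 0 → m g = 0}.Finite := by
  refine (finite_weight_eq_of_neg_le 0 a).subset ?_
  rintro m ⟨h1, h2⟩
  exact ⟨h1, fun g hg => (h2 g hg).le⟩

theorem weight_nonneg {m : Idx r →₀ ℕ} (h : ∀ g, mode g < 0 → m g = 0) : 0 ≤ weight r m := by
  rw [weight_eq_sum]
  refine Finset.sum_nonneg fun g hg => ?_
  have : ¬ mode g < 0 := fun h' => Finsupp.mem_support_iff.mp hg (h g h')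
  have := Int.natCast_nonneg (m g)
  exact mul_nonneg this (by omega)

variable {K : Type*} [Field K]

/-- All terms of `A` have weight `a`. -/
def IsHomogeneous (a : ℤ) (A : HeisHat K r) : Prop :=
  ∀ m, weight r m ≠ a → MvPowerSeries.coeff m A = 0

/-- The pairs of monomials of weights `a` and `b` whose product may involve the monomial of `l`. -/
def relevantPairs (l : Idx r →₀ ℕ) (a b : ℤ) : Finset ((Idx r →₀ ℕ) × (Idx r →₀ ℕ)) :=
  ((finite_weight_eq_of_neg_le l a).prod (finite_weight_eq_of_pos_le l b)).toFinset

variable (q₁ q₂ : K)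

theorem support_starTerm_subset {A B : HeisHat K r} {a b : ℤ} (hA : IsHomogeneous a A)
    (hB : IsHomogeneous b B) (l : Idx r →₀ ℕ) :
    Function.support (starTerm q₁ q₂ A B l) ⊆ relevantPairs l a b := by
  rintro ⟨m, n⟩ h
  rw [Function.mem_support] at h
  have h1 := left_ne_zero_of_mul (left_ne_zero_of_mul h)
  have h2 := right_ne_zero_of_mul (left_ne_zero_of_mul h)
  obtain ⟨-, h3, h4⟩ := structConst_ne_zero q₁ q₂ (right_ne_zero_of_mul h)
  rw [relevantPairs, Set.Finite.coe_toFinset]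
  exact ⟨⟨by by_contra hc; exact h1 (hA m hc), h4⟩, ⟨by by_contra hc; exact h2 (hB n hc), h3⟩⟩

/-- Products of homogeneous elements of the completion are well defined. -/
theorem IsHomogeneous.starSummable {A B : HeisHat K r} {a b : ℤ} (hA : IsHomogeneous a A)
    (hB : IsHomogeneous b B) : StarSummable q₁ q₂ A B := fun l =>
  (Finset.finite_toSet _).subset (support_starTerm_subset q₁ q₂ hA hB l)

theorem coeff_starMul {A B : HeisHat K r} {a b : ℤ} (hA : IsHomogeneous a A)
    (hB : IsHomogeneous b B) (l : Idx r →₀ ℕ) :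
    MvPowerSeries.coeff l (starMul q₁ q₂ A B) = ∑ p ∈ relevantPairs l a b,
      MvPowerSeries.coeff p.1 A * MvPowerSeries.coeff p.2 B * structConst q₁ q₂ l p.1 p.2 :=
  finsum_eq_sum_of_support_subset _ (support_starTerm_subset q₁ q₂ hA hB l)

theorem coeff_starMul_eq_finsum {A B : HeisHat K r} {a b : ℤ} (hA : IsHomogeneous a A)
    (hB : IsHomogeneous b B) (l : Idx r →₀ ℕ) :
    MvPowerSeries.coeff l (starMul q₁ q₂ A B) = ∑ᶠ m, ∑ᶠ n,
      MvPowerSeries.coeff m A * MvPowerSeries.coeff n B * structConst q₁ q₂ l m n :=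
  finsum_curry _ (hA.starSummable q₁ q₂ hB l)

theorem IsHomogeneous.sum_smul {ι : Type*} {s : Finset ι} {a : ℤ} {c : ι → K}
    {A : ι → HeisHat K r} (h : ∀ i ∈ s, IsHomogeneous a (A i)) :
    IsHomogeneous a (∑ i ∈ s, c i • A i) := by
  intro m hm
  rw [map_sum]
  refine Finset.sum_eq_zero fun i hi => ?_
  rw [map_smul, h i hi m hm, smul_zero]

/-- The product is bilinear on homogeneous elements.  It is not additive in general, the sums
defining it being zero by convention where they are infinite. -/
theorem starMul_sum_smul {ι κ : Type*} {s : Finset ι} {t : Finset κ} {a b : ℤ} {c : ι → K}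
    {d : κ → K} {A : ι → HeisHat K r} {B : κ → HeisHat K r}
    (hA : ∀ i ∈ s, IsHomogeneous a (A i)) (hB : ∀ j ∈ t, IsHomogeneous b (B j)) :
    starMul q₁ q₂ (∑ i ∈ s, c i • A i) (∑ j ∈ t, d j • B j) =
      ∑ i ∈ s, ∑ j ∈ t, (c i * d j) • starMul q₁ q₂ (A i) (B j) := by
  ext l
  rw [coeff_starMul q₁ q₂ (IsHomogeneous.sum_smul hA) (IsHomogeneous.sum_smul hB)]
  have h : ∀ p ∈ relevantPairs l a b,
      MvPowerSeries.coeff p.1 (∑ i ∈ s, c i • A i) * MvPowerSeries.coeff p.2 (∑ j ∈ t, d j • B j) *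
        structConst q₁ q₂ l p.1 p.2 = ∑ i ∈ s, ∑ j ∈ t, (c i * d j) * (MvPowerSeries.coeff p.1 (A i) *
          MvPowerSeries.coeff p.2 (B j) * structConst q₁ q₂ l p.1 p.2) := by
    intro p _
    rw [map_sum, map_sum, Finset.sum_mul_sum, Finset.sum_mul]
    refine Finset.sum_congr rfl fun i _ => ?_
    rw [Finset.sum_mul]
    refine Finset.sum_congr rfl fun j _ => ?_
    rw [map_smul, map_smul, smul_eq_mul, smul_eq_mul]
    ring
  rw [Finset.sum_congr rfl h, Finset.sum_comm, map_sum]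
  refine Finset.sum_congr rfl fun i hi => ?_
  rw [Finset.sum_comm, map_sum]
  refine Finset.sum_congr rfl fun j hj => ?_
  rw [map_smul, smul_eq_mul, coeff_starMul q₁ q₂ (hA i hi) (hB j hj), Finset.mul_sum]

end Finiteness

/-! ### Reindexing finite sums over multiplicity functions -/

section Finsum

theorem finsum_sum_antidiagonal {A M : Type*} [AddCommMonoid A] [Finset.HasAntidiagonal A]
    [AddCommMonoid M] (f : A × A → M) (hf : (Function.support f).Finite) :
    ∑ᶠ m : A, ∑ p ∈ Finset.HasAntidiagonal.antidiagonal m, f p = ∑ᶠ p, f p := by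
  classical
  rw [finsum_eq_sum_of_support_subset f (s := hf.toFinset) (by simp),
    finsum_eq_sum_of_support_subset (s := hf.toFinset.image fun p => p.1 + p.2)]
  · rw [← Finset.sum_fiberwise_of_maps_to (s := hf.toFinset)
      (t := hf.toFinset.image fun p => p.1 + p.2) (g := fun p => p.1 + p.2)
      (fun p hp => Finset.mem_image_of_mem _ hp)]
    refine Finset.sum_congr rfl fun m _ => ?_
    symm
    refine Finset.sum_subset (fun p hp => ?_) fun p hp hp' => ?_
    · rw [Finset.mem_filter] at hp
      exact Finset.HasAntidiagonal.mem_antidiagonal.mpr hp.2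
    · rw [Finset.HasAntidiagonal.mem_antidiagonal] at hp
      rw [Finset.mem_filter, not_and] at hp'
      by_contra h
      exact hp' (by simpa using h) hp
  · intro m hm
    obtain ⟨p, hp, h0⟩ := Finset.exists_ne_zero_of_sum_ne_zero hm
    rw [Finset.coe_image]
    exact ⟨p, by simpa using h0, Finset.HasAntidiagonal.mem_antidiagonal.mp hp⟩

theorem finsum_eq_finsum_add_single {σ M : Type*} [AddCommMonoid M] (g : σ)
    (F : (σ →₀ ℕ) → M) (hF : ∀ y, y g = 0 → F y = 0) :
    ∑ᶠ y, F y = ∑ᶠ y, F (y + Finsupp.single g 1) := by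
  rw [← finsum_mem_range (add_left_injective (Finsupp.single g 1))]
  refine finsum_congr fun y => ?_
  by_cases hy : y g = 0
  · rw [hF y hy]
    simp
  · have : y ∈ Set.range fun x => x + Finsupp.single g 1 :=
      ⟨y - Finsupp.single g 1, tsub_add_cancel_of_le
        (Finsupp.single_le_iff.mpr (Nat.one_le_iff_ne_zero.mpr hy))⟩
    simp [this]

end Finsum

/-! ### Products of homogeneous parts of exponentials -/

section ProductOfExponentials

open Finset.HasAntidiagonal

variable {r : ℕ} {K : Type*} [Field K]

/-- The part of weight `a` of the exponential `mvExp K α`. -/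
def expMode (α : Idx r → K) (a : ℤ) : HeisHat K r :=
  fun m => if weight r m = a then MvPowerSeries.coeff m (mvExp K α) else 0

theorem coeff_expMode (α : Idx r → K) (a : ℤ) (m : Idx r →₀ ℕ) :
    MvPowerSeries.coeff m (expMode α a) =
      if weight r m = a then MvPowerSeries.coeff m (mvExp K α) else 0 := rfl

theorem isHomogeneous_expMode (α : Idx r → K) (a : ℤ) : IsHomogeneous a (expMode α a) :=
  fun _ hm => if_neg hm

/-- The coefficient of `z^w` in `exp (∑ γ_g z^(mode g))`.  The sum is finite when `γ` vanishes on the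
labels of negative mode. -/
def expWeight (γ : Idx r → K) (w : ℤ) : K :=
  ∑ᶠ y, MvPowerSeries.coeff y (expMode γ w)

theorem eq_zero_of_coeff_mvExp_ne_zero {γ : Idx r → K} (hγ : ∀ g, mode g < 0 → γ g = 0)
    {y : Idx r →₀ ℕ} (h : MvPowerSeries.coeff y (mvExp K γ) ≠ 0) (g : Idx r) (hg : mode g < 0) :
    y g = 0 := by
  by_contra hc
  exact h (coeff_mvExp_eq_zero K γ hc (hγ g hg))

theorem finite_support_expMode {γ : Idx r → K} (hγ : ∀ g, mode g < 0 → γ g = 0) (w : ℤ) :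
    (Function.support fun y => MvPowerSeries.coeff y (expMode γ w)).Finite := by
  refine (finite_weight_eq_of_nonneg w).subset ?_
  intro y hy
  rw [Function.mem_support, coeff_expMode, ne_eq, ite_eq_right_iff, Classical.not_imp] at hy
  exact ⟨hy.1, eq_zero_of_coeff_mvExp_ne_zero hγ hy.2⟩

theorem expWeight_of_neg {γ : Idx r → K} (hγ : ∀ g, mode g < 0 → γ g = 0) {w : ℤ} (hw : w < 0) :
    expWeight γ w = 0 := by
  refine finsum_eq_zero_of_forall_eq_zero fun y => ?_
  by_contra hy
  rw [coeff_expMode, ite_eq_right_iff, Classical.not_imp] at hy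
  have := weight_nonneg (eq_zero_of_coeff_mvExp_ne_zero hγ hy.2)
  omega

variable (q₁ q₂ : K)

theorem annihilate_of_neg (α β : Idx r → K) (g : Idx r) (hg : mode g < 0) :
    α g * annihilate q₁ q₂ β g = 0 := by
  rw [annihilate, if_neg (by omega), mul_zero]

variable [CharZero K]

/-- The binomial expansion of the product of the factors `X_g + annihilate β g`: the part `p.1` of
`m` remains normally ordered, the part `p.2` is contracted. -/
theorem coeff_mul_prod_annihilate (α β : Idx r → K) (l m : Idx r →₀ ℕ) :
    MvPowerSeries.coeff m (mvExp K α) * MvPowerSeries.coeff l ((m.prod fun g k =>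
      (MvPowerSeries.X g + MvPowerSeries.C (annihilate q₁ q₂ β g)) ^ k) * mvExp K β) =
    ∑ p ∈ antidiagonal m, if p.1 ≤ l then MvPowerSeries.coeff p.1 (mvExp K α) *
      MvPowerSeries.coeff (l - p.1) (mvExp K β) *
        MvPowerSeries.coeff p.2 (mvExp K fun g => α g * annihilate q₁ q₂ β g) else 0 := by
  classical
  have e1 : MvPowerSeries.C (MvPowerSeries.coeff m (mvExp K α)) * (m.prod fun g k =>
      (MvPowerSeries.X g + MvPowerSeries.C (annihilate q₁ q₂ β g) : HeisHat K r) ^ k) =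
      MvPowerSeries.coeff m (mvExp K fun g => (MvPowerSeries.X g * MvPowerSeries.C (α g) +
        MvPowerSeries.C (α g * annihilate q₁ q₂ β g) : HeisHat K r)) := by
    have : (fun g => (MvPowerSeries.X g * MvPowerSeries.C (α g) +
        MvPowerSeries.C (α g * annihilate q₁ q₂ β g) : HeisHat K r)) = fun g =>
        (MvPowerSeries.X g + MvPowerSeries.C (annihilate q₁ q₂ β g)) *
          (Algebra.ofId K (HeisHat K r)) (α g) := by
      funext g
      show _ = _ * MvPowerSeries.C (α g)
      rw [map_mul]
      ring
    rw [this, coeff_mvExp_mul, ← map_coeff_mvExp, mul_comm]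
    rfl
  have e2 : MvPowerSeries.coeff m (mvExp K fun g => (MvPowerSeries.X g * MvPowerSeries.C (α g) +
        MvPowerSeries.C (α g * annihilate q₁ q₂ β g) : HeisHat K r)) =
      ∑ p ∈ antidiagonal m, MvPowerSeries.monomial p.1 (MvPowerSeries.coeff p.1 (mvExp K α)) *
        MvPowerSeries.C (MvPowerSeries.coeff p.2
          (mvExp K fun g => α g * annihilate q₁ q₂ β g)) := by
    have h := mvExp_add K (fun g => (MvPowerSeries.X g * MvPowerSeries.C (α g) : HeisHat K r))
      (fun g => MvPowerSeries.C (α g * annihilate q₁ q₂ β g))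
    have h' := congrArg (MvPowerSeries.coeff m) h
    rw [MvPowerSeries.coeff_mul] at h'
    refine h'.trans (Finset.sum_congr rfl fun p _ => ?_)
    congr 1
    · have := coeff_mvExp_mul K (fun g => (MvPowerSeries.X g : HeisHat K r))
        (fun g => Algebra.ofId K (HeisHat K r) (α g)) p.1
      refine this.trans ?_
      rw [← map_coeff_mvExp, ← MvPowerSeries.monomial_one_eq]
      show _ * MvPowerSeries.C _ = _
      rw [← MvPowerSeries.monomial_zero_eq_C_apply, MvPowerSeries.monomial_mul_monomial, add_zero,
        one_mul]
    · exact (map_coeff_mvExp K (Algebra.ofId K (HeisHat K r)) _ _).symm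
  rw [← MvPowerSeries.coeff_C_mul, ← mul_assoc, e1, e2, Finset.sum_mul, map_sum]
  refine Finset.sum_congr rfl fun p _ => ?_
  rw [mul_assoc, MvPowerSeries.coeff_monomial_mul]
  split_ifs
  · rw [MvPowerSeries.coeff_C_mul]
    ring
  · rfl

/-- The product of the parts of weights `a` and `b` of two exponentials of linear series: the
normally ordered product, weighted by the contraction factor.  Of the weight `a`, the part
`weight r p.1` remains in the left factor and the rest is contracted. -/
theorem coeff_starMul_expMode (α β : Idx r → K) (a b : ℤ) (l : Idx r →₀ ℕ) :
    MvPowerSeries.coeff l (starMul q₁ q₂ (expMode α a) (expMode β b)) =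
      if weight r l = a + b then
        ∑ p ∈ antidiagonal l, MvPowerSeries.coeff p.1 (mvExp K α) *
          MvPowerSeries.coeff p.2 (mvExp K β) *
            expWeight (fun g => α g * annihilate q₁ q₂ β g) (a - weight r p.1)
      else 0 := by
  classical
  rw [coeff_starMul_eq_finsum q₁ q₂ (isHomogeneous_expMode α a) (isHomogeneous_expMode β b)]
  split_ifs with hl
  · set γ : Idx r → K := fun g => α g * annihilate q₁ q₂ β g with hγ
    have hγ0 : ∀ g, mode g < 0 → γ g = 0 := annihilate_of_neg q₁ q₂ α β
    set f : (Idx r →₀ ℕ) × (Idx r →₀ ℕ) → K := fun p =>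
      if p.1 ≤ l then MvPowerSeries.coeff p.1 (mvExp K α) *
        MvPowerSeries.coeff (l - p.1) (mvExp K β) *
          MvPowerSeries.coeff p.2 (expMode γ (a - weight r p.1)) else 0 with hf
    have h1 : ∀ m, (∑ᶠ n, MvPowerSeries.coeff m (expMode α a) * MvPowerSeries.coeff n (expMode β b) *
        structConst q₁ q₂ l m n) = ∑ p ∈ antidiagonal m, f p := by
      intro m
      by_cases hm : weight r m = a
      · have : ∀ n, MvPowerSeries.coeff m (expMode α a) * MvPowerSeries.coeff n (expMode β b) *
            structConst q₁ q₂ l m n = MvPowerSeries.coeff m (mvExp K α) *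
              (MvPowerSeries.coeff n (mvExp K β) * structConst q₁ q₂ l m n) := by
          intro n
          rw [coeff_expMode, if_pos hm, mul_assoc]
          by_cases hs : structConst q₁ q₂ l m n = 0
          · simp [hs]
          · have := (structConst_ne_zero q₁ q₂ hs).1
            rw [coeff_expMode, if_pos (by omega)]
        rw [finsum_congr this, ← mul_finsum, finsum_mul_structConst, coeff_mul_prod_annihilate]
        refine Finset.sum_congr rfl fun p hp => ?_
        rw [mem_antidiagonal] at hp
        rw [hf]
        dsimp only
        have h : weight r p.2 = a - weight r p.1 := by
          rw [← hm, ← hp, map_add]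
          ring
        rw [coeff_expMode, if_pos h]
      · rw [finsum_eq_zero_of_forall_eq_zero, Finset.sum_eq_zero]
        · intro p hp
          rw [mem_antidiagonal] at hp
          rw [hf]
          dsimp only
          have h : ¬ weight r p.2 = a - weight r p.1 := by
            intro h
            apply hm
            rw [← hp, map_add, h]
            ring
          rw [coeff_expMode, if_neg h, mul_zero, ite_self]
        · intro n
          rw [coeff_expMode, if_neg hm, zero_mul, zero_mul]
    have hsupp : Function.support f ⊆
        ⋃ x ∈ Set.Iic l, (fun y => (x, y)) '' Function.support
          fun y => MvPowerSeries.coeff y (expMode γ (a - weight r x)) := by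
      rintro ⟨x, y⟩ hp
      rw [Function.mem_support, hf] at hp
      dsimp only at hp
      rw [ne_eq, ite_eq_right_iff, Classical.not_imp] at hp
      simp only [Set.mem_iUnion]
      exact ⟨x, hp.1, y, right_ne_zero_of_mul hp.2, rfl⟩
    have hfin : (Function.support f).Finite := by
      refine Set.Finite.subset ?_ hsupp
      exact (Set.finite_Iic l).biUnion fun x _ => (finite_support_expMode hγ0 _).image _
    rw [finsum_congr h1, finsum_sum_antidiagonal f hfin, finsum_curry f hfin]
    rw [finsum_eq_sum_of_support_subset (s := Finset.Iic l)]
    · symm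
      refine Finset.sum_bij' (fun p _ => p.1) (fun x _ => (x, l - x)) ?_ ?_ ?_ ?_ ?_
      · intro p hp
        rw [mem_antidiagonal] at hp
        exact Finset.mem_Iic.mpr (hp ▸ le_self_add)
      · intro x hx
        exact mem_antidiagonal.mpr (add_tsub_cancel_of_le (Finset.mem_Iic.mp hx))
      · intro p hp
        rw [mem_antidiagonal] at hp
        exact Prod.ext rfl (by rw [← hp, add_tsub_cancel_left])
      · intro x _
        rfl
      · intro p hp
        rw [mem_antidiagonal] at hp
        have h2 : p.1 ≤ l := hp ▸ le_self_add
        have h3 : l - p.1 = p.2 := by rw [← hp, add_tsub_cancel_left]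
        rw [hf]
        simp only [h2, if_true, h3]
        rw [← mul_finsum]
        rfl
    · intro x hx
      rw [Function.mem_support] at hx
      by_contra hc
      apply hx
      refine finsum_eq_zero_of_forall_eq_zero fun y => ?_
      exact if_neg fun h => hc (Finset.mem_coe.mpr (Finset.mem_Iic.mpr h))
  · refine finsum_eq_zero_of_forall_eq_zero fun m => finsum_eq_zero_of_forall_eq_zero fun n => ?_
    by_contra hc
    have h1 := left_ne_zero_of_mul (left_ne_zero_of_mul hc)
    have h2 := right_ne_zero_of_mul (left_ne_zero_of_mul hc)
    have h3 := (structConst_ne_zero q₁ q₂ (right_ne_zero_of_mul hc)).1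
    rw [coeff_expMode, ne_eq, ite_eq_right_iff, Classical.not_imp] at h1 h2
    omega

end ProductOfExponentials

/-! ### Exponentials of power series -/

section PowerSeriesExponentials

open PowerSeries

variable {K : Type*} [Field K]

/-- `F` is the exponential of `g` (up to the constant term of `g`, which does not matter):
the solution of `F' = g' F` with constant term `1`. -/
def IsExpOf (g F : K⟦X⟧) : Prop :=
  constantCoeff F = 1 ∧ d⁄dX K F = d⁄dX K g * F

theorem isExpOf_zero : IsExpOf (0 : K⟦X⟧) 1 := by
  simp [IsExpOf]

theorem IsExpOf.mul {g g' F F' : K⟦X⟧} (h : IsExpOf g F) (h' : IsExpOf g' F') :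
    IsExpOf (g + g') (F * F') := by
  refine ⟨by rw [map_mul, h.1, h'.1, one_mul], ?_⟩
  rw [Derivation.leibniz, h.2, h'.2, map_add, smul_eq_mul, smul_eq_mul]
  ring

theorem IsExpOf.prod {ι : Type*} (s : Finset ι) {g F : ι → K⟦X⟧}
    (h : ∀ i ∈ s, IsExpOf (g i) (F i)) : IsExpOf (∑ i ∈ s, g i) (∏ i ∈ s, F i) := by
  classical
  induction s using Finset.induction_on with
  | empty => simpa using isExpOf_zero
  | insert a s ha ih =>
    rw [Finset.sum_insert ha, Finset.prod_insert ha]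
    exact (h a (Finset.mem_insert_self a s)).mul
      (ih fun i hi => h i (Finset.mem_insert_of_mem hi))

/-- An exponential is determined by its logarithm. -/
theorem IsExpOf.unique [CharZero K] {g F F' : K⟦X⟧} (h : IsExpOf g F) (h' : IsExpOf g F') :
    F = F' := by
  have hne : constantCoeff F' ≠ 0 := by rw [h'.1]; exact one_ne_zero
  have h1 : F * F'⁻¹ = 1 := by
    refine derivative.ext ?_ ?_
    · rw [derivative_one, Derivation.leibniz, derivative_inv', h.2, h'.2, smul_eq_mul, smul_eq_mul]
      have := PowerSeries.mul_inv_cancel F' hne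
      linear_combination (-(F * F'⁻¹ * (d⁄dX K) g)) * this
    · rw [map_mul, constantCoeff_inv, h.1, h'.1]
      simp
  calc F = F * F'⁻¹ * F' := by rw [mul_assoc, PowerSeries.inv_mul_cancel F' hne, mul_one]
    _ = F' := by rw [h1, one_mul]

theorem isExpOf_exp_subst [CharZero K] {g : K⟦X⟧} (hg : constantCoeff g = 0) :
    IsExpOf g ((PowerSeries.exp ℚ).subst g) := by
  have hs : HasSubst g := HasSubst.of_constantCoeff_zero' hg
  have hm : (PowerSeries.exp ℚ).subst g = (PowerSeries.exp K).subst g := by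
    ext n
    rw [coeff_subst' hs, coeff_subst' hs]
    refine finsum_congr fun d => ?_
    rw [coeff_exp, coeff_exp, Algebra.smul_def, eq_ratCast, smul_eq_mul]
    simp
  refine ⟨?_, ?_⟩
  · rw [← coeff_zero_eq_constantCoeff_apply, coeff_subst' hs, finsum_eq_single _ 0]
    · simp
    · intro n hn
      rw [coeff_zero_eq_constantCoeff_apply, map_pow, hg, zero_pow hn, smul_zero]
  · rw [hm, derivative_subst hs, derivative_exp, mul_comm]

/-- The logarithm of `1 - c z`. -/
theorem isExpOf_one_sub [CharZero K] (c : K) :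
    IsExpOf (mk fun n => -(c ^ n / n)) (1 - C c * X) := by
  refine ⟨by simp, ?_⟩
  have h : d⁄dX K (mk fun n : ℕ => -(c ^ n / n)) = mk fun n => -c ^ (n + 1) := by
    ext n
    rw [coeff_derivative, coeff_mk, coeff_mk]
    have : (n : K) + 1 ≠ 0 := Nat.cast_add_one_ne_zero n
    push_cast
    field_simp
  rw [h, map_sub, derivative_one, Derivation.leibniz, derivative_C, derivative_X]
  ext n
  rw [mul_sub, mul_one, map_sub, map_sub, coeff_mk, mul_left_comm, coeff_C_mul]
  cases n with
  | zero => simp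
  | succ n =>
    rw [coeff_succ_mul_X, coeff_mk]
    simp
    ring

end PowerSeriesExponentials

/-! ### The generating function of the contraction weights -/

section WeightGeneratingFunction

open PowerSeries

variable {r : ℕ} {K : Type*} [Field K]

/-- The power series `∑ γ_g z^(mode g)`, over the labels `g` of positive mode. -/
def modeSeries (γ : Idx r → K) : K⟦X⟧ :=
  mk fun n => if h : (n : ℤ) ≠ 0 then ∑ i, γ (idx ⟨n, h⟩ i) else 0

theorem coeff_modeSeries_succ (γ : Idx r → K) (n : ℕ) :
    coeff (n + 1) (modeSeries γ) = ∑ i, γ (idx ⟨((n + 1 : ℕ) : ℤ), by omega⟩ i) := by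
  rw [modeSeries, coeff_mk, dif_pos]

theorem mode_idx (n : Mode) (i : Fin r) : mode (idx n i) = n.1 := rfl

theorem colour_idx (n : Mode) (i : Fin r) : colour (idx n i) = i := rfl

/-- The weight of a monomial of nonnegative modes is the sum of its multiplicities times the modes. -/
theorem weight_mul_coeff_expMode {γ : Idx r → K} (hγ : ∀ g, mode g < 0 → γ g = 0) (w : ℕ)
    (y : Idx r →₀ ℕ) :
    (w : K) * MvPowerSeries.coeff y (expMode γ w) =
      ∑ j ∈ Finset.range w, ∑ i : Fin r, ((j + 1 : ℕ) : K) *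
        ((y (idx ⟨((j + 1 : ℕ) : ℤ), by omega⟩ i) : K) *
          MvPowerSeries.coeff y (expMode γ w)) := by
  by_cases hy : MvPowerSeries.coeff y (expMode γ w) = 0
  · simp [hy]
  · have hy' := hy
    rw [coeff_expMode, ite_eq_right_iff, Classical.not_imp] at hy'
    have hneg := eq_zero_of_coeff_mvExp_ne_zero hγ hy'.2
    simp only [← mul_assoc, ← Finset.sum_mul]
    congr 1
    have h1 : (w : ℤ) = ∑ p ∈ Finset.range w ×ˢ (Finset.univ : Finset (Fin r)),
        ((p.1 + 1 : ℕ) : ℤ) * y (idx ⟨((p.1 + 1 : ℕ) : ℤ), by omega⟩ p.2) := by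
      rw [← hy'.1, weight_eq_sum, Finsupp.sum]
      have hpos : ∀ g ∈ y.support, 0 < mode g := fun g hg => by
        by_contra hc
        have := mode_ne_zero g
        exact Finsupp.mem_support_iff.mp hg (hneg g (by omega))
      have hidx : ∀ (g : Idx r) (h : (((mode g).toNat - 1 + 1 : ℕ) : ℤ) ≠ 0), 0 < mode g →
          idx ⟨(((mode g).toNat - 1 + 1 : ℕ) : ℤ), h⟩ (colour g) = g := by
        intro g h hg
        refine eq_of_mode_eq_of_colour_eq ?_ rfl
        show (((mode g).toNat - 1 + 1 : ℕ) : ℤ) = mode g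
        omega
      refine Finset.sum_of_injOn (fun g => ((mode g).toNat - 1, colour g)) ?_ ?_ ?_ ?_
      · intro g hg g' hg' h
        rw [Finset.mem_coe] at hg hg'
        have h1 : (mode g).toNat - 1 = (mode g').toNat - 1 := congrArg (fun p : ℕ × Fin r => p.1) h
        have h2 : colour g = colour g' := congrArg (fun p : ℕ × Fin r => p.2) h
        have h3 := hpos g hg
        have h4 := hpos g' hg'
        exact eq_of_mode_eq_of_colour_eq (by omega) h2
      · intro g hg
        rw [Finset.mem_coe] at hg
        simp only [Finset.coe_product, Finset.coe_univ, Set.mem_prod, Finset.mem_coe,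
          Finset.mem_range, Set.mem_univ, and_true]
        have h1 := mul_natAbs_le_absWeight y g
        have h2 := weight_eq_sub y
        have h3 := absWeight_eq_add y
        have h4 : (y.filter fun g => ¬ 0 < mode g) = 0 := by
          rw [Finsupp.filter_eq_zero_iff]
          intro g hg
          exact hneg g (by have := mode_ne_zero g; omega)
        have h5 : 1 ≤ y g := Nat.one_le_iff_ne_zero.mpr (Finsupp.mem_support_iff.mp hg)
        have h6 := hpos g hg
        have h7 : (mode g).natAbs ≤ y g * (mode g).natAbs := Nat.le_mul_of_pos_left _ h5
        rw [h4, map_zero] at h2 h3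
        have := hy'.1
        omega
      · rintro ⟨j, i⟩ - hj
        dsimp only
        suffices h : y (idx ⟨((j + 1 : ℕ) : ℤ), by omega⟩ i) = 0 by rw [h]; simp
        by_contra hc
        refine hj ⟨_, Finset.mem_coe.mpr (Finsupp.mem_support_iff.mpr hc), ?_⟩
        refine Prod.ext ?_ rfl
        show ((j + 1 : ℕ) : ℤ).toNat - 1 = j
        omega
      · intro g hg
        dsimp only
        rw [hidx g (by omega) (hpos g hg), mul_comm]
        congr 1
        have := hpos g hg
        omega
    have h2 := congrArg (Int.cast : ℤ → K) h1
    push_cast at h2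
    rw [Finset.sum_product] at h2
    push_cast
    exact h2

variable [CharZero K]

/-- The Euler identity for one variable: a multiplicity is the effect of the corresponding
logarithmic derivative. -/
theorem finsum_mul_coeff_expMode (γ : Idx r → K) (g : Idx r) (w : ℤ) :
    ∑ᶠ y : Idx r →₀ ℕ, (y g : K) * MvPowerSeries.coeff y (expMode γ w) =
      γ g * expWeight γ (w - mode g) := by
  rw [finsum_eq_finsum_add_single g _ (fun y hy => by simp [hy]), expWeight, mul_finsum]
  refine finsum_congr fun y => ?_
  rw [coeff_expMode, coeff_expMode, map_add, weight_single]
  by_cases h : weight r y = w - mode g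
  · rw [if_pos h, if_pos (by rw [h]; push_cast; ring), ← natCast_mul_coeff_mvExp,
      Finsupp.add_apply, Finsupp.single_eq_same]
  · rw [if_neg h, if_neg, mul_zero, mul_zero]
    intro h'
    push_cast at h'
    omega

/-- Evaluating an exponential in many variables at powers of `z` gives the exponential of a power
series. -/
theorem isExpOf_expWeight {γ : Idx r → K} (hγ : ∀ g, mode g < 0 → γ g = 0) :
    IsExpOf (modeSeries γ) (mk fun n : ℕ => expWeight γ n) := by
  refine ⟨?_, ?_⟩
  · rw [← coeff_zero_eq_constantCoeff_apply, coeff_mk, expWeight, finsum_eq_single _ 0]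
    · rw [coeff_expMode]
      simp [constantCoeff_mvExp]
    · intro y hy
      by_contra hc
      rw [coeff_expMode, ite_eq_right_iff, Classical.not_imp] at hc
      have hneg := eq_zero_of_coeff_mvExp_ne_zero hγ hc.2
      have h1 := weight_eq_sub y
      have h2 := absWeight_eq_add y
      have h3 : (y.filter fun g => ¬ 0 < mode g) = 0 := by
        rw [Finsupp.filter_eq_zero_iff]
        intro g hg
        exact hneg g (by have := mode_ne_zero g; omega)
      obtain ⟨g, hg⟩ := Finsupp.ne_iff.mp hy
      have h4 := mul_natAbs_le_absWeight y g
      rw [h3, map_zero] at h1 h2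
      have h5 : absWeight r y = 0 := by
        have := hc.1
        push_cast at this h1
        omega
      rw [h5, Nat.le_zero, mul_eq_zero] at h4
      have := mode_ne_zero g
      rcases h4 with h4 | h4
      · exact hg h4
      · omega
  · ext n
    rw [coeff_derivative, coeff_mul, coeff_mk, Finset.Nat.sum_antidiagonal_eq_sum_range_succ_mk,
      mul_comm, expWeight, mul_finsum]
    have h : ∀ y, ((n : K) + 1) * MvPowerSeries.coeff y (expMode γ ((n + 1 : ℕ) : ℤ)) = _ :=
      fun y => by
        have := weight_mul_coeff_expMode hγ (n + 1) y
        push_cast at this ⊢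
        exact this
    rw [finsum_congr h]
    have hfin : ∀ g : Idx r, (Function.support fun y : Idx r →₀ ℕ =>
        (y g : K) * MvPowerSeries.coeff y (expMode γ ((n : ℤ) + 1))).Finite := fun g =>
      (finite_support_expMode hγ _).subset fun y hy => right_ne_zero_of_mul hy
    rw [finsum_sum_comm]
    · refine Finset.sum_congr rfl fun j hj => ?_
      rw [Finset.mem_range] at hj
      rw [finsum_sum_comm]
      · dsimp only
        rw [coeff_derivative, coeff_modeSeries_succ, coeff_mk, Finset.sum_mul, Finset.sum_mul]
        refine Finset.sum_congr rfl fun i _ => ?_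
        rw [← mul_finsum, finsum_mul_coeff_expMode, mode_idx]
        have e : ∀ h, expWeight γ ((n : ℤ) + 1 - ((⟨(j : ℤ) + 1, h⟩ : Mode) : ℤ)) =
            expWeight γ ((n - j : ℕ) : ℤ) := by
          intro h
          congr 1
          show (n : ℤ) + 1 - ((j : ℤ) + 1) = _
          omega
        rw [e]
        push_cast
        ring
      · intro i _
        exact (hfin _).subset fun y hy => right_ne_zero_of_mul hy
    · intro j _
      refine (finite_support_expMode hγ ((n : ℤ) + 1)).subset fun y hy => ?_
      obtain ⟨i, -, hi⟩ := Finset.exists_ne_zero_of_sum_ne_zero hy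
      exact right_ne_zero_of_mul (right_ne_zero_of_mul hi)

end WeightGeneratingFunction

/-! ### Multiplicative independence of the parameters -/

section Independence

variable {K : Type*} [Field K] [CharZero K] {q₁ q₂ : K}

theorem pow_mul_pow_injective (hq : AlgebraicIndependent ℚ ![q₁, q₂]) {a b c d : ℕ}
    (h : q₁ ^ a * q₂ ^ b = q₁ ^ c * q₂ ^ d) : a = c ∧ b = d := by
  have key : ∀ a b : ℕ, MvPolynomial.aeval ![q₁, q₂] (MvPolynomial.monomial
      (Finsupp.equivFunOnFinite.symm ![a, b]) (1 : ℚ)) = q₁ ^ a * q₂ ^ b := by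
    intro a b
    rw [MvPolynomial.aeval_monomial, map_one, one_mul, Finsupp.prod_fintype _ _ (by simp)]
    simp
  rw [← key, ← key] at h
  have h1 := MvPolynomial.monomial_left_injective (one_ne_zero) (hq h)
  have h2 := Finsupp.equivFunOnFinite.symm.injective h1
  exact ⟨congrFun h2 0, congrFun h2 1⟩

theorem q₁_ne_zero (hq : AlgebraicIndependent ℚ ![q₁, q₂]) : q₁ ≠ 0 := by
  rintro rfl
  exact absurd (pow_mul_pow_injective hq (a := 1) (b := 0) (c := 2) (d := 0) (by simp)).1
    (by norm_num)

theorem q₂_ne_zero (hq : AlgebraicIndependent ℚ ![q₁, q₂]) : q₂ ≠ 0 := by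
  rintro rfl
  exact absurd (pow_mul_pow_injective hq (a := 0) (b := 1) (c := 0) (d := 2) (by simp)).2
    (by norm_num)

theorem zpow_mul_zpow_ne_one (hq : AlgebraicIndependent ℚ ![q₁, q₂]) {a b : ℤ}
    (hab : a ≠ 0 ∨ b ≠ 0) : q₁ ^ a * q₂ ^ b ≠ 1 := by
  intro h
  have h1 := q₁_ne_zero hq
  have h2 := q₂_ne_zero hq
  have e1 : q₁ ^ (a.toNat : ℤ) = q₁ ^ a * q₁ ^ ((-a).toNat : ℤ) := by
    rw [← zpow_add₀ h1]
    congr 1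
    omega
  have e2 : q₂ ^ (b.toNat : ℤ) = q₂ ^ b * q₂ ^ ((-b).toNat : ℤ) := by
    rw [← zpow_add₀ h2]
    congr 1
    omega
  have e3 : q₁ ^ a.toNat * q₂ ^ b.toNat = q₁ ^ (-a).toNat * q₂ ^ (-b).toNat := by
    rw [← zpow_natCast, ← zpow_natCast, ← zpow_natCast, ← zpow_natCast, e1, e2]
    linear_combination (q₁ ^ ((-a).toNat : ℤ) * q₂ ^ ((-b).toNat : ℤ)) * h
  have := pow_mul_pow_injective hq e3
  omega

theorem q_ne_zero (hq : AlgebraicIndependent ℚ ![q₁, q₂]) : q₁ * q₂ ≠ 0 :=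
  mul_ne_zero (q₁_ne_zero hq) (q₂_ne_zero hq)

theorem q_zpow_ne_one (hq : AlgebraicIndependent ℚ ![q₁, q₂]) {a : ℤ} (ha : a ≠ 0) :
    (q₁ * q₂) ^ a ≠ 1 := by
  rw [mul_zpow]
  exact zpow_mul_zpow_ne_one hq (Or.inl ha)

theorem q_zpow_injective (hq : AlgebraicIndependent ℚ ![q₁, q₂]) :
    Function.Injective fun a : ℤ => (q₁ * q₂) ^ a := by
  intro a b hab
  by_contra hc
  refine q_zpow_ne_one hq (sub_ne_zero.mpr hc) ?_
  rw [zpow_sub₀ (q_ne_zero hq), div_eq_one_iff_eq (zpow_ne_zero _ (q_ne_zero hq))]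
  exact hab

end Independence

/-! ### Sums over colours -/

section Telescoping

variable {K : Type*} [Field K]

theorem sum_range_telescope_lt (x : K) (i r : ℕ) :
    ∑ j ∈ Finset.range r, x ^ j * (if j < i then 1 - x else if j = i then 1 else 0) =
      if i < r then 1 else 1 - x ^ r := by
  induction r with
  | zero => simp
  | succ r ih =>
    rw [Finset.sum_range_succ, ih]
    rcases lt_trichotomy r i with h | h | h
    · rw [if_neg (by omega), if_pos h, if_neg (by omega)]
      ring
    · rw [if_neg (by omega), if_neg (by omega), if_pos h, if_pos (by omega)]
      ring
    · rw [if_pos h, if_neg (by omega), if_neg (by omega), if_pos (by omega)]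
      ring

theorem sum_range_telescope_gt {x : K} (hx : x ≠ 0) (i r : ℕ) :
    x * ∑ j ∈ Finset.range r, x ^ j * (if i < j then 1 - x⁻¹ else if i = j then 1 else 0) =
      if i < r then x ^ r else 0 := by
  induction r with
  | zero => simp
  | succ r ih =>
    rw [Finset.sum_range_succ, mul_add, ih]
    rcases lt_trichotomy r i with h | h | h
    · rw [if_neg (by omega), if_neg (by omega), if_neg (by omega), if_neg (by omega)]
      ring
    · rw [if_neg (by omega), if_neg (by omega), if_pos h.symm, if_pos (by omega)]
      ring
    · rw [if_pos h, if_pos h, if_pos (by omega)]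
      field_simp
      ring

/-- The numbers `below I i`, for `i ∈ I`, are `0, 1, ..., |I| - 1`. -/
theorem sum_below {M : Type*} [AddCommMonoid M] {r : ℕ} (I : Finset (Fin r)) (f : ℕ → M) :
    ∑ i ∈ I, f (below I i) = ∑ s ∈ Finset.range I.card, f s := by
  have himg : I = Finset.univ.image (I.orderEmbOfFin rfl) := by
    apply Finset.coe_injective
    simp
  rw [← Fin.sum_univ_eq_sum_range]
  conv_lhs => rw [himg]
  rw [Finset.sum_image fun a _ b _ hab => (I.orderEmbOfFin rfl).injective hab]
  exact Finset.sum_congr rfl fun s _ => by rw [below_image (I.orderEmbOfFin rfl).strictMono]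

end Telescoping

/-! ### Commutators of the currents with the bosons -/

section BosonCommutators

variable {r : ℕ} {K : Type*} [Field K] (q₁ q₂ : K)

/-- The derivation of the algebra of symbols given by the commutator with `b_g`. -/
def commutatorDerivation (g : Idx r) :
    Derivation K (MvPolynomial (Idx r) K) (MvPolynomial (Idx r) K) :=
  MvPolynomial.mkDerivation K fun h => MvPolynomial.C (bracket q₁ q₂ h g)

/-- The part of `commutatorDerivation` that involves annihilation operators. -/
def annihilatorDerivation (g : Idx r) :
    Derivation K (MvPolynomial (Idx r) K) (MvPolynomial (Idx r) K) :=
  MvPolynomial.mkDerivation K fun h =>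
    MvPolynomial.C (if 0 < mode h then bracket q₁ q₂ h g else 0)

theorem annihilatorDerivation_sub_contraction (g : Idx r) (p : MvPolynomial (Idx r) K) :
    annihilatorDerivation q₁ q₂ g p - contraction q₁ q₂ g p = commutatorDerivation q₁ q₂ g p := by
  have : annihilatorDerivation q₁ q₂ g - contraction q₁ q₂ g = commutatorDerivation q₁ q₂ g := by
    apply MvPolynomial.derivation_ext
    intro h
    rw [Derivation.sub_apply, contraction_X, annihilatorDerivation, commutatorDerivation,
      MvPolynomial.mkDerivation_X, MvPolynomial.mkDerivation_X, ← map_sub]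
    congr 1
    have hg := mode_ne_zero g
    have hh := mode_ne_zero h
    by_cases h0 : mode g + mode h = 0
    · by_cases h1 : 0 < mode g
      · rw [if_neg (by omega), if_pos h1, zero_sub, bracket_antisymm, neg_neg]
      · rw [if_pos (by omega), if_neg h1, sub_zero]
    · rw [bracket_eq_zero (g := h) (h := g) q₁ q₂ (by omega),
        bracket_eq_zero (g := g) (h := h) q₁ q₂ (by omega)]
      simp
  exact congrArg (fun D => D p) this

theorem contraction_annihilatorDerivation (a g : Idx r) (p : MvPolynomial (Idx r) K) :
    contraction q₁ q₂ a (annihilatorDerivation q₁ q₂ g p) =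
      annihilatorDerivation q₁ q₂ g (contraction q₁ q₂ a p) := by
  have : ⁅contraction q₁ q₂ a, annihilatorDerivation q₁ q₂ g⁆ = 0 := by
    apply MvPolynomial.derivation_ext
    intro i
    rw [Derivation.commutator_apply, contraction_X, annihilatorDerivation,
      MvPolynomial.mkDerivation_X, MvPolynomial.derivation_C, MvPolynomial.derivation_C]
    simp
  have h2 := congrArg (fun D => D p) this
  simp only [Derivation.commutator_apply, Derivation.coe_zero, Pi.zero_apply] at h2
  exact sub_eq_zero.mp h2

theorem contraction_prod_X_eq_zero {a : Idx r} (ha : 0 < mode a) {t : List (Idx r)}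
    (ht : ∀ h ∈ t, a ≤ h) :
    contraction q₁ q₂ a (t.map (MvPolynomial.X (R := K))).prod = 0 := by
  induction t with
  | nil => simp
  | cons h t ih =>
    rw [List.map_cons, List.prod_cons, Derivation.leibniz,
      ih fun h' hh' => ht h' (List.mem_cons_of_mem _ hh'), contraction_X, if_pos ha,
      bracket_eq_zero_of_pos q₁ q₂ ha (ht h List.mem_cons_self)]
    simp

/-- Moving `b_g` from the right of an ordered product into its place costs the contractions with the
annihilation operators of the product. -/
theorem symbolRep_prod_X {L : List (Idx r)} (hL : L.Pairwise (· ≤ ·)) (g : Idx r) :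
    symbolRep q₁ q₂ (L.map (gen q₁ q₂)).prod (MvPolynomial.X g) =
      MvPolynomial.X g * (L.map (MvPolynomial.X (R := K))).prod +
        annihilatorDerivation q₁ q₂ g (L.map (MvPolynomial.X (R := K))).prod := by
  induction L with
  | nil => simp
  | cons a t ih =>
    rw [List.pairwise_cons] at hL
    have hD : annihilatorDerivation q₁ q₂ g (MvPolynomial.X a) =
        MvPolynomial.C (if 0 < mode a then bracket q₁ q₂ a g else 0) := by
      rw [annihilatorDerivation, MvPolynomial.mkDerivation_X]
    rw [List.map_cons, List.prod_cons, map_mul, Module.End.mul_apply, ih hL.2, symbolRep_gen,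
      genAction_apply, List.map_cons, List.prod_cons, map_add, Derivation.leibniz,
      Derivation.leibniz, contraction_annihilatorDerivation, hD, contraction_X]
    by_cases ha : 0 < mode a
    · rw [contraction_prod_X_eq_zero q₁ q₂ ha hL.1, if_pos ha, map_zero]
      simp only [smul_eq_mul]
      ring
    · have : ∀ p, contraction q₁ q₂ a p = 0 := fun p => by
        rw [contraction_apply, if_neg ha]
      rw [this, if_neg ha, map_zero, map_zero]
      simp only [smul_eq_mul]
      ring

theorem prod_map_X (m : Idx r →₀ ℕ) :
    (((Finsupp.toMultiset m).sort (· ≤ ·)).map (MvPolynomial.X (R := K))).prod =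
      MvPolynomial.monomial m 1 := by
  rw [map_prod_sort, MvPolynomial.monomial_eq, map_one, one_mul]

/-- The commutator of a normally ordered monomial with a generator is the derivative of its symbol. -/
theorem repr_commutator_gen (m : Idx r →₀ ℕ) (g : Idx r) (l : Idx r →₀ ℕ) :
    (heisBasis q₁ q₂ r).repr (normalMonomial q₁ q₂ m * gen q₁ q₂ g -
        gen q₁ q₂ g * normalMonomial q₁ q₂ m) l =
      MvPolynomial.coeff l (commutatorDerivation q₁ q₂ g (MvPolynomial.monomial m 1)) := by
  have h1 : symbolRep q₁ q₂ (gen q₁ q₂ g) 1 = MvPolynomial.X g := by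
    rw [symbolRep_gen, genAction_apply, mul_one, Derivation.map_one_eq_zero, add_zero]
  have h2 := symbolRep_prod_X q₁ q₂ (Multiset.pairwise_sort (Finsupp.toMultiset m) _) g
  rw [prod_map_X] at h2
  rw [repr_eq_coeff, map_sub, map_mul, map_mul, LinearMap.sub_apply, Module.End.mul_apply,
    Module.End.mul_apply, h1, symbolRep_normalMonomial, symbolRep_gen, genAction_apply,
    ← annihilatorDerivation_sub_contraction]
  rw [normalMonomial, h2, add_sub_add_left_eq_sub]

theorem commutatorDerivation_apply (g : Idx r) (p : MvPolynomial (Idx r) K) :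
    commutatorDerivation q₁ q₂ g p =
      ∑ i, bracket q₁ q₂ (opp g i) g • MvPolynomial.pderiv (opp g i) p := by
  classical
  have : commutatorDerivation q₁ q₂ g =
      ∑ i, bracket q₁ q₂ (opp g i) g • MvPolynomial.pderiv (opp g i) := by
    apply MvPolynomial.derivation_ext
    intro h
    rw [commutatorDerivation, MvPolynomial.mkDerivation_X, derivation_sum_apply]
    simp only [Derivation.smul_apply, MvPolynomial.pderiv_X]
    by_cases hh : mode h = -mode g
    · obtain ⟨i, rfl⟩ : ∃ i, h = opp g i := ⟨_, eq_opp hh⟩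
      rw [Finset.sum_eq_single i]
      · simp [MvPolynomial.smul_eq_C_mul]
      · intro j _ hj
        rw [Pi.single_eq_of_ne, smul_zero]
        exact fun h => hj (opp_injective g h).symm
      · simp
    · rw [bracket_eq_zero _ _ (by omega), map_zero, Finset.sum_eq_zero]
      intro i _
      rw [Pi.single_eq_of_ne, smul_zero]
      rintro rfl
      exact hh rfl
  rw [this, derivation_sum_apply]
  rfl

theorem finsum_mul_coeff_pderiv (A : HeisHat K r) (l : Idx r →₀ ℕ) (h : Idx r) :
    ∑ᶠ m, MvPowerSeries.coeff m A *
      MvPolynomial.coeff l (MvPolynomial.pderiv h (MvPolynomial.monomial m (1 : K))) =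
    ((l h + 1 : ℕ) : K) * MvPowerSeries.coeff (l + Finsupp.single h 1) A := by
  classical
  rw [finsum_eq_single _ (l + Finsupp.single h 1)]
  · rw [MvPolynomial.coeff_pderiv, MvPolynomial.coeff_monomial, if_pos rfl]
    push_cast
    ring
  · intro m hm
    rw [MvPolynomial.coeff_pderiv, MvPolynomial.coeff_monomial, if_neg hm, zero_mul, mul_zero]

theorem finite_support_finsum {α β M : Type*} [AddCommMonoid M] {f : α × β → M}
    (hf : (Function.support f).Finite) :
    (Function.support fun a => ∑ᶠ b, f (a, b)).Finite := by
  refine (hf.image Prod.fst).subset fun a ha => ?_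
  rw [Function.mem_support] at ha
  by_contra hc
  refine ha (finsum_eq_zero_of_forall_eq_zero fun b => ?_)
  by_contra hb
  exact hc ⟨(a, b), hb, rfl⟩

theorem coeff_toHat (x : Heis q₁ q₂ r) (n : Idx r →₀ ℕ) :
    MvPowerSeries.coeff n (toHat q₁ q₂ x) = (heisBasis q₁ q₂ r).repr x n := rfl

theorem finsum_repr_mul (T : Heis q₁ q₂ r →ₗ[K] K) (x : Heis q₁ q₂ r) :
    ∑ᶠ n, (heisBasis q₁ q₂ r).repr x n * T (normalMonomial q₁ q₂ n) = T x := by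
  conv_rhs => rw [← (heisBasis q₁ q₂ r).linearCombination_repr x]
  rw [Finsupp.linearCombination_apply, Finsupp.sum, map_sum,
    finsum_eq_sum_of_support_subset (s := ((heisBasis q₁ q₂ r).repr x).support)]
  · refine Finset.sum_congr rfl fun n _ => ?_
    rw [map_smul, heisBasis_apply, smul_eq_mul]
  · intro n hn
    exact Finsupp.mem_support_iff.mpr (left_ne_zero_of_mul hn)

/-- The commutator of a homogeneous element of the completion with an element of the algebra. -/
theorem coeff_starComm_toHat {A : HeisHat K r} {x : Heis q₁ q₂ r} {a b : ℤ}
    (hA : IsHomogeneous a A) (hx : IsHomogeneous b (toHat q₁ q₂ x)) (l : Idx r →₀ ℕ) :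
    MvPowerSeries.coeff l (starComm q₁ q₂ A (toHat q₁ q₂ x)) =
      ∑ᶠ m, MvPowerSeries.coeff m A * (heisBasis q₁ q₂ r).repr
        (normalMonomial q₁ q₂ m * x - x * normalMonomial q₁ q₂ m) l := by
  have f1 := hA.starSummable q₁ q₂ hx l
  have f2 : (Function.support ((starTerm q₁ q₂ (toHat q₁ q₂ x) A l) ∘ Prod.swap)).Finite := by
    refine ((hx.starSummable q₁ q₂ hA l).image Prod.swap).subset ?_
    intro p hp
    exact ⟨p.swap, hp, p.swap_swap⟩
  have e1 : ∀ m, (∑ᶠ n, starTerm q₁ q₂ A (toHat q₁ q₂ x) l (m, n)) =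
      MvPowerSeries.coeff m A * (heisBasis q₁ q₂ r).repr (normalMonomial q₁ q₂ m * x) l := by
    intro m
    have := finsum_repr_mul q₁ q₂ ((Finsupp.lapply l) ∘ₗ (heisBasis q₁ q₂ r).repr.toLinearMap ∘ₗ
      LinearMap.mulLeft K (normalMonomial q₁ q₂ m)) x
    refine Eq.trans ?_ (congrArg (MvPowerSeries.coeff m A * ·) this)
    rw [mul_finsum]
    refine finsum_congr fun n => ?_
    rw [← mul_assoc]
    rfl
  have e2 : ∀ m, (∑ᶠ n, ((starTerm q₁ q₂ (toHat q₁ q₂ x) A l) ∘ Prod.swap) (m, n)) =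
      MvPowerSeries.coeff m A * (heisBasis q₁ q₂ r).repr (x * normalMonomial q₁ q₂ m) l := by
    intro m
    have := finsum_repr_mul q₁ q₂ ((Finsupp.lapply l) ∘ₗ (heisBasis q₁ q₂ r).repr.toLinearMap ∘ₗ
      LinearMap.mulRight K (normalMonomial q₁ q₂ m)) x
    refine Eq.trans ?_ (congrArg (MvPowerSeries.coeff m A * ·) this)
    rw [mul_finsum]
    refine finsum_congr fun n => ?_
    show MvPowerSeries.coeff n (toHat q₁ q₂ x) * MvPowerSeries.coeff m A * _ = _
    rw [mul_comm (MvPowerSeries.coeff n _), mul_assoc]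
    rfl
  have s1 := finite_support_finsum f1
  have s2 := finite_support_finsum f2
  have t1 : MvPowerSeries.coeff l (starMul q₁ q₂ A (toHat q₁ q₂ x)) = _ := finsum_curry _ f1
  have t2 : MvPowerSeries.coeff l (starMul q₁ q₂ (toHat q₁ q₂ x) A) =
      ∑ᶠ m, ∑ᶠ n, ((starTerm q₁ q₂ (toHat q₁ q₂ x) A l) ∘ Prod.swap) (m, n) :=
    (finsum_comp_equiv (Equiv.prodComm _ _)).symm.trans (finsum_curry _ f2)
  rw [starComm, map_sub, t1, t2, ← finsum_sub_distrib s1 s2]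
  refine finsum_congr fun m => ?_
  rw [e1, e2, map_sub, Finsupp.sub_apply, mul_sub]

theorem repr_gen (g : Idx r) (n : Idx r →₀ ℕ) :
    (heisBasis q₁ q₂ r).repr (gen q₁ q₂ g) n =
      MvPolynomial.coeff n (MvPolynomial.X g : MvPolynomial (Idx r) K) := by
  rw [repr_eq_coeff, symbolRep_gen, genAction_apply, mul_one, Derivation.map_one_eq_zero, add_zero]

theorem isHomogeneous_boson (n : Mode) :
    IsHomogeneous n.1 (toHat q₁ q₂ (boson q₁ q₂ r n)) := by
  classical
  intro m hm
  rw [coeff_toHat, boson, map_sum, Finsupp.finsetSum_apply]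
  refine Finset.sum_eq_zero fun i _ => ?_
  rw [map_smul, Finsupp.smul_apply, repr_gen, MvPolynomial.coeff_X, if_neg, smul_zero]
  rintro rfl
  rw [weight_single, mode_idx] at hm
  exact hm (by simp)

theorem isHomogeneous_wMode [CharZero K] (u : Fin r → K) (k : ℕ) (d : ℤ) :
    IsHomogeneous d (wMode q₁ q₂ u k d) := by
  intro m hm
  rw [coeff_wMode, if_neg hm]

/-- The opposite of a mode. -/
def negMode (n : Mode) : Mode := ⟨-n.1, neg_ne_zero.mpr n.2⟩

theorem coeff_starComm_boson {A : HeisHat K r} {a : ℤ} (hA : IsHomogeneous a A) (n : Mode)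
    (l : Idx r →₀ ℕ) :
    MvPowerSeries.coeff l (starComm q₁ q₂ A (toHat q₁ q₂ (boson q₁ q₂ r n))) =
      ∑ i, (∑ j : Fin r, (q₁ * q₂) ^ (n.1 * (j : ℤ)) *
        bracket q₁ q₂ (idx (negMode n) i) (idx n j)) *
          (((l (idx (negMode n) i) + 1 : ℕ) : K) *
            MvPowerSeries.coeff (l + Finsupp.single (idx (negMode n) i) 1) A) := by
  classical
  rw [coeff_starComm_toHat q₁ q₂ hA (isHomogeneous_boson q₁ q₂ n)]
  have h : ∀ m, MvPowerSeries.coeff m A * (heisBasis q₁ q₂ r).repr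
      (normalMonomial q₁ q₂ m * boson q₁ q₂ r n - boson q₁ q₂ r n * normalMonomial q₁ q₂ m) l =
      ∑ i, (∑ j : Fin r, (q₁ * q₂) ^ (n.1 * (j : ℤ)) *
        bracket q₁ q₂ (idx (negMode n) i) (idx n j)) * (MvPowerSeries.coeff m A *
        MvPolynomial.coeff l (MvPolynomial.pderiv (idx (negMode n) i)
          (MvPolynomial.monomial m (1 : K)))) := by
    intro m
    have e : normalMonomial q₁ q₂ m * boson q₁ q₂ r n - boson q₁ q₂ r n * normalMonomial q₁ q₂ m =
        ∑ j : Fin r, (q₁ * q₂) ^ (n.1 * (j : ℤ)) • (normalMonomial q₁ q₂ m * gen q₁ q₂ (idx n j) -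
          gen q₁ q₂ (idx n j) * normalMonomial q₁ q₂ m) := by
      rw [boson, Finset.mul_sum, Finset.sum_mul, ← Finset.sum_sub_distrib]
      refine Finset.sum_congr rfl fun j _ => ?_
      rw [mul_smul_comm, smul_mul_assoc, smul_sub]
    rw [e, map_sum, Finsupp.finsetSum_apply, Finset.mul_sum]
    simp only [Finset.sum_mul]
    rw [Finset.sum_comm]
    refine Finset.sum_congr rfl fun j _ => ?_
    rw [map_smul, Finsupp.smul_apply, repr_commutator_gen, commutatorDerivation_apply,
      MvPolynomial.coeff_sum, smul_eq_mul, Finset.mul_sum, Finset.mul_sum]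
    refine Finset.sum_congr rfl fun i _ => ?_
    rw [MvPolynomial.coeff_smul, smul_eq_mul]
    show _ * (_ * (bracket q₁ q₂ (idx (negMode n) i) (idx n j) * MvPolynomial.coeff l
      (MvPolynomial.pderiv (idx (negMode n) i) (MvPolynomial.monomial m 1)))) = _
    ring
  rw [finsum_congr h, finsum_sum_comm]
  · refine Finset.sum_congr rfl fun i _ => ?_
    rw [← mul_finsum, finsum_mul_coeff_pderiv]
  · intro i _
    refine (Set.finite_singleton (l + Finsupp.single (idx (negMode n) i) 1)).subset fun m hm => ?_
    by_contra hc
    have h1 := right_ne_zero_of_mul (right_ne_zero_of_mul hm)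
    rw [MvPolynomial.coeff_pderiv, MvPolynomial.coeff_monomial,
      if_neg (show ¬ m = _ from hc), zero_mul] at h1
    exact h1 rfl

/-- The derivative of an exponential is a multiple of it, so the commutator of `W_k` with a boson is
proportional to `W_k` as soon as the scalar is the same for all sets of colours of size `k`. -/
theorem starComm_wMode_boson [CharZero K] (u : Fin r → K) (k : ℕ) (d : ℤ) (n : Mode) (c : K)
    (hc : ∀ I : Finset (Fin r), I.card = k →
      (∑ i, (∑ j : Fin r, (q₁ * q₂) ^ (n.1 * (j : ℤ)) *
        bracket q₁ q₂ (idx (negMode n) i) (idx n j)) *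
          setCoeff (q₁ * q₂) I (idx (negMode n) i)) = c) :
    starComm q₁ q₂ (wMode q₁ q₂ u k d) (toHat q₁ q₂ (boson q₁ q₂ r n)) =
      c • wMode q₁ q₂ u k (d + n.1) := by
  ext l
  rw [coeff_starComm_boson q₁ q₂ (isHomogeneous_wMode q₁ q₂ u k d), map_smul, smul_eq_mul,
    coeff_wMode]
  simp only [coeff_wMode, map_add, weight_single, mode_idx]
  have hiff : ∀ w : ℤ, w + ((1 : ℕ) : ℤ) * (negMode n).1 = d ↔ w = d + n.1 := by
    intro w
    show w + _ * (-n.1) = d ↔ _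
    constructor <;> intro h <;> push_cast at * <;> omega
  simp only [hiff]
  split_ifs with h
  · simp only [Finset.mul_sum]
    rw [Finset.sum_comm]
    refine Finset.sum_congr rfl fun I hI => ?_
    rw [← hc I (Finset.mem_powersetCard.mp hI).2, Finset.sum_mul]
    refine Finset.sum_congr rfl fun i _ => ?_
    have := natCast_mul_coeff_mvExp K (setCoeff (q₁ * q₂) I) l (idx (negMode n) i)
    linear_combination (∑ j : Fin r, (q₁ * q₂) ^ (n.1 * (j : ℤ)) *
      bracket q₁ q₂ (idx (negMode n) i) (idx n j)) * (∏ i ∈ I, u i) * this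
  · simp

theorem setCoeff_idx (q : K) (I : Finset (Fin r)) (n : Mode) (i : Fin r) :
    setCoeff q I (idx n i) = if i ∈ I then q ^ (n.1 * below I i) / (n.1.natAbs : K) else 0 := rfl

variable {q₁ q₂}

/-- The sum over the colours of the boson telescopes to a number independent of the colour of the
annihilation operator; what remains is a geometric sum over the elements of the set of colours. -/
theorem starComm_wMode_boson_neg [CharZero K] (hq : AlgebraicIndependent ℚ ![q₁, q₂])
    (u : Fin r → K) (k : ℕ) (d : ℤ) (n : ℕ) (hn : (n : ℤ) ≠ 0) :
    starComm q₁ q₂ (wMode q₁ q₂ u k d)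
        (toHat q₁ q₂ (boson q₁ q₂ r ⟨-(n : ℤ), neg_ne_zero.mpr hn⟩)) =
      (-((1 - q₁ ^ n) * (1 - q₂ ^ n) * (1 - (q₁ * q₂) ^ (k * n)) / (1 - (q₁ * q₂) ^ n))) •
        wMode q₁ q₂ u k (d - n) := by
  have hq0 := q_ne_zero hq
  have hn0 : (n : K) ≠ 0 := by
    rw [Nat.cast_ne_zero]
    omega
  refine starComm_wMode_boson q₁ q₂ u k d ⟨-(n : ℤ), neg_ne_zero.mpr hn⟩ _ fun I hI => ?_
  have hm : negMode ⟨-(n : ℤ), neg_ne_zero.mpr hn⟩ = ⟨(n : ℤ), hn⟩ := Subtype.ext (neg_neg _)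
  rw [hm]
  have hS : ∀ i : Fin r, ∑ j : Fin r, (q₁ * q₂) ^ (-(n : ℤ) * (j : ℤ)) *
      bracket q₁ q₂ (idx ⟨(n : ℤ), hn⟩ i) (idx ⟨-(n : ℤ), neg_ne_zero.mpr hn⟩ j) =
      -(n * (1 - q₁ ^ n) * (1 - q₂ ^ n)) := by
    intro i
    have h := sum_range_telescope_lt ((q₁ * q₂) ^ (-(n : ℤ))) i r
    rw [if_pos i.2, ← Fin.sum_univ_eq_sum_range (fun j => ((q₁ * q₂) ^ (-(n : ℤ))) ^ j *
      (if j < (i : ℕ) then 1 - (q₁ * q₂) ^ (-(n : ℤ)) else if j = i then 1 else 0))] at h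
    refine Eq.trans (Eq.trans ?_ (congrArg (_ * ·) h)) (mul_one _)
    rw [Finset.mul_sum]
    refine Finset.sum_congr rfl fun j _ => ?_
    unfold bracket
    rw [mode_idx, mode_idx, if_pos (by simp), if_neg (by simp), colour_idx, colour_idx, pairing,
      zpow_mul, zpow_natCast, zpow_natCast, zpow_natCast]
    simp only [Fin.lt_def, Fin.ext_iff]
    push_cast
    ring
  simp only [hS, setCoeff_idx]
  rw [← Finset.mul_sum, ← Finset.sum_filter, Finset.filter_mem_eq_inter, Finset.univ_inter]
  have hx : (q₁ * q₂) ^ n ≠ 1 := by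
    have := q_zpow_ne_one hq hn
    rwa [zpow_natCast] at this
  have h2 : ∀ i ∈ I, (q₁ * q₂) ^ ((n : ℤ) * (below I i : ℤ)) / (((n : ℤ).natAbs : ℕ) : K) =
      (fun s : ℕ => ((q₁ * q₂) ^ n) ^ s / (n : K)) (below I i) := by
    intro i _
    rw [zpow_mul, zpow_natCast, zpow_natCast, Int.natAbs_natCast]
  rw [(Finset.sum_congr rfl h2).trans (sum_below I fun s : ℕ => ((q₁ * q₂) ^ n) ^ s / (n : K)),
    hI, ← Finset.sum_div, geom_sum_eq hx, mul_comm k n,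
    pow_mul]
  have h3 : (q₁ * q₂) ^ n - 1 ≠ 0 := sub_ne_zero.mpr hx
  have h4 : 1 - (q₁ * q₂) ^ n ≠ 0 := sub_ne_zero.mpr hx.symm
  rw [← neg_sub (1 : K) ((q₁ * q₂) ^ n), ← neg_sub (1 : K) (((q₁ * q₂) ^ n) ^ k)]
  generalize (q₁ * q₂) ^ n = x at *
  field_simp

/-- As for negative modes; the telescoping sum now leaves the factor `q^{(r - 1) n}`. -/
theorem starComm_wMode_boson_pos [CharZero K] (hq : AlgebraicIndependent ℚ ![q₁, q₂])
    (u : Fin r → K) (k : ℕ) (d : ℤ) (n : ℕ) (hn : (n : ℤ) ≠ 0) :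
    starComm q₁ q₂ (wMode q₁ q₂ u k d) (toHat q₁ q₂ (boson q₁ q₂ r ⟨(n : ℤ), hn⟩)) =
      ((1 - q₁ ^ n) * (1 - q₂ ^ n) * ((q₁ * q₂) ^ (-((k : ℤ) * n)) - 1) *
          ((q₁ * q₂) ^ r) ^ n / (1 - (q₁ * q₂) ^ n)) • wMode q₁ q₂ u k (d + n) := by
  have hq0 := q_ne_zero hq
  have hn0 : (n : K) ≠ 0 := by
    rw [Nat.cast_ne_zero]
    omega
  have hx0 : (q₁ * q₂) ^ n ≠ 0 := pow_ne_zero _ hq0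
  refine starComm_wMode_boson q₁ q₂ u k d ⟨(n : ℤ), hn⟩ _ fun I hI => ?_
  have hS : ∀ i : Fin r, ∑ j : Fin r, (q₁ * q₂) ^ ((n : ℤ) * (j : ℤ)) *
      bracket q₁ q₂ (idx (negMode ⟨(n : ℤ), hn⟩) i) (idx ⟨(n : ℤ), hn⟩ j) =
      n * (1 - q₁ ^ n) * (1 - q₂ ^ n) * (((q₁ * q₂) ^ n)⁻¹ * ((q₁ * q₂) ^ n) ^ r) := by
    intro i
    have h := sum_range_telescope_gt hx0 i r
    rw [if_pos i.2, ← Fin.sum_univ_eq_sum_range (fun j => ((q₁ * q₂) ^ n) ^ j *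
      (if (i : ℕ) < j then 1 - ((q₁ * q₂) ^ n)⁻¹ else if (i : ℕ) = j then 1 else 0))] at h
    rw [← h, inv_mul_cancel_left₀ hx0, Finset.mul_sum]
    refine Finset.sum_congr rfl fun j _ => ?_
    unfold bracket
    rw [mode_idx, mode_idx, if_pos (by simp [negMode]), if_pos (by dsimp only; omega), colour_idx,
      colour_idx, pairing, zpow_mul, zpow_natCast, zpow_natCast, zpow_natCast, zpow_natCast,
      zpow_neg, zpow_natCast]
    simp only [Fin.lt_def, Fin.ext_iff]
    push_cast
    ring
  simp only [hS, setCoeff_idx]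
  rw [← Finset.mul_sum, ← Finset.sum_filter, Finset.filter_mem_eq_inter, Finset.univ_inter]
  have hx : (q₁ * q₂) ^ n ≠ 1 := by
    have := q_zpow_ne_one hq hn
    rwa [zpow_natCast] at this
  have h2 : ∀ i ∈ I, (q₁ * q₂) ^ ((negMode ⟨(n : ℤ), hn⟩).1 * (below I i : ℤ)) /
      (((negMode ⟨(n : ℤ), hn⟩).1.natAbs : ℕ) : K) =
      (fun s : ℕ => (((q₁ * q₂) ^ n)⁻¹) ^ s / (n : K)) (below I i) := by
    intro i _
    show (q₁ * q₂) ^ (-(n : ℤ) * (below I i : ℤ)) / (((-(n : ℤ)).natAbs : ℕ) : K) = _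
    rw [zpow_mul, zpow_neg, zpow_natCast, zpow_natCast, Int.natAbs_neg, Int.natAbs_natCast]
  have hx' : ((q₁ * q₂) ^ n)⁻¹ ≠ 1 := by rwa [ne_eq, inv_eq_one]
  rw [(Finset.sum_congr rfl h2).trans
      (sum_below I fun s : ℕ => (((q₁ * q₂) ^ n)⁻¹) ^ s / (n : K)),
    hI, ← Finset.sum_div, geom_sum_eq hx', mul_comm (k : ℤ),
    zpow_neg, zpow_mul, zpow_natCast, zpow_natCast, pow_right_comm (q₁ * q₂) r n, inv_pow]
  have h3 : (q₁ * q₂) ^ n - 1 ≠ 0 := sub_ne_zero.mpr hx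
  have h4 : 1 - (q₁ * q₂) ^ n ≠ 0 := sub_ne_zero.mpr hx.symm
  generalize (q₁ * q₂) ^ n = x at *
  have h5 : x⁻¹ - 1 ≠ 0 := sub_ne_zero.mpr hx'
  have h6 : x * (x⁻¹ - 1) = 1 - x := by
    rw [mul_sub, mul_inv_cancel₀ hx0, mul_one]
  rw [← h6]
  field_simp

end BosonCommutators

/-! ### The contraction factor of two currents -/

section ContractionFactor

open PowerSeries

variable {K : Type*} [Field K]

theorem IsExpOf.inv {g F : K⟦X⟧} (h : IsExpOf g F) : IsExpOf (-g) F⁻¹ := by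
  have hne : constantCoeff F ≠ 0 := by rw [h.1]; exact one_ne_zero
  refine ⟨by rw [constantCoeff_inv, h.1, inv_one], ?_⟩
  rw [derivative_inv', h.2, map_neg]
  have := PowerSeries.mul_inv_cancel F hne
  linear_combination (-(F⁻¹ * (d⁄dX K) g)) * this

variable (q₁ q₂ : K)

/-- The logarithm of `ζ(c z)`. -/
def logZetaSeries (c : K) : K⟦X⟧ := mk fun n => (1 - q₁ ^ n) * (1 - q₂ ^ n) / n * c ^ n

/-- The expansion of `ζ(c z)` at `z = 0`. -/
def zetaSeries (c : K) : K⟦X⟧ :=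
  (1 - C (q₁ * c) * X) * (1 - C (q₂ * c) * X) *
    ((1 - C c * X) * (1 - C (q₁ * q₂ * c) * X))⁻¹

theorem isExpOf_zetaSeries [CharZero K] (c : K) :
    IsExpOf (logZetaSeries q₁ q₂ c) (zetaSeries q₁ q₂ c) := by
  have h := ((isExpOf_one_sub (q₁ * c)).mul (isExpOf_one_sub (q₂ * c))).mul
    ((isExpOf_one_sub c).mul (isExpOf_one_sub (q₁ * q₂ * c))).inv
  have e : logZetaSeries q₁ q₂ c = (mk fun n => -((q₁ * c) ^ n / n)) +
      (mk fun n => -((q₂ * c) ^ n / n)) + -((mk fun n => -(c ^ n / n)) +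
        (mk fun n => -((q₁ * q₂ * c) ^ n / n))) := by
    ext n
    simp only [logZetaSeries, map_add, map_neg, coeff_mk, mul_pow]
    ring
  rw [e]
  exact h

theorem constantCoeff_logZetaSeries (c : K) : constantCoeff (logZetaSeries q₁ q₂ c) = 0 := by
  rw [← coeff_zero_eq_constantCoeff_apply, logZetaSeries, coeff_mk]
  simp

/-- `f_{k k'}(z)` is the product of the `ζ(q^s z)` over `max(0, k - k') ≤ s < k`. -/
theorem isExpOf_fSeries [CharZero K] (hq : AlgebraicIndependent ℚ ![q₁, q₂]) (k k' : ℕ) :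
    IsExpOf (∑ s ∈ Finset.Ico (k - k') k, logZetaSeries q₁ q₂ ((q₁ * q₂) ^ s))
      (fSeries q₁ q₂ k k') := by
  have e : (∑ s ∈ Finset.Ico (k - k') k, logZetaSeries q₁ q₂ ((q₁ * q₂) ^ s)) =
      PowerSeries.mk fun n : ℕ => (1 - q₁ ^ n) * (1 - q₂ ^ n) *
        ((q₁ * q₂) ^ ((k - k') * n) - (q₁ * q₂) ^ (k * n)) / (n * (1 - (q₁ * q₂) ^ n)) := by
    ext n
    rw [map_sum, coeff_mk]
    simp only [logZetaSeries, coeff_mk]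
    rw [← Finset.mul_sum]
    rcases Nat.eq_zero_or_pos n with rfl | hn
    · simp
    · have hx : (q₁ * q₂) ^ n ≠ 1 := by
        have := q_zpow_ne_one hq (a := n) (by omega)
        rwa [zpow_natCast] at this
      have h1 : ∀ s : ℕ, ((q₁ * q₂) ^ s) ^ n = ((q₁ * q₂) ^ n) ^ s := fun s =>
        pow_right_comm (q₁ * q₂) s n
      simp only [h1]
      rw [geom_sum_Ico hx (Nat.sub_le k k'), ← pow_mul, ← pow_mul, mul_comm n, mul_comm n,
        ← neg_sub ((q₁ * q₂) ^ n), ← neg_sub ((q₁ * q₂) ^ (k * n)), div_mul_div_comm, mul_neg,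
        mul_neg, neg_div_neg_eq]
  rw [fSeries, ← e]
  apply isExpOf_exp_subst
  rw [map_sum]
  exact Finset.sum_eq_zero fun s _ => constantCoeff_logZetaSeries q₁ q₂ _

variable {r : ℕ}

/-- A telescoping sum over the elements of `J`: those below `i` contribute `1 - x^(below J i)`, the
colour `i` itself, if present, the missing power. -/
theorem sum_setCoeff_neg (J : Finset (Fin r)) (i : Fin r) (x : K) :
    ∑ j ∈ J, (if j < i then 1 - x else if j = i then 1 else 0) * x ^ below J j =
      1 - if i ∈ J then 0 else x ^ below J i := by
  have h1 : ∀ j ∈ J, (if j < i then 1 - x else if j = i then 1 else 0) * x ^ below J j =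
      (if j < i then (1 - x) * x ^ below J j else 0) + (if j = i then x ^ below J j else 0) := by
    intro j _
    rcases lt_trichotomy j i with h | h | h
    · rw [if_pos h, if_pos h, if_neg h.ne, add_zero]
    · rw [if_neg h.not_lt, if_pos h, if_neg h.not_lt, if_pos h, one_mul, zero_add]
    · rw [if_neg h.le.not_gt, if_neg h.ne', if_neg h.le.not_gt, if_neg h.ne', zero_mul, add_zero]
  rw [Finset.sum_congr rfl h1, Finset.sum_add_distrib, ← Finset.sum_filter, Finset.sum_ite_eq',
    ← Finset.mul_sum]
  have h2 : ∀ j ∈ J.filter (· < i), x ^ below J j = x ^ below (J.filter (· < i)) j := by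
    intro j hj
    rw [Finset.mem_filter] at hj
    unfold below
    rw [Finset.filter_filter]
    congr 2
    ext a
    simp only [Finset.mem_filter]
    constructor
    · rintro ⟨h3, h4⟩
      exact ⟨h3, h4.trans hj.2, h4⟩
    · rintro ⟨h3, -, h4⟩
      exact ⟨h3, h4⟩
  rw [Finset.sum_congr rfl h2, sum_below _ fun s => x ^ s, mul_neg_geom_sum]
  show 1 - x ^ below J i + _ = _
  split_ifs <;> ring

/-- The contraction of the negative modes of `: ∏_{j ∈ J} Λ^j :` with `b_n^i`, for `n > 0`. -/
theorem annihilate_setCoeff [CharZero K] (J : Finset (Fin r)) (n : ℕ) (hn : (n : ℤ) ≠ 0) (i : Fin r) :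
    annihilate q₁ q₂ (setCoeff (q₁ * q₂) J) (idx ⟨n, hn⟩ i) =
      -((1 - q₁ ^ n) * (1 - q₂ ^ n) *
        (1 - if i ∈ J then 0 else ((q₁ * q₂) ^ (-(n : ℤ))) ^ below J i)) := by
  have hn0 : (n : K) ≠ 0 := by
    rw [Nat.cast_ne_zero]
    omega
  rw [annihilate, if_pos (by rw [mode_idx]; dsimp only; omega), ← sum_setCoeff_neg,
    ← Finset.univ_inter J, ← Finset.filter_mem_eq_inter, Finset.sum_filter, Finset.mul_sum,
    ← Finset.sum_neg_distrib]
  refine Finset.sum_congr rfl fun j _ => ?_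
  rw [Finset.filter_mem_eq_inter, Finset.univ_inter]
  have h1 : opp (idx ⟨(n : ℤ), hn⟩ i) j = idx (negMode ⟨(n : ℤ), hn⟩) j := rfl
  have h2 : setCoeff (q₁ * q₂) J (idx (negMode ⟨(n : ℤ), hn⟩) j) =
      if j ∈ J then ((q₁ * q₂) ^ (-(n : ℤ))) ^ below J j / (n : K) else 0 := by
    rw [setCoeff_idx]
    show (if j ∈ J then (q₁ * q₂) ^ (-(n : ℤ) * (below J j : ℤ)) /
      (((-(n : ℤ)).natAbs : ℕ) : K) else 0) = _
    rw [zpow_mul, zpow_natCast, Int.natAbs_neg, Int.natAbs_natCast]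
  have h3 : bracket q₁ q₂ (idx ⟨(n : ℤ), hn⟩ i) (idx (negMode ⟨(n : ℤ), hn⟩) j) =
      -(n * (1 - q₁ ^ n) * (1 - q₂ ^ n) *
        (if j < i then 1 - (q₁ * q₂) ^ (-(n : ℤ)) else if j = i then 1 else 0)) := by
    unfold bracket
    rw [mode_idx, mode_idx, if_pos (by simp [negMode]), if_neg (by simp [negMode]), colour_idx,
      colour_idx, pairing, zpow_natCast, zpow_natCast]
    push_cast
    rfl
  rw [h1, h2, h3]
  split_ifs <;> field_simp <;> simp

/-- The difference between the numbers of elements of `I` and of `J` below `i`.  A colour `i` of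
`I \ J` contributes `ζ(q^(height I J i) z)` to the contraction factor of `(I, J)`. -/
def height (I J : Finset (Fin r)) (i : Fin r) : ℤ := (below I i : ℤ) - below J i

/-- The logarithm of the contraction factor of the terms of `W_k(x)` and `W_{k'}(y)` given by `I` and
`J`. -/
theorem modeSeries_setCoeff [CharZero K] (hq : AlgebraicIndependent ℚ ![q₁, q₂])
    (I J : Finset (Fin r)) :
    modeSeries (fun g => setCoeff (q₁ * q₂) I g *
        annihilate q₁ q₂ (setCoeff (q₁ * q₂) J) g) +
      ∑ s ∈ Finset.range I.card, logZetaSeries q₁ q₂ ((q₁ * q₂) ^ s) =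
    ∑ i ∈ I \ J, logZetaSeries q₁ q₂ ((q₁ * q₂) ^ height I J i) := by
  have hq0 := q_ne_zero hq
  ext n
  rw [map_add, map_sum, map_sum]
  simp only [logZetaSeries, coeff_mk]
  rw [← Finset.mul_sum, ← Finset.mul_sum, modeSeries, coeff_mk]
  by_cases hn : (n : ℤ) ≠ 0
  · rw [dif_pos hn]
    simp only [annihilate_setCoeff q₁ q₂ J n hn, setCoeff_idx]
    have hn0 : (n : K) ≠ 0 := by
      rw [Nat.cast_ne_zero]
      omega
    have h1 : ∀ i : Fin r, (if i ∈ I then (q₁ * q₂) ^ ((n : ℤ) * (below I i : ℤ)) /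
        (((n : ℤ).natAbs : ℕ) : K) else 0) * -((1 - q₁ ^ n) * (1 - q₂ ^ n) *
        (1 - if i ∈ J then 0 else ((q₁ * q₂) ^ (-(n : ℤ))) ^ below J i)) =
        (1 - q₁ ^ n) * (1 - q₂ ^ n) / n * ((if i ∈ I then (if i ∉ J then
          ((q₁ * q₂) ^ height I J i) ^ n else 0) else 0) -
            if i ∈ I then ((q₁ * q₂) ^ below I i) ^ n else 0) := by
      intro i
      have e1 : ((q₁ * q₂) ^ height I J i) ^ n = (q₁ * q₂) ^ ((n : ℤ) * (below I i : ℤ)) *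
          ((q₁ * q₂) ^ (-(n : ℤ))) ^ below J i := by
        rw [← zpow_natCast, ← zpow_natCast, ← zpow_mul, ← zpow_mul, ← zpow_add₀ hq0]
        congr 1
        unfold height
        ring
      have e2 : ((q₁ * q₂) ^ below I i) ^ n = (q₁ * q₂) ^ ((n : ℤ) * (below I i : ℤ)) := by
        rw [← pow_mul, ← zpow_natCast]
        congr 1
        push_cast
        ring
      rw [e1, e2, Int.natAbs_natCast]
      by_cases hI : i ∈ I <;> by_cases hJ : i ∈ J <;>
        simp only [hI, hJ, if_true, if_false, not_true, not_false_iff] <;> field_simp <;> ring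
    rw [Finset.sum_congr rfl fun i _ => h1 i, ← Finset.mul_sum, ← mul_add,
      Finset.sum_sub_distrib]
    congr 1
    rw [← Finset.sum_filter, ← Finset.sum_filter, Finset.filter_mem_eq_inter, Finset.univ_inter,
      ← Finset.sum_filter, ← Finset.sdiff_eq_filter, Finset.filter_mem_eq_inter,
      Finset.univ_inter, sum_below I fun s => ((q₁ * q₂) ^ s) ^ n, sub_add_cancel]
  · rw [dif_neg hn]
    have : n = 0 := by omega
    subst this
    simp

/-- The function `f_{k k'}` completes the contraction factor of the terms given by `I` and `J` to a
product of functions `ζ`, up to a factor independent of `I` and `J`. -/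
theorem expWeight_mul_fSeries [CharZero K] (hq : AlgebraicIndependent ℚ ![q₁, q₂]) {k : ℕ} (k' : ℕ)
    {I J : Finset (Fin r)} (hI : I.card = k) :
    (mk fun n : ℕ => expWeight (fun g => setCoeff (q₁ * q₂) I g *
        annihilate q₁ q₂ (setCoeff (q₁ * q₂) J) g) n) * fSeries q₁ q₂ k k' *
      ∏ s ∈ Finset.range (k - k'), zetaSeries q₁ q₂ ((q₁ * q₂) ^ s) =
    ∏ i ∈ I \ J, zetaSeries q₁ q₂ ((q₁ * q₂) ^ height I J i) := by
  have h1 := ((isExpOf_expWeight (annihilate_of_neg q₁ q₂ (setCoeff (q₁ * q₂) I)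
    (setCoeff (q₁ * q₂) J))).mul (isExpOf_fSeries q₁ q₂ hq k k')).mul
    (IsExpOf.prod (Finset.range (k - k')) fun s _ =>
      isExpOf_zetaSeries q₁ q₂ ((q₁ * q₂) ^ s))
  have h2 := IsExpOf.prod (I \ J) fun i _ =>
    isExpOf_zetaSeries q₁ q₂ ((q₁ * q₂) ^ height I J i)
  refine h1.unique ?_
  rw [add_assoc, add_comm (∑ s ∈ Finset.Ico _ _, _), Finset.sum_range_add_sum_Ico _
    (Nat.sub_le k k'), ← hI, modeSeries_setCoeff q₁ q₂ hq]
  exact h2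

end ContractionFactor

/-! ### Products of two currents as expansions of rational functions -/

section Expansion

open PowerSeries Finset.HasAntidiagonal

variable {K : Type*} [Field K]

theorem ratFunc_one_sub_ne_zero (c : K) : (1 - RatFunc.C c * RatFunc.X : RatFunc K) ≠ 0 := by
  have : (1 - RatFunc.C c * RatFunc.X : RatFunc K) =
      algebraMap (Polynomial K) (RatFunc K) (1 - Polynomial.C c * Polynomial.X) := by
    simp
  rw [this]
  refine RatFunc.algebraMap_ne_zero fun h => ?_
  have := congrArg (Polynomial.eval 0) h
  simp at this

theorem coe_ratFunc_C (c : K) :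
    ((RatFunc.C c : RatFunc K) : LaurentSeries K) = HahnSeries.C c := by
  have h := RatFunc.coe_coe (Polynomial.C c)
  rw [Polynomial.coe_C, PowerSeries.coe_C, RatFunc.coePolynomial_eq_algebraMap,
    RatFunc.algebraMap_C] at h
  exact h.symm

theorem laurent_algebraMap (c : K) :
    algebraMap K (LaurentSeries K) c = HahnSeries.C c := by
  exact (HahnSeries.algebraMap_apply' ℤ c).trans (PowerSeries.coe_C c)

/-- The expansion of rational functions at `z = 0`. -/
def toLaurent : RatFunc K →ₐ[K] LaurentSeries K where
  toFun R := R
  map_one' := map_one _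
  map_mul' := map_mul _
  map_zero' := map_zero _
  map_add' := map_add _
  commutes' c := (coe_ratFunc_C c).trans (laurent_algebraMap c).symm

theorem toLaurent_apply (R : RatFunc K) : toLaurent R = (R : LaurentSeries K) := rfl

theorem toLaurent_C (c : K) : toLaurent (RatFunc.C c) = HahnSeries.C c := coe_ratFunc_C c

theorem toLaurent_X : toLaurent (RatFunc.X : RatFunc K) = HahnSeries.single 1 1 :=
  RatFunc.coe_X

theorem toLaurent_one_sub (c : K) :
    toLaurent (1 - RatFunc.C c * RatFunc.X) = HahnSeries.ofPowerSeries ℤ K (1 - C c * X) := by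
  rw [map_sub, map_mul, toLaurent_C, toLaurent_X, map_one, PowerSeries.coe_sub,
    PowerSeries.coe_mul, PowerSeries.coe_C, PowerSeries.coe_X, PowerSeries.coe_one]

variable (q₁ q₂ : K)

/-- The rational function `ζ(c z)`. -/
def zetaFunc (c : K) : RatFunc K :=
  zeta (RatFunc.C q₁) (RatFunc.C q₂) (RatFunc.C c * RatFunc.X)

theorem zetaFunc_eq (c : K) : zetaFunc q₁ q₂ c =
    (1 - RatFunc.C (q₁ * c) * RatFunc.X) * (1 - RatFunc.C (q₂ * c) * RatFunc.X) /
      ((1 - RatFunc.C c * RatFunc.X) * (1 - RatFunc.C (q₁ * q₂ * c) * RatFunc.X)) := by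
  simp only [zetaFunc, zeta, map_mul, mul_assoc]

theorem zetaFunc_ne_zero (c : K) : zetaFunc q₁ q₂ c ≠ 0 := by
  rw [zetaFunc_eq]
  exact div_ne_zero (mul_ne_zero (ratFunc_one_sub_ne_zero _) (ratFunc_one_sub_ne_zero _))
    (mul_ne_zero (ratFunc_one_sub_ne_zero _) (ratFunc_one_sub_ne_zero _))

theorem toLaurent_zetaFunc (c : K) :
    toLaurent (zetaFunc q₁ q₂ c) = HahnSeries.ofPowerSeries ℤ K (zetaSeries q₁ q₂ c) := by
  have hne : (1 - RatFunc.C c * RatFunc.X) * (1 - RatFunc.C (q₁ * q₂ * c) * RatFunc.X) ≠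
      (0 : RatFunc K) :=
    mul_ne_zero (ratFunc_one_sub_ne_zero _) (ratFunc_one_sub_ne_zero _)
  have h1 : constantCoeff ((1 - C c * X) * (1 - C (q₁ * q₂ * c) * X)) ≠ 0 := by simp
  have h2 := PowerSeries.inv_mul_cancel _ h1
  have h3 : zetaSeries q₁ q₂ c * ((1 - C c * X) * (1 - C (q₁ * q₂ * c) * X)) =
      (1 - C (q₁ * c) * X) * (1 - C (q₂ * c) * X) := by
    rw [zetaSeries, mul_assoc, h2, mul_one]
  rw [zetaFunc_eq, map_div₀, div_eq_iff ((map_ne_zero _).mpr hne),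
    map_mul _ (1 - RatFunc.C (q₁ * c) * RatFunc.X) (1 - RatFunc.C (q₂ * c) * RatFunc.X),
    map_mul _ (1 - RatFunc.C c * RatFunc.X) (1 - RatFunc.C (q₁ * q₂ * c) * RatFunc.X),
    toLaurent_one_sub, toLaurent_one_sub, toLaurent_one_sub, toLaurent_one_sub,
    ← PowerSeries.coe_mul, ← PowerSeries.coe_mul, ← PowerSeries.coe_mul, h3]

/-- The coefficients of the exponent of `: A(x) B(y) :` as rational functions of `z = y / x`,
up to the common power of `y`. -/
def pairCoeff {r : ℕ} (α β : Idx r → K) (g : Idx r) : RatFunc K :=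
  RatFunc.X ^ mode g * RatFunc.C (α g) + RatFunc.C (β g)

variable {r : ℕ}

/-- The normally ordered product of two exponentials, with `x` and `y` restored, times a series in
`y / x`. -/
theorem coeff_toLaurent_pairCoeff_mul [CharZero K] (α β : Idx r → K) (l : Idx r →₀ ℕ)
    (S : LaurentSeries K) (a : ℤ) :
    (toLaurent (MvPowerSeries.coeff l (mvExp K (pairCoeff α β))) * S).coeff a =
      ∑ p ∈ antidiagonal l, MvPowerSeries.coeff p.1 (mvExp K α) *
        MvPowerSeries.coeff p.2 (mvExp K β) * S.coeff (a - weight r p.1) := by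
  have e1 := map_coeff_mvExp K toLaurent (pairCoeff α β) l
  have e2 : (fun g => toLaurent (pairCoeff α β g)) =
      (fun g => HahnSeries.single (mode g) (1 : K) * Algebra.ofId K (LaurentSeries K) (α g)) +
        (fun g => Algebra.ofId K (LaurentSeries K) (β g)) := by
    funext g
    show toLaurent (RatFunc.X ^ mode g * RatFunc.C (α g) + RatFunc.C (β g)) =
      HahnSeries.single (mode g) (1 : K) * algebraMap K _ (α g) + algebraMap K _ (β g)
    rw [map_add, map_mul, map_zpow₀, toLaurent_X, toLaurent_C, toLaurent_C, laurent_algebraMap,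
      laurent_algebraMap, RatFunc.single_zpow (mode g)]
  have e3 : ∀ m : Idx r →₀ ℕ, (m.prod fun g k => (HahnSeries.single (mode g) (1 : K) :
      LaurentSeries K) ^ k) = HahnSeries.single (weight r m) 1 := by
    intro m
    rw [weight_eq_sum, Finsupp.prod, Finsupp.sum]
    induction m.support using Finset.cons_induction with
    | empty => simp
    | cons g s hg ih =>
      rw [Finset.prod_cons, Finset.sum_cons, ih, HahnSeries.single_pow, HahnSeries.single_mul_single]
      simp
  rw [e2, mvExp_add, MvPowerSeries.coeff_mul] at e1
  rw [e1, Finset.sum_mul, HahnSeries.coeff_sum]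
  refine Finset.sum_congr rfl fun p _ => ?_
  rw [coeff_mvExp_mul, e3, ← map_coeff_mvExp, ← map_coeff_mvExp]
  show (HahnSeries.single (weight r p.1) 1 * algebraMap K _ _ * algebraMap K _ _ * S).coeff a = _
  rw [laurent_algebraMap, laurent_algebraMap, HahnSeries.C_apply, HahnSeries.C_apply, HahnSeries.single_mul_single,
    HahnSeries.single_mul_single, HahnSeries.coeff_single_mul]
  simp

/-- A coefficient of the product of `f` with the generating function of `φ`. -/
theorem sum_range_coeff_mul {φ : ℤ → K} (hφ : ∀ w < 0, φ w = 0) (f : K⟦X⟧) {w : ℤ} {N : ℕ}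
    (hN : w < N) : ∑ n ∈ Finset.range N, coeff n f * φ (w - n) =
      (HahnSeries.ofPowerSeries ℤ K ((mk fun n : ℕ => φ n) * f)).coeff w := by
  rw [PowerSeries.coeff_coe]
  split_ifs with h
  · exact Finset.sum_eq_zero fun n _ => by rw [hφ _ (by omega), mul_zero]
  · obtain ⟨m, rfl⟩ := Int.eq_ofNat_of_zero_le (not_lt.mp h)
    rw [Int.natAbs_natCast, mul_comm, coeff_mul, Finset.Nat.sum_antidiagonal_eq_sum_range_succ_mk]
    symm
    apply Finset.sum_subset_zero_on_sdiff
    · intro n hn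
      rw [Finset.mem_range] at *
      omega
    · intro n hn
      rw [Finset.mem_sdiff, Finset.mem_range, Finset.mem_range] at hn
      rw [hφ _ (by omega), mul_zero]
    · intro n hn
      rw [Finset.mem_range] at hn
      rw [coeff_mk, Nat.cast_sub (by omega)]

variable [CharZero K] (u : Fin r → K)

theorem wMode_eq_sum (k : ℕ) (d : ℤ) : wMode q₁ q₂ u k d =
    ∑ I ∈ Finset.powersetCard k Finset.univ,
      (∏ i ∈ I, u i) • expMode (setCoeff (q₁ * q₂) I) d := by
  ext l
  rw [coeff_wMode, map_sum]
  simp only [map_smul, coeff_expMode, smul_eq_mul]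
  split_ifs <;> simp

theorem coeff_starMul_wMode (k k' : ℕ) (a b : ℤ) (l : Idx r →₀ ℕ) :
    MvPowerSeries.coeff l (starMul q₁ q₂ (wMode q₁ q₂ u k a) (wMode q₁ q₂ u k' b)) =
      if weight r l = a + b then
        ∑ I ∈ Finset.powersetCard k Finset.univ, ∑ J ∈ Finset.powersetCard k' Finset.univ,
          ((∏ i ∈ I, u i) * ∏ j ∈ J, u j) * ∑ p ∈ antidiagonal l,
            MvPowerSeries.coeff p.1 (mvExp K (setCoeff (q₁ * q₂) I)) *
              MvPowerSeries.coeff p.2 (mvExp K (setCoeff (q₁ * q₂) J)) *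
              expWeight (fun g => setCoeff (q₁ * q₂) I g *
                annihilate q₁ q₂ (setCoeff (q₁ * q₂) J) g) (a - weight r p.1)
      else 0 := by
  rw [wMode_eq_sum, wMode_eq_sum, starMul_sum_smul q₁ q₂
    (fun I _ => isHomogeneous_expMode _ a) (fun J _ => isHomogeneous_expMode _ b)]
  simp only [map_sum, map_smul, coeff_starMul_expMode, smul_eq_mul]
  split_ifs <;> simp

theorem coeff_currentTerm_wMode (f : K⟦X⟧) (k k' : ℕ) (a b : ℤ) (l : Idx r →₀ ℕ) (n : ℕ) :
    MvPowerSeries.coeff l (currentTerm q₁ q₂ (wMode q₁ q₂ u k) (wMode q₁ q₂ u k') f a b n) =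
      if weight r l = a + b then
        ∑ I ∈ Finset.powersetCard k Finset.univ, ∑ J ∈ Finset.powersetCard k' Finset.univ,
          ((∏ i ∈ I, u i) * ∏ j ∈ J, u j) * ∑ p ∈ antidiagonal l,
            MvPowerSeries.coeff p.1 (mvExp K (setCoeff (q₁ * q₂) I)) *
              MvPowerSeries.coeff p.2 (mvExp K (setCoeff (q₁ * q₂) J)) *
              (coeff n f * expWeight (fun g => setCoeff (q₁ * q₂) I g *
                annihilate q₁ q₂ (setCoeff (q₁ * q₂) J) g) (a - weight r p.1 - n))
      else 0 := by
  have h1 : a - (n : ℤ) + (b + n) = a + b := by ring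
  rw [currentTerm, map_smul, coeff_starMul_wMode, h1, smul_eq_mul]
  split_ifs
  · rw [Finset.mul_sum]
    refine Finset.sum_congr rfl fun I _ => ?_
    rw [Finset.mul_sum]
    refine Finset.sum_congr rfl fun J _ => ?_
    rw [mul_left_comm, Finset.mul_sum]
    congr 1
    refine Finset.sum_congr rfl fun p _ => ?_
    rw [mul_left_comm, sub_right_comm]
  · exact mul_zero _

theorem exists_weight_lt (a : ℤ) (l : Idx r →₀ ℕ) :
    ∃ N : ℕ, ∀ p ∈ antidiagonal l, a - weight r p.1 < N := by
  refine ⟨∑ p ∈ antidiagonal l, (a - weight r p.1).natAbs + 1, fun p hp => ?_⟩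
  have : (a - weight r p.1).natAbs ≤ ∑ p ∈ antidiagonal l, (a - weight r p.1).natAbs :=
    Finset.single_le_sum (f := fun p : (Idx r →₀ ℕ) × (Idx r →₀ ℕ) =>
      (a - weight r p.1).natAbs) (fun _ _ => Nat.zero_le _) hp
  omega

theorem support_currentTerm_wMode (f : K⟦X⟧) (k k' : ℕ) (a b : ℤ) (l : Idx r →₀ ℕ) {N : ℕ}
    (hN : ∀ p ∈ antidiagonal l, a - weight r p.1 < N) :
    (Function.support fun n : ℕ => MvPowerSeries.coeff l
      (currentTerm q₁ q₂ (wMode q₁ q₂ u k) (wMode q₁ q₂ u k') f a b n)) ⊆ Finset.range N := by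
  intro n hn
  rw [Finset.coe_range, Set.mem_Iio]
  by_contra hc
  refine hn ((coeff_currentTerm_wMode q₁ q₂ u f k k' a b l n).trans ?_)
  split_ifs
  · refine Finset.sum_eq_zero fun I _ => Finset.sum_eq_zero fun J _ => ?_
    rw [Finset.sum_eq_zero, mul_zero]
    intro p hp
    have := hN p hp
    rw [expWeight_of_neg (annihilate_of_neg q₁ q₂ _ _) (by omega), mul_zero, mul_zero]
  · rfl

theorem currentSummable_wMode (f : K⟦X⟧) (k k' : ℕ) :
    CurrentSummable q₁ q₂ (wMode q₁ q₂ u k) (wMode q₁ q₂ u k') f := by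
  refine ⟨fun a b => (isHomogeneous_wMode q₁ q₂ u k a).starSummable q₁ q₂
    (isHomogeneous_wMode q₁ q₂ u k' b), fun a b l => ?_⟩
  obtain ⟨N, hN⟩ := exists_weight_lt a l
  exact (Finset.finite_toSet _).subset (support_currentTerm_wMode q₁ q₂ u f k k' a b l hN)

/-- The sum over pairs of sets of colours of sizes `k` and `k'`, which is the coefficient of the
basis vector `l` in `W_k(x) W_{k'}(y) f_{k k'}(y / x) ∏_{s < k - k'} ζ(q^s y / x)`, as a rational
function of `y / x`. -/
def pairSum (k k' : ℕ) (l : Idx r →₀ ℕ) : RatFunc K :=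
  ∑ I ∈ Finset.powersetCard k Finset.univ, ∑ J ∈ Finset.powersetCard k' Finset.univ,
    RatFunc.C ((∏ i ∈ I, u i) * ∏ j ∈ J, u j) *
      (MvPowerSeries.coeff l (mvExp K (pairCoeff (setCoeff (q₁ * q₂) I) (setCoeff (q₁ * q₂) J))) *
        ∏ i ∈ I \ J, zetaFunc q₁ q₂ ((q₁ * q₂) ^ height I J i))

/-- The coefficient of the basis vector `l` in `W_k(x) W_{k'}(y) f_{k k'}(y / x)`, as a rational
function of `y / x`. -/
def currentFunc (k k' : ℕ) (l : Idx r →₀ ℕ) : RatFunc K :=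
  pairSum q₁ q₂ u k k' l / ∏ s ∈ Finset.range (k - k'), zetaFunc q₁ q₂ ((q₁ * q₂) ^ s)

/-- Each coefficient of `W_k(x) W_{k'}(y) f_{k k'}(y / x)` is the expansion at `0` of a rational function
of `y / x`. -/
theorem coeff_currentMul_wMode (hq : AlgebraicIndependent ℚ ![q₁, q₂]) (k k' : ℕ) (a b : ℤ)
    (l : Idx r →₀ ℕ) :
    MvPowerSeries.coeff l (currentMul q₁ q₂ (wMode q₁ q₂ u k) (wMode q₁ q₂ u k')
      (fSeries q₁ q₂ k k') a b) =
      if weight r l = a + b then (currentFunc q₁ q₂ u k k' l : LaurentSeries K).coeff a else 0 := by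
  obtain ⟨N, hN⟩ := exists_weight_lt a l
  show ∑ᶠ n : ℕ, _ = _
  rw [finsum_eq_sum_of_support_subset _ (support_currentTerm_wMode q₁ q₂ u _ k k' a b l hN)]
  simp only [coeff_currentTerm_wMode]
  split_ifs
  · have hz : toLaurent (∏ s ∈ Finset.range (k - k'), zetaFunc q₁ q₂ ((q₁ * q₂) ^ s)) ≠ 0 :=
      (map_ne_zero _).mpr (Finset.prod_ne_zero_iff.mpr fun s _ => zetaFunc_ne_zero q₁ q₂ _)
    have hR : toLaurent (currentFunc q₁ q₂ u k k' l) =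
        ∑ I ∈ Finset.powersetCard k Finset.univ, ∑ J ∈ Finset.powersetCard k' Finset.univ,
          HahnSeries.single 0 ((∏ i ∈ I, u i) * ∏ j ∈ J, u j) *
            (toLaurent (MvPowerSeries.coeff l (mvExp K (pairCoeff (setCoeff (q₁ * q₂) I)
              (setCoeff (q₁ * q₂) J)))) *
              HahnSeries.ofPowerSeries ℤ K ((mk fun n : ℕ => expWeight (fun g =>
                setCoeff (q₁ * q₂) I g * annihilate q₁ q₂ (setCoeff (q₁ * q₂) J) g) n) *
                  fSeries q₁ q₂ k k')) := by
      rw [currentFunc, map_div₀, div_eq_iff hz, pairSum, map_sum, Finset.sum_mul]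
      refine Finset.sum_congr rfl fun I hI => ?_
      rw [map_sum, Finset.sum_mul]
      refine Finset.sum_congr rfl fun J _ => ?_
      rw [map_mul toLaurent (RatFunc.C _), toLaurent_C,
        map_mul toLaurent (MvPowerSeries.coeff l _), map_prod, map_prod, mul_assoc, mul_assoc]
      simp only [toLaurent_zetaFunc]
      rw [← map_prod, ← map_prod, ← PowerSeries.coe_mul, expWeight_mul_fSeries q₁ q₂ hq k'
        (Finset.mem_powersetCard.mp hI).2]
      rfl
    rw [← toLaurent_apply, hR, HahnSeries.coeff_sum, Finset.sum_comm]
    refine Finset.sum_congr rfl fun I _ => ?_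
    rw [HahnSeries.coeff_sum, Finset.sum_comm]
    refine Finset.sum_congr rfl fun J _ => ?_
    rw [← Finset.mul_sum, Finset.sum_comm, HahnSeries.coeff_single_zero_mul,
      coeff_toLaurent_pairCoeff_mul]
    congr 1
    refine Finset.sum_congr rfl fun p hp => ?_
    rw [← Finset.mul_sum, sum_range_coeff_mul
      (fun w hw => expWeight_of_neg (annihilate_of_neg q₁ q₂ _ _) hw) _ (hN p hp)]
  · exact Finset.sum_const_zero

end Expansion

/-! ### Values of rational functions -/

section RationalFunctions

open Polynomial (eval)

variable {K : Type*} [Field K]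

/-- The rational function `R` is regular at `c`, with value `v`.  The fraction `P / Q` need not be
reduced, which makes sums and products immediate. -/
def RegAt (c : K) (R : RatFunc K) (v : K) : Prop :=
  ∃ P Q : Polynomial K, eval c Q ≠ 0 ∧
    R * algebraMap (Polynomial K) (RatFunc K) Q = algebraMap (Polynomial K) (RatFunc K) P ∧
    eval c P = v * eval c Q

theorem regAt_algebraMap (c : K) (P : Polynomial K) :
    RegAt c (algebraMap (Polynomial K) (RatFunc K) P) (eval c P) :=
  ⟨P, 1, by simp, by simp, by simp⟩

theorem regAt_C (c a : K) : RegAt c (RatFunc.C a) a := by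
  simpa using regAt_algebraMap c (Polynomial.C a)

theorem regAt_zero (c : K) : RegAt c 0 0 := by
  simpa using regAt_C c 0

theorem regAt_one (c : K) : RegAt c 1 1 := by
  simpa using regAt_C c 1

theorem regAt_X (c : K) : RegAt c RatFunc.X c := by
  simpa using regAt_algebraMap c Polynomial.X

theorem RegAt.congr_left {c : K} {R S : RatFunc K} {v : K} (hRS : S = R) (h : RegAt c R v) :
    RegAt c S v :=
  hRS ▸ h

theorem RegAt.congr_right {c : K} {R : RatFunc K} {v w : K} (h : RegAt c R v) (hvw : w = v) :
    RegAt c R w :=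
  hvw ▸ h

theorem RegAt.add {c : K} {R S : RatFunc K} {v w : K} (hR : RegAt c R v) (hS : RegAt c S w) :
    RegAt c (R + S) (v + w) := by
  obtain ⟨P, Q, h1, h2, h3⟩ := hR
  obtain ⟨P', Q', h1', h2', h3'⟩ := hS
  refine ⟨P * Q' + P' * Q, Q * Q', ?_, ?_, ?_⟩
  · rw [Polynomial.eval_mul]
    exact mul_ne_zero h1 h1'
  · simp only [map_add, map_mul, ← h2, ← h2']
    ring
  · simp only [Polynomial.eval_add, Polynomial.eval_mul, h3, h3']
    ring

theorem RegAt.mul {c : K} {R S : RatFunc K} {v w : K} (hR : RegAt c R v) (hS : RegAt c S w) :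
    RegAt c (R * S) (v * w) := by
  obtain ⟨P, Q, h1, h2, h3⟩ := hR
  obtain ⟨P', Q', h1', h2', h3'⟩ := hS
  refine ⟨P * P', Q * Q', ?_, ?_, ?_⟩
  · rw [Polynomial.eval_mul]
    exact mul_ne_zero h1 h1'
  · simp only [map_mul, ← h2, ← h2']
    ring
  · simp only [Polynomial.eval_mul, h3, h3']
    ring

theorem RegAt.neg {c : K} {R : RatFunc K} {v : K} (hR : RegAt c R v) : RegAt c (-R) (-v) := by
  have := (regAt_C c (-1)).mul hR
  simpa using this

theorem RegAt.sub {c : K} {R S : RatFunc K} {v w : K} (hR : RegAt c R v) (hS : RegAt c S w) :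
    RegAt c (R - S) (v - w) := by
  rw [sub_eq_add_neg, sub_eq_add_neg]
  exact hR.add hS.neg

theorem RegAt.inv {c : K} {R : RatFunc K} {v : K} (hR : RegAt c R v) (hv : v ≠ 0) :
    RegAt c R⁻¹ v⁻¹ := by
  obtain ⟨P, Q, h1, h2, h3⟩ := hR
  have hP : eval c P ≠ 0 := by
    rw [h3]
    exact mul_ne_zero hv h1
  have hP0 : algebraMap (Polynomial K) (RatFunc K) P ≠ 0 := by
    refine RatFunc.algebraMap_ne_zero ?_
    rintro rfl
    simp at hP
  have hR0 : R ≠ 0 := by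
    rintro rfl
    rw [zero_mul] at h2
    exact hP0 h2.symm
  refine ⟨Q, P, hP, ?_, ?_⟩
  · rw [← h2, inv_mul_cancel_left₀ hR0]
  · rw [h3, inv_mul_cancel_left₀ hv]

theorem RegAt.div {c : K} {R S : RatFunc K} {v w : K} (hR : RegAt c R v) (hS : RegAt c S w)
    (hw : w ≠ 0) : RegAt c (R / S) (v / w) := by
  rw [div_eq_mul_inv, div_eq_mul_inv]
  exact hR.mul (hS.inv hw)

theorem RegAt.sum {ι : Type*} {c : K} (s : Finset ι) {R : ι → RatFunc K} {v : ι → K}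
    (h : ∀ i ∈ s, RegAt c (R i) (v i)) : RegAt c (∑ i ∈ s, R i) (∑ i ∈ s, v i) := by
  induction s using Finset.cons_induction with
  | empty => exact regAt_zero c
  | cons a s ha ih =>
    rw [Finset.sum_cons, Finset.sum_cons]
    exact (h a (Finset.mem_cons_self a s)).add
      (ih fun i hi => h i (Finset.mem_cons.mpr (Or.inr hi)))

theorem RegAt.prod {ι : Type*} {c : K} (s : Finset ι) {R : ι → RatFunc K} {v : ι → K}
    (h : ∀ i ∈ s, RegAt c (R i) (v i)) : RegAt c (∏ i ∈ s, R i) (∏ i ∈ s, v i) := by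
  induction s using Finset.cons_induction with
  | empty => exact regAt_one c
  | cons a s ha ih =>
    rw [Finset.prod_cons, Finset.prod_cons]
    exact (h a (Finset.mem_cons_self a s)).mul
      (ih fun i hi => h i (Finset.mem_cons.mpr (Or.inr hi)))

theorem RegAt.pow {c : K} {R : RatFunc K} {v : K} (hR : RegAt c R v) (n : ℕ) :
    RegAt c (R ^ n) (v ^ n) := by
  simpa using RegAt.prod (Finset.range n) fun _ _ => hR

theorem RegAt.zpow {c : K} {R : RatFunc K} {v : K} (hR : RegAt c R v) (hv : v ≠ 0) (n : ℤ) :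
    RegAt c (R ^ n) (v ^ n) := by
  cases n with
  | ofNat n => simpa using hR.pow n
  | negSucc n =>
    rw [zpow_negSucc, zpow_negSucc]
    exact (hR.pow _).inv (pow_ne_zero _ hv)

theorem RegAt.denom_ne_zero {c : K} {R : RatFunc K} {v : K} (hR : RegAt c R v) :
    eval c R.denom ≠ 0 := by
  obtain ⟨P, Q, h1, h2, h3⟩ := hR
  intro h
  have h4 : R.num * Q = P * R.denom := by
    apply RatFunc.algebraMap_injective K
    rw [map_mul, map_mul, ← h2, mul_right_comm]
    congr 1
    conv_rhs => rw [← RatFunc.num_div_denom R]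
    rw [RatFunc.num_div_denom, ← div_eq_iff (RatFunc.algebraMap_ne_zero R.denom_ne_zero),
      RatFunc.num_div_denom]
  have h5 := congrArg (eval c) h4
  rw [Polynomial.eval_mul, Polynomial.eval_mul, h, mul_zero] at h5
  have h6 := (mul_eq_zero.mp h5).resolve_right h1
  obtain ⟨a, b, hab⟩ := R.isCoprime_num_denom
  have h7 := congrArg (eval c) hab
  simp [h, h6] at h7

theorem RegAt.eval_eq {c : K} {R : RatFunc K} {v : K} (hR : RegAt c R v) :
    R.eval (RingHom.id K) c = v := by
  have hd := hR.denom_ne_zero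
  obtain ⟨P, Q, h1, h2, h3⟩ := hR
  have h4 : R.num * Q = P * R.denom := by
    apply RatFunc.algebraMap_injective K
    rw [map_mul, map_mul, ← h2, mul_right_comm]
    congr 1
    rw [← div_eq_iff (RatFunc.algebraMap_ne_zero R.denom_ne_zero), RatFunc.num_div_denom]
  have h5 := congrArg (eval c) h4
  rw [Polynomial.eval_mul, Polynomial.eval_mul, h3] at h5
  rw [RatFunc.eval, ← Polynomial.eval, ← Polynomial.eval, div_eq_iff hd]
  apply mul_right_cancel₀ h1
  rw [h5]
  ring

theorem RegAt.unique {c : K} {R : RatFunc K} {v w : K} (h : RegAt c R v) (h' : RegAt c R w) :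
    v = w := by
  rw [← h.eval_eq, h'.eval_eq]

theorem regAt_one_sub (a c : K) : RegAt c (1 - RatFunc.C a * RatFunc.X) (1 - a * c) :=
  (regAt_one c).sub ((regAt_C c a).mul (regAt_X c))

/-- If `(1 - a z) R` is a polynomial and `R` is regular at `1 / a`, then `R` is a polynomial. -/
theorem eq_algebraMap_of_regAt {a c v : K} (hac : a * c = 1) {R : RatFunc K} {P : Polynomial K}
    (h : RegAt c R v)
    (hP : R * (1 - RatFunc.C a * RatFunc.X) = algebraMap (Polynomial K) (RatFunc K) P) :
    ∃ P' : Polynomial K, R = algebraMap (Polynomial K) (RatFunc K) P' := by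
  have h1 := h.mul (regAt_one_sub a c)
  rw [hac, sub_self, mul_zero, hP] at h1
  have h2 := h1.unique (regAt_algebraMap c P)
  obtain ⟨Q, rfl⟩ := Polynomial.dvd_iff_isRoot.mpr (show P.IsRoot c from h2.symm)
  refine ⟨-(Polynomial.C c * Q), ?_⟩
  apply mul_right_cancel₀ (ratFunc_one_sub_ne_zero a)
  rw [hP]
  have h3 : (RatFunc.C a * RatFunc.C c : RatFunc K) = 1 := by rw [← map_mul, hac, map_one]
  simp only [map_mul, map_sub, map_neg, RatFunc.algebraMap_X, RatFunc.algebraMap_C]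
  linear_combination (-RatFunc.X * algebraMap (Polynomial K) (RatFunc K) Q) * h3

/-- A simple pole whose residue vanishes is no pole. -/
theorem regAt_of_mul_one_sub {a c : K} (hac : a * c = 1) {R : RatFunc K}
    (h : RegAt c ((1 - RatFunc.C a * RatFunc.X) * R) 0) : ∃ v, RegAt c R v := by
  obtain ⟨P, Q, h1, h2, h3⟩ := h
  rw [zero_mul] at h3
  obtain ⟨P', rfl⟩ := Polynomial.dvd_iff_isRoot.mpr (show P.IsRoot c from h3)
  refine ⟨eval c (-(Polynomial.C c * P')) / eval c Q, -(Polynomial.C c * P'), Q, h1, ?_, ?_⟩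
  · apply mul_left_cancel₀ (ratFunc_one_sub_ne_zero a)
    rw [← mul_assoc, h2]
    have h3 : (RatFunc.C a * RatFunc.C c : RatFunc K) = 1 := by rw [← map_mul, hac, map_one]
    simp only [map_mul, map_sub, map_neg, RatFunc.algebraMap_X, RatFunc.algebraMap_C]
    linear_combination (-RatFunc.X * algebraMap (Polynomial K) (RatFunc K) P') * h3
  · rw [div_mul_cancel₀ _ h1]

/-! ### The substitution `z ↦ z⁻¹` -/

/-- The automorphism `z ↦ z⁻¹` of the field of rational functions. -/
def invHom : RatFunc K →ₐ[K] RatFunc K :=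
  RatFunc.liftAlgHom (Polynomial.aeval (RatFunc.X⁻¹ : RatFunc K))
    (nonZeroDivisors_le_comap_nonZeroDivisors_of_injective _ (by
      rw [← transcendental_iff_injective]
      intro h
      exact RatFunc.transcendental_X (IsAlgebraic.inv_iff.mp h)))

theorem invHom_algebraMap (P : Polynomial K) :
    invHom (algebraMap (Polynomial K) (RatFunc K) P) = Polynomial.aeval RatFunc.X⁻¹ P := by
  rw [invHom, RatFunc.liftAlgHom_apply, RatFunc.num_algebraMap, RatFunc.denom_algebraMap, map_one,
    div_one]

theorem invHom_C (a : K) : invHom (RatFunc.C a) = RatFunc.C a :=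
  (invHom : RatFunc K →ₐ[K] RatFunc K).commutes a

theorem invHom_X : invHom (RatFunc.X : RatFunc K) = RatFunc.X⁻¹ := by
  have h := invHom_algebraMap (K := K) Polynomial.X
  rwa [RatFunc.algebraMap_X, Polynomial.aeval_X] at h

theorem RegAt.invHom {c : K} (hc : c ≠ 0) {R : RatFunc K} {v : K} (h : RegAt c R v) :
    RegAt c⁻¹ (invHom R) v := by
  have key : ∀ P : Polynomial K,
      RegAt c⁻¹ (DeformedW.invHom (algebraMap (Polynomial K) (RatFunc K) P)) (eval c P) := by
    intro P
    rw [invHom_algebraMap, Polynomial.aeval_eq_sum_range, Polynomial.eval_eq_sum_range]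
    refine RegAt.sum _ fun i _ => ?_
    rw [RatFunc.smul_eq_C_mul]
    refine (regAt_C _ _).mul (RegAt.pow ?_ i)
    simpa using (regAt_X c⁻¹).inv (inv_ne_zero hc)
  obtain ⟨P, Q, h1, h2, h3⟩ := h
  have h4 := (key P).div (key Q) h1
  have hQ : algebraMap (Polynomial K) (RatFunc K) Q ≠ 0 := by
    refine RatFunc.algebraMap_ne_zero ?_
    rintro rfl
    simp at h1
  rw [← h2, map_mul, mul_div_cancel_right₀ _ ((map_ne_zero _).mpr hQ), h3,
    mul_div_cancel_right₀ _ h1] at h4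
  exact h4

/-! ### Rational functions with prescribed poles -/

/-- The poles of `R` other than `0` and `∞` are inverses of elements of `S`. -/
def PolesIn (S : Set K) (R : RatFunc K) : Prop :=
  ∃ (N : ℕ) (s : Multiset K) (P : Polynomial K), (∀ a ∈ s, a ∈ S) ∧
    R * (RatFunc.X ^ N * (s.map fun a => 1 - RatFunc.C a * RatFunc.X).prod) =
      algebraMap (Polynomial K) (RatFunc K) P

variable {S : Set K}

theorem polesIn_algebraMap (P : Polynomial K) :
    PolesIn S (algebraMap (Polynomial K) (RatFunc K) P) :=
  ⟨0, 0, P, by simp, by simp⟩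

theorem polesIn_C (a : K) : PolesIn S (RatFunc.C a) := by
  simpa using polesIn_algebraMap (S := S) (Polynomial.C a)

theorem exists_algebraMap_eq_prod (N : ℕ) (s : Multiset K) : ∃ P : Polynomial K,
    (RatFunc.X ^ N * (s.map fun a => 1 - RatFunc.C a * RatFunc.X).prod : RatFunc K) =
      algebraMap (Polynomial K) (RatFunc K) P := by
  refine ⟨Polynomial.X ^ N * (s.map fun a => 1 - Polynomial.C a * Polynomial.X).prod, ?_⟩
  rw [map_mul, map_pow, RatFunc.algebraMap_X, map_multiset_prod, Multiset.map_map]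
  congr 3
  funext a
  simp

theorem PolesIn.add {R R' : RatFunc K} (h : PolesIn S R) (h' : PolesIn S R') :
    PolesIn S (R + R') := by
  obtain ⟨N, s, P, h1, h2⟩ := h
  obtain ⟨N', s', P', h1', h2'⟩ := h'
  obtain ⟨D, hD⟩ := exists_algebraMap_eq_prod N s
  obtain ⟨D', hD'⟩ := exists_algebraMap_eq_prod N' s'
  refine ⟨N + N', s + s', P * D' + P' * D, ?_, ?_⟩
  · intro a ha
    exact (Multiset.mem_add.mp ha).elim (h1 a) (h1' a)
  · rw [map_add, map_mul, map_mul, ← h2, ← h2', ← hD, ← hD', Multiset.map_add, Multiset.prod_add,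
      pow_add]
    ring

theorem PolesIn.mul {R R' : RatFunc K} (h : PolesIn S R) (h' : PolesIn S R') :
    PolesIn S (R * R') := by
  obtain ⟨N, s, P, h1, h2⟩ := h
  obtain ⟨N', s', P', h1', h2'⟩ := h'
  refine ⟨N + N', s + s', P * P', ?_, ?_⟩
  · intro a ha
    exact (Multiset.mem_add.mp ha).elim (h1 a) (h1' a)
  · rw [map_mul, ← h2, ← h2', Multiset.map_add, Multiset.prod_add, pow_add]
    ring

theorem PolesIn.sum {ι : Type*} (s : Finset ι) {R : ι → RatFunc K}
    (h : ∀ i ∈ s, PolesIn S (R i)) : PolesIn S (∑ i ∈ s, R i) := by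
  induction s using Finset.cons_induction with
  | empty => simpa using polesIn_C (S := S) 0
  | cons a s ha ih =>
    rw [Finset.sum_cons]
    exact (h a (Finset.mem_cons_self a s)).add
      (ih fun i hi => h i (Finset.mem_cons.mpr (Or.inr hi)))

theorem PolesIn.prod {ι : Type*} (s : Finset ι) {R : ι → RatFunc K}
    (h : ∀ i ∈ s, PolesIn S (R i)) : PolesIn S (∏ i ∈ s, R i) := by
  induction s using Finset.cons_induction with
  | empty => simpa using polesIn_C (S := S) 1
  | cons a s ha ih =>
    rw [Finset.prod_cons]
    exact (h a (Finset.mem_cons_self a s)).mul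
      (ih fun i hi => h i (Finset.mem_cons.mpr (Or.inr hi)))

theorem PolesIn.pow {R : RatFunc K} (h : PolesIn S R) (n : ℕ) : PolesIn S (R ^ n) := by
  simpa using PolesIn.prod (Finset.range n) fun _ _ => h

theorem polesIn_X_zpow (n : ℤ) : PolesIn S (RatFunc.X ^ n) := by
  cases n with
  | ofNat n => simpa using polesIn_algebraMap (S := S) (Polynomial.X ^ n)
  | negSucc n =>
    refine ⟨n + 1, 0, 1, by simp, ?_⟩
    rw [zpow_negSucc, Multiset.map_zero, Multiset.prod_zero, mul_one,
      inv_mul_cancel₀ (pow_ne_zero _ RatFunc.X_ne_zero), map_one]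

theorem polesIn_inv_one_sub {a : K} (ha : a ∈ S) : PolesIn S (1 - RatFunc.C a * RatFunc.X)⁻¹ :=
  ⟨0, {a}, 1, by simpa using ha, by
    simp [inv_mul_cancel₀ (ratFunc_one_sub_ne_zero a)]⟩

theorem polesIn_one_sub (a : K) : PolesIn S (1 - RatFunc.C a * RatFunc.X) := by
  have h := polesIn_algebraMap (S := S) (1 - Polynomial.C a * Polynomial.X)
  rwa [map_sub, map_one, map_mul, RatFunc.algebraMap_C, RatFunc.algebraMap_X] at h

/-- A rational function regular at all of its possible poles other than `0` is a Laurent polynomial. -/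
theorem PolesIn.exists_mul_X_pow {R : RatFunc K} (h : PolesIn S R) (hS : ∀ a ∈ S, a ≠ 0)
    (hreg : ∀ a ∈ S, ∃ v, RegAt a⁻¹ R v) :
    ∃ (N : ℕ) (P : Polynomial K), R * RatFunc.X ^ N = algebraMap (Polynomial K) (RatFunc K) P := by
  obtain ⟨N, s, P, h1, h2⟩ := h
  induction s using Multiset.induction_on generalizing P with
  | empty => exact ⟨N, P, by simpa using h2⟩
  | cons a s ih =>
    have ha := h1 a (Multiset.mem_cons_self a s)
    obtain ⟨v, hv⟩ := hreg a ha
    obtain ⟨D, hD⟩ := exists_algebraMap_eq_prod N s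
    have h3 := hv.mul (regAt_algebraMap a⁻¹ D)
    rw [← hD] at h3
    obtain ⟨P', hP'⟩ := eq_algebraMap_of_regAt (mul_inv_cancel₀ (hS a ha)) h3 (P := P) (by
      rw [← h2, Multiset.map_cons, Multiset.prod_cons]
      ring)
    exact ih P' (fun b hb => h1 b (Multiset.mem_cons_of_mem hb)) hP'

/-! ### The difference of the expansions at `0` and at `∞` -/

/-- The coefficient of `z^a` in the expansion of `R` at `z = 0` minus that in the expansion
at `z = ∞`. -/
def expansionDiff (a : ℤ) (R : RatFunc K) : K :=
  (toLaurent R).coeff a - (toLaurent (invHom R)).coeff (-a)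

theorem expansionDiff_add (a : ℤ) (R R' : RatFunc K) :
    expansionDiff a (R + R') = expansionDiff a R + expansionDiff a R' := by
  simp only [expansionDiff, map_add, HahnSeries.coeff_add]
  ring

theorem expansionDiff_C_mul (a : ℤ) (c : K) (R : RatFunc K) :
    expansionDiff a (RatFunc.C c * R) = c * expansionDiff a R := by
  simp only [expansionDiff, map_mul, invHom_C, toLaurent_C, HahnSeries.C_apply,
    HahnSeries.coeff_single_zero_mul]
  ring

theorem expansionDiff_zero (a : ℤ) : expansionDiff a (0 : RatFunc K) = 0 := by
  simp [expansionDiff]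

theorem expansionDiff_sum {ι : Type*} (a : ℤ) (s : Finset ι) (R : ι → RatFunc K) :
    expansionDiff a (∑ i ∈ s, R i) = ∑ i ∈ s, expansionDiff a (R i) := by
  induction s using Finset.cons_induction with
  | empty => simp [expansionDiff_zero]
  | cons i s hi ih => rw [Finset.sum_cons, Finset.sum_cons, expansionDiff_add, ih]

theorem expansionDiff_X_zpow (a n : ℤ) : expansionDiff a (RatFunc.X ^ n : RatFunc K) = 0 := by
  rw [expansionDiff, map_zpow₀, map_zpow₀, map_zpow₀, invHom_X, map_inv₀, toLaurent_X,
    inv_zpow', ← RatFunc.single_zpow, ← RatFunc.single_zpow, HahnSeries.coeff_single,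
    HahnSeries.coeff_single]
  by_cases h : a = n
  · rw [if_pos h, if_pos (congrArg Neg.neg h), sub_self]
  · rw [if_neg h, if_neg (fun h' => h (neg_injective h')), sub_self]

/-- The two expansions of a Laurent polynomial agree. -/
theorem expansionDiff_of_mul_X_pow (a : ℤ) {R : RatFunc K} {N : ℕ} {P : Polynomial K}
    (h : R * RatFunc.X ^ N = algebraMap (Polynomial K) (RatFunc K) P) : expansionDiff a R = 0 := by
  have h1 : R = ∑ i ∈ Finset.range (P.natDegree + 1),
      RatFunc.C (P.coeff i) * RatFunc.X ^ ((i : ℤ) - N) := by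
    rw [← mul_div_cancel_right₀ R (pow_ne_zero N RatFunc.X_ne_zero), h, Finset.sum_congr rfl
      (fun i _ => by rw [zpow_sub₀ RatFunc.X_ne_zero, zpow_natCast, zpow_natCast, ← mul_div_assoc]),
      ← Finset.sum_div]
    congr 1
    conv_lhs => rw [P.as_sum_range_C_mul_X_pow]
    simp
  rw [h1, expansionDiff_sum]
  exact Finset.sum_eq_zero fun i _ => by rw [expansionDiff_C_mul, expansionDiff_X_zpow, mul_zero]

theorem coeff_toLaurent_inv_one_sub (c : K) (a : ℤ) :
    (toLaurent (1 - RatFunc.C c * RatFunc.X)⁻¹).coeff a = if a < 0 then 0 else c ^ a.natAbs := by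
  have h : toLaurent (1 - RatFunc.C c * RatFunc.X)⁻¹ =
      HahnSeries.ofPowerSeries ℤ K (PowerSeries.mk fun n => c ^ n) := by
    rw [map_inv₀]
    apply inv_eq_of_mul_eq_one_right
    rw [toLaurent_one_sub, ← PowerSeries.coe_mul, ← PowerSeries.coe_one]
    congr 1
    ext n
    rw [sub_mul, one_mul, map_sub, PowerSeries.coeff_mk, mul_assoc, PowerSeries.coeff_C_mul,
      PowerSeries.coeff_one]
    cases n with
    | zero => simp
    | succ n =>
      rw [PowerSeries.coeff_succ_X_mul, PowerSeries.coeff_mk]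
      simp [pow_succ']
  rw [h, PowerSeries.coeff_coe, PowerSeries.coeff_mk]

/-- The two expansions of `1 / (1 - c z)` differ by the delta function `∑ c^n z^n`. -/
theorem expansionDiff_inv_one_sub {c : K} (hc : c ≠ 0) (a : ℤ) :
    expansionDiff a (1 - RatFunc.C c * RatFunc.X)⁻¹ = c ^ a := by
  have h1 : invHom (1 - RatFunc.C c * RatFunc.X)⁻¹ =
      -(RatFunc.C c⁻¹ * RatFunc.X * (1 - RatFunc.C c⁻¹ * RatFunc.X)⁻¹) := by
    rw [map_inv₀, map_sub, map_one, map_mul, invHom_C, invHom_X]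
    have h2 : (RatFunc.C c * RatFunc.C c⁻¹ : RatFunc K) = 1 := by
      rw [← map_mul, mul_inv_cancel₀ hc, map_one]
    have h3 := ratFunc_one_sub_ne_zero c⁻¹
    have h4 := RatFunc.X_ne_zero (K := K)
    apply inv_eq_of_mul_eq_one_right
    have h5 : (1 - RatFunc.C c * RatFunc.X⁻¹) * (RatFunc.C c⁻¹ * RatFunc.X) =
        -(1 - RatFunc.C c⁻¹ * RatFunc.X : RatFunc K) := by
      linear_combination (-(RatFunc.X⁻¹ * RatFunc.X)) * h2 - inv_mul_cancel₀ h4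
    rw [mul_neg, ← mul_assoc, h5, neg_mul, neg_neg, mul_inv_cancel₀ h3]
  rw [expansionDiff, h1, map_neg, map_mul, map_mul, toLaurent_C, toLaurent_X, HahnSeries.coeff_neg,
    HahnSeries.C_apply, HahnSeries.single_mul_single, HahnSeries.coeff_single_mul,
    coeff_toLaurent_inv_one_sub, coeff_toLaurent_inv_one_sub, zero_add, mul_one]
  rcases lt_or_ge a 0 with h | h
  · rw [if_pos h, if_neg (by omega), zero_sub, neg_neg, ← pow_succ']
    obtain ⟨n, rfl⟩ : ∃ n : ℕ, a = -((n : ℤ) + 1) := ⟨(-a - 1).toNat, by omega⟩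
    have : (- -((n : ℤ) + 1) - 1).natAbs + 1 = n + 1 := by omega
    rw [this, zpow_neg, inv_pow]
    norm_cast
  · rw [if_neg (by omega), if_pos (by omega), mul_zero, neg_zero, sub_zero]
    obtain ⟨n, rfl⟩ := Int.eq_ofNat_of_zero_le h
    simp

/-- The difference of the expansions at `0` and at `∞` of a rational function with simple poles:
each pole contributes a multiple of a formal delta function. -/
theorem expansionDiff_eq_sum {ι : Type*} {p : ι → K} (hp : Function.Injective p)
    (hp0 : ∀ i, p i ≠ 0) {R : RatFunc K} (hR : PolesIn (Set.range fun i => (p i)⁻¹) R)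
    (T : Finset ι) (ρ : ι → K)
    (hT : ∀ i ∈ T, RegAt (p i) ((1 - RatFunc.C (p i)⁻¹ * RatFunc.X) * R) (ρ i))
    (hreg : ∀ i ∉ T, ∃ v, RegAt (p i) R v) (a : ℤ) :
    expansionDiff a R = ∑ i ∈ T, ρ i * (p i) ^ (-a) := by
  classical
  -- The principal parts of `R`; what remains after subtracting them is a Laurent polynomial.
  set D : RatFunc K := ∑ i ∈ T, RatFunc.C (ρ i) * (1 - RatFunc.C (p i)⁻¹ * RatFunc.X)⁻¹ with hD
  have hne : ∀ i j, i ≠ j → 1 - (p j)⁻¹ * p i ≠ 0 := by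
    intro i j hij h
    rw [sub_eq_zero, eq_comm, inv_mul_eq_one₀ (hp0 j)] at h
    exact hij (hp h).symm
  have hterm : ∀ i j, i ≠ j → ∃ v,
      RegAt (p i) (RatFunc.C (ρ j) * (1 - RatFunc.C (p j)⁻¹ * RatFunc.X)⁻¹) v := fun i j hij =>
    ⟨_, (regAt_C _ _).mul ((regAt_one_sub _ _).inv (hne i j hij))⟩
  have hsum : ∀ i, ∀ T' : Finset ι, i ∉ T' → ∃ v, RegAt (p i)
      (∑ j ∈ T', RatFunc.C (ρ j) * (1 - RatFunc.C (p j)⁻¹ * RatFunc.X)⁻¹) v := by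
    intro i T' hi
    choose! v hv using fun j (hij : i ≠ j) => hterm i j hij
    exact ⟨_, RegAt.sum T' fun j hj => hv j (by rintro rfl; exact hi hj)⟩
  have hreg' : ∀ i, ∃ v, RegAt (p i) (R - D) v := by
    intro i
    by_cases hi : i ∈ T
    · obtain ⟨v, hv⟩ := hsum i (T.erase i) (Finset.notMem_erase i T)
      apply regAt_of_mul_one_sub (inv_mul_cancel₀ (hp0 i))
      have h1 : (1 - RatFunc.C (p i)⁻¹ * RatFunc.X) * (R - D) =
          (1 - RatFunc.C (p i)⁻¹ * RatFunc.X) * R - (RatFunc.C (ρ i) +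
          (1 - RatFunc.C (p i)⁻¹ * RatFunc.X) * ∑ j ∈ T.erase i,
            RatFunc.C (ρ j) * (1 - RatFunc.C (p j)⁻¹ * RatFunc.X)⁻¹) := by
        rw [hD, ← Finset.add_sum_erase T _ hi]
        linear_combination (-RatFunc.C (ρ i)) * mul_inv_cancel₀ (ratFunc_one_sub_ne_zero (p i)⁻¹)
      rw [h1]
      have h2 := (hT i hi).sub ((regAt_C (p i) (ρ i)).add ((regAt_one_sub (p i)⁻¹ (p i)).mul hv))
      rwa [inv_mul_cancel₀ (hp0 i), sub_self, zero_mul, add_zero, sub_self] at h2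
    · obtain ⟨v, hv⟩ := hreg i hi
      obtain ⟨w, hw⟩ := hsum i T hi
      exact ⟨_, hv.sub hw⟩
  have hpoles : PolesIn (Set.range fun i => (p i)⁻¹) (R - D) := by
    have h1 : R - D = R + RatFunc.C (-1) * D := by
      rw [map_neg, map_one]
      ring
    rw [h1]
    exact hR.add ((polesIn_C _).mul (PolesIn.sum T fun i _ =>
      (polesIn_C _).mul (polesIn_inv_one_sub ⟨i, rfl⟩)))
  obtain ⟨N, P, h⟩ := hpoles.exists_mul_X_pow (by rintro _ ⟨i, rfl⟩; exact inv_ne_zero (hp0 i))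
    (by rintro _ ⟨i, rfl⟩; simpa using hreg' i)
  have h2 := expansionDiff_of_mul_X_pow a h
  rw [← sub_add_cancel R D, expansionDiff_add, h2, zero_add, hD, expansionDiff_sum]
  refine Finset.sum_congr rfl fun i _ => ?_
  rw [expansionDiff_C_mul, expansionDiff_inv_one_sub (inv_ne_zero (hp0 i)), inv_zpow']

end RationalFunctions

/-! ### Sums over pairs of sets of colours -/

section PathSums

variable {r : ℕ} {R : Type*} [CommRing R]

/-- The colours preceding `i`. -/
def lowColours (r i : ℕ) : Finset (Fin r) := Finset.univ.filter (·.val < i)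

theorem lowColours_succ {i : ℕ} (h : i < r) :
    lowColours r (i + 1) = insert ⟨i, h⟩ (lowColours r i) := by
  ext j
  simp only [lowColours, Finset.mem_filter, Finset.mem_univ, true_and, Finset.mem_insert,
    Fin.ext_iff]
  omega

theorem notMem_lowColours {i : ℕ} (h : i < r) : (⟨i, h⟩ : Fin r) ∉ lowColours r i := by
  simp [lowColours]

theorem lowColours_self : lowColours r r = Finset.univ := by
  ext j
  simp [lowColours]

/-- The sum over pairs `(I, J)` of sets of colours preceding `i`, of sizes `s` and `t`, of a product
of local weights.  The weight of a colour `j` depends on the numbers of elements of `I` and of `J`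
below `j`, and on whether `j` belongs to `I` and to `J`. -/
def pathSum (F : Fin r → ℤ → ℤ → Bool → Bool → R) (i : ℕ) (s t : ℤ) : R :=
  ∑ I ∈ (lowColours r i).powerset, ∑ J ∈ (lowColours r i).powerset,
    if (I.card : ℤ) = s ∧ (J.card : ℤ) = t then
      ∏ j ∈ lowColours r i, F j (below I j) (below J j) (decide (j ∈ I)) (decide (j ∈ J))
    else 0

variable (F : Fin r → ℤ → ℤ → Bool → Bool → R)

theorem pathSum_zero (s t : ℤ) : pathSum F 0 s t = if s = 0 ∧ t = 0 then 1 else 0 := by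
  have : lowColours r 0 = ∅ := by simp [lowColours]
  rw [pathSum, this, Finset.powerset_empty, Finset.sum_singleton, Finset.sum_singleton,
    Finset.prod_empty, Finset.card_empty, Nat.cast_zero]
  exact if_congr (and_congr eq_comm eq_comm) rfl rfl

theorem pathSum_of_neg (i : ℕ) {s t : ℤ} (h : s < 0 ∨ t < 0) : pathSum F i s t = 0 :=
  Finset.sum_eq_zero fun I _ => Finset.sum_eq_zero fun J _ => if_neg (by omega)

theorem below_insert_self {i : ℕ} (h : i < r) {I : Finset (Fin r)} (hI : I ⊆ lowColours r i) :
    below (insert ⟨i, h⟩ I) ⟨i, h⟩ = I.card := by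
  unfold below
  rw [Finset.filter_insert, if_neg (lt_irrefl _), Finset.filter_true_of_mem]
  intro j hj
  exact (Finset.mem_filter.mp (hI hj)).2

theorem below_self {i : ℕ} (h : i < r) {I : Finset (Fin r)} (hI : I ⊆ lowColours r i) :
    below I ⟨i, h⟩ = I.card := by
  unfold below
  rw [Finset.filter_true_of_mem]
  intro j hj
  exact (Finset.mem_filter.mp (hI hj)).2

theorem below_insert_of_mem {i : ℕ} (h : i < r) (I : Finset (Fin r)) {j : Fin r}
    (hj : j ∈ lowColours r i) : below (insert ⟨i, h⟩ I) j = below I j := by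
  unfold below
  rw [Finset.filter_insert, if_neg]
  have := (Finset.mem_filter.mp hj).2
  exact fun h' => absurd (Fin.lt_def.mp h') (by dsimp only; omega)

/-- The effect of adding the colour `i` to the sets `I` (if `e` holds) and `J` (if `e'` holds). -/
theorem pathSum_term {i : ℕ} (h : i < r) {I J : Finset (Fin r)} (hI : I ⊆ lowColours r i)
    (hJ : J ⊆ lowColours r i) (e e' : Bool) (s t : ℤ) (I' J' : Finset (Fin r))
    (hI' : I' = if e then insert ⟨i, h⟩ I else I) (hJ' : J' = if e' then insert ⟨i, h⟩ J else J) :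
    (if (I'.card : ℤ) = s + (if e then 1 else 0) ∧ (J'.card : ℤ) = t + (if e' then 1 else 0) then
      ∏ j ∈ lowColours r (i + 1), F j (below I' j) (below J' j) (decide (j ∈ I')) (decide (j ∈ J'))
    else 0) = (if (I.card : ℤ) = s ∧ (J.card : ℤ) = t then
      ∏ j ∈ lowColours r i, F j (below I j) (below J j) (decide (j ∈ I)) (decide (j ∈ J))
    else 0) * F ⟨i, h⟩ s t e e' := by
  have hnI : (⟨i, h⟩ : Fin r) ∉ I := fun h' => notMem_lowColours h (hI h')
  have hnJ : (⟨i, h⟩ : Fin r) ∉ J := fun h' => notMem_lowColours h (hJ h')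
  have key : ∀ (I I' : Finset (Fin r)) (e : Bool), I ⊆ lowColours r i → (⟨i, h⟩ : Fin r) ∉ I →
      (I' = if e then insert ⟨i, h⟩ I else I) →
      (I'.card : ℤ) = I.card + (if e then 1 else 0) ∧ below I' ⟨i, h⟩ = I.card ∧
      decide ((⟨i, h⟩ : Fin r) ∈ I') = e ∧
      ∀ j ∈ lowColours r i, below I' j = below I j ∧ decide (j ∈ I') = decide (j ∈ I) := by
    intro I I' e hI hnI hI'
    subst hI'
    cases e with
    | false => simpa [hnI] using below_self h hI
    | true =>
      refine ⟨?_, ?_, ?_, ?_⟩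
      · simp [hnI]
      · simpa using below_insert_self h hI
      · simp
      · intro j hj
        have hne : j ≠ ⟨i, h⟩ := by
          rintro rfl
          exact notMem_lowColours h hj
        simpa [hne] using below_insert_of_mem h I hj
  obtain ⟨a1, a2, a3, a4⟩ := key I I' e hI hnI hI'
  obtain ⟨b1, b2, b3, b4⟩ := key J J' e' hJ hnJ hJ'
  simp only [a1, b1, add_left_inj]
  split_ifs with hc
  · rw [lowColours_succ h, Finset.prod_insert (notMem_lowColours h), a2, b2, a3, b3, hc.1, hc.2,
      mul_comm]
    congr 1
    refine Finset.prod_congr rfl fun j hj => ?_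
    rw [(a4 j hj).1, (a4 j hj).2, (b4 j hj).1, (b4 j hj).2]
  · rw [zero_mul]

/-- The recursion over colours: the colour `i` belongs to neither set, to `J`, to `I`, or to both. -/
theorem pathSum_succ {i : ℕ} (h : i < r) (s t : ℤ) :
    pathSum F (i + 1) s t = pathSum F i s t * F ⟨i, h⟩ s t false false +
      pathSum F i s (t - 1) * F ⟨i, h⟩ s (t - 1) false true +
      (pathSum F i (s - 1) t * F ⟨i, h⟩ (s - 1) t true false +
      pathSum F i (s - 1) (t - 1) * F ⟨i, h⟩ (s - 1) (t - 1) true true) := by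
  have hn := notMem_lowColours h
  have key : ∀ (e e' : Bool) (s t s' t' : ℤ), s' = s + (if e then 1 else 0) →
      t' = t + (if e' then 1 else 0) →
      (∑ I ∈ (lowColours r i).powerset, ∑ J ∈ (lowColours r i).powerset,
        if ((if e then insert ⟨i, h⟩ I else I).card : ℤ) = s' ∧
          ((if e' then insert ⟨i, h⟩ J else J).card : ℤ) = t' then
        ∏ j ∈ lowColours r (i + 1), F j (below (if e then insert ⟨i, h⟩ I else I) j)
          (below (if e' then insert ⟨i, h⟩ J else J) j)
          (decide (j ∈ if e then insert ⟨i, h⟩ I else I))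
          (decide (j ∈ if e' then insert ⟨i, h⟩ J else J)) else 0) =
        pathSum F i s t * F ⟨i, h⟩ s t e e' := by
    intro e e' s t s' t' hs ht
    subst hs ht
    rw [pathSum, Finset.sum_mul]
    refine Finset.sum_congr rfl fun I hI => ?_
    rw [Finset.sum_mul]
    refine Finset.sum_congr rfl fun J hJ => ?_
    exact pathSum_term F h (Finset.mem_powerset.mp hI) (Finset.mem_powerset.mp hJ) e e' s t _ _
      rfl rfl
  rw [← key false false s t s t (by simp) (by simp),
    ← key false true s (t - 1) s t (by simp) (by simp),
    ← key true false (s - 1) t s t (by simp) (by simp),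
    ← key true true (s - 1) (t - 1) s t (by simp) (by simp)]
  rw [pathSum, lowColours_succ h, Finset.sum_powerset_insert hn]
  conv_rhs => rw [← Finset.sum_add_distrib, ← Finset.sum_add_distrib]
  refine congrArg₂ (· + ·) ?_ ?_ <;>
  · refine Finset.sum_congr rfl fun I _ => ?_
    rw [Finset.sum_powerset_insert hn]
    rfl

end PathSums

/-! ### Products of two currents as sums over paths -/

section CurrentsAsPathSums

variable {K : Type*} [Field K] {r : ℕ}

/-- The part of the multiplicity function `l` concerning the colour `i`. -/
def colourPart (l : Idx r →₀ ℕ) (i : Fin r) : Idx r →₀ ℕ := l.filter fun g => colour g = i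

theorem coeff_mvExp_colourPart {R : Type*} [CommRing R] [Algebra K R] (γ : Idx r → R)
    (l : Idx r →₀ ℕ) (i : Fin r) : MvPowerSeries.coeff (colourPart l i) (mvExp K γ) =
      ∏ g ∈ l.support with colour g = i, algebraMap K R (((l g).factorial : K)⁻¹) * γ g ^ l g := by
  rw [coeff_mvExp, Finsupp.prod, colourPart, Finsupp.support_filter]
  refine Finset.prod_congr rfl fun g hg => ?_
  rw [Finsupp.filter_apply_pos (fun g => colour g = i) _ (Finset.mem_filter.mp hg).2]

theorem coeff_mvExp_colourPart_congr {R : Type*} [CommRing R] [Algebra K R] {γ γ' : Idx r → R}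
    (l : Idx r →₀ ℕ) {i : Fin r} (h : ∀ g, colour g = i → γ g = γ' g) :
    MvPowerSeries.coeff (colourPart l i) (mvExp K γ) =
      MvPowerSeries.coeff (colourPart l i) (mvExp K γ') := by
  rw [coeff_mvExp_colourPart, coeff_mvExp_colourPart]
  refine Finset.prod_congr rfl fun g hg => ?_
  rw [h g (Finset.mem_filter.mp hg).2]

/-- A coefficient of an exponential factors over the colours. -/
theorem coeff_mvExp_eq_prod_colour {R : Type*} [CommRing R] [Algebra K R] (γ : Idx r → R)
    (l : Idx r →₀ ℕ) : MvPowerSeries.coeff l (mvExp K γ) =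
      ∏ i, MvPowerSeries.coeff (colourPart l i) (mvExp K γ) := by
  simp only [coeff_mvExp_colourPart]
  rw [Finset.prod_fiberwise, coeff_mvExp]
  rfl

theorem sum_weight_colourPart (l : Idx r →₀ ℕ) : ∑ i, weight r (colourPart l i) = weight r l := by
  rw [weight_eq_sum, Finsupp.sum, ← Finset.sum_fiberwise _ colour]
  refine Finset.sum_congr rfl fun i _ => ?_
  rw [weight_eq_sum, Finsupp.sum, colourPart, Finsupp.support_filter]
  refine Finset.sum_congr rfl fun g hg => ?_
  rw [Finsupp.filter_apply_pos (fun g => colour g = i) _ (Finset.mem_filter.mp hg).2]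

variable (q₁ q₂ : K) (u : Fin r → K)

/-- The coefficient of the generator of label `g`, of colour `i`, in the exponent of
`: Λ^i(x / q^s) Λ^i(y / q^t) :`, up to the common power of `y`, as a rational function of `y / x`.
The flags `e` and `e'` tell whether the first and the second factor occur. -/
def stepCoeff (s t : ℤ) (e e' : Bool) (g : Idx r) : RatFunc K :=
  (if e then RatFunc.X ^ mode g * RatFunc.C ((q₁ * q₂) ^ (mode g * s) / (mode g).natAbs) else 0) +
    (if e' then RatFunc.C ((q₁ * q₂) ^ (mode g * t) / (mode g).natAbs) else 0)

/-- The factor of the colour `i` in a term of `: W_k(x) W_{k'}(y) :`.  The flags `e` and `e'` tell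
whether `Λ^i(x / q^s)` and `Λ^i(y / q^t)` occur. -/
def stepFactor (l : Idx r →₀ ℕ) (i : Fin r) (s t : ℤ) (e e' : Bool) : RatFunc K :=
  RatFunc.C ((if e then u i else 1) * (if e' then u i else 1)) *
    MvPowerSeries.coeff (colourPart l i) (mvExp K (stepCoeff q₁ q₂ s t e e'))

/-- The factor of the colour `i` in a term of `W_k(x) W_{k'}(y)`: a colour of the first set which is
not in the second one also contributes a factor `ζ`. -/
def stepWeight (l : Idx r →₀ ℕ) (i : Fin r) (s t : ℤ) (e e' : Bool) : RatFunc K :=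
  (if e && !e' then zetaFunc q₁ q₂ ((q₁ * q₂) ^ (s - t)) else 1) *
    stepFactor q₁ q₂ u l i s t e e'

/-- Products of currents are path sums over all `r` colours. -/
theorem pairSum_eq_pathSum (k k' : ℕ) (l : Idx r →₀ ℕ) :
    pairSum q₁ q₂ u k k' l = pathSum (stepWeight q₁ q₂ u l) r k k' := by
  rw [pairSum, pathSum, lowColours_self, Finset.powersetCard_eq_filter, Finset.sum_filter]
  refine Finset.sum_congr rfl fun I _ => ?_
  split_ifs with hI
  · rw [Finset.powersetCard_eq_filter, Finset.sum_filter]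
    refine Finset.sum_congr rfl fun J _ => ?_
    have hI' : (I.card : ℤ) = k := by exact_mod_cast hI
    by_cases hJ : J.card = k'
    · rw [if_pos hJ, if_pos ⟨hI', by exact_mod_cast hJ⟩]
      have e1 : ∀ I : Finset (Fin r), ∏ i ∈ I, u i = ∏ i, if i ∈ I then u i else 1 := by
        intro I
        rw [Finset.prod_ite_mem, Finset.univ_inter]
      have e2 : ∏ i ∈ I \ J, zetaFunc q₁ q₂ ((q₁ * q₂) ^ height I J i) =
          ∏ i, if i ∈ I \ J then zetaFunc q₁ q₂ ((q₁ * q₂) ^ height I J i) else 1 := by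
        rw [Finset.prod_ite_mem, Finset.univ_inter]
      rw [e1, e1, e2, coeff_mvExp_eq_prod_colour, ← Finset.prod_mul_distrib, map_prod,
        ← Finset.prod_mul_distrib, ← Finset.prod_mul_distrib]
      refine Finset.prod_congr rfl fun i _ => ?_
      have e3 : MvPowerSeries.coeff (colourPart l i) (mvExp K
          (pairCoeff (setCoeff (q₁ * q₂) I) (setCoeff (q₁ * q₂) J))) =
          MvPowerSeries.coeff (colourPart l i) (mvExp K (stepCoeff q₁ q₂ (below I i) (below J i)
            (decide (i ∈ I)) (decide (i ∈ J)))) := by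
        refine coeff_mvExp_colourPart_congr l fun g hg => ?_
        subst hg
        unfold pairCoeff stepCoeff setCoeff
        by_cases h1 : colour g ∈ I <;> by_cases h2 : colour g ∈ J <;> simp [h1, h2]
      rw [e3, stepWeight, stepFactor]
      by_cases h1 : i ∈ I <;> by_cases h2 : i ∈ J <;> simp [h1, h2, height]; ring
    · rw [if_neg hJ, if_neg]
      rintro ⟨-, h⟩
      exact hJ (by exact_mod_cast h)
  · symm
    refine Finset.sum_eq_zero fun J _ => if_neg ?_
    rintro ⟨h, -⟩
    exact hI (by exact_mod_cast h)

end CurrentsAsPathSums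

/-! ### Values and residues of `ζ` -/

section ZetaValues

variable {K : Type*} [Field K] {q₁ q₂ : K}

/-- The functional equation `ζ(1 / (q x)) = ζ(x)`. -/
theorem zeta_inv {x : K} (h₁ : q₁ ≠ 0) (h₂ : q₂ ≠ 0) (hx : x ≠ 0) :
    zeta q₁ q₂ (q₁ * q₂ * x)⁻¹ = zeta q₁ q₂ x := by
  have hk : (q₁ * q₂ * x ^ 2)⁻¹ ≠ 0 := by positivity
  have e1 : (1 - q₁ * (q₁ * q₂ * x)⁻¹) * (1 - q₂ * (q₁ * q₂ * x)⁻¹) =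
      (1 - q₁ * x) * (1 - q₂ * x) * (q₁ * q₂ * x ^ 2)⁻¹ := by
    field_simp
    ring
  have e2 : (1 - (q₁ * q₂ * x)⁻¹) * (1 - q₁ * q₂ * (q₁ * q₂ * x)⁻¹) =
      (1 - x) * (1 - q₁ * q₂ * x) * (q₁ * q₂ * x ^ 2)⁻¹ := by
    field_simp
    ring
  rw [zeta, e1, e2, mul_div_mul_right _ _ hk, zeta]

theorem zeta_zpow_neg (h₁ : q₁ ≠ 0) (h₂ : q₂ ≠ 0) {n n' : ℤ} (h : n + n' = -1) :
    zeta q₁ q₂ ((q₁ * q₂) ^ n) = zeta q₁ q₂ ((q₁ * q₂) ^ n') := by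
  have h0 : q₁ * q₂ ≠ 0 := mul_ne_zero h₁ h₂
  rw [← zeta_inv h₁ h₂ (zpow_ne_zero n' h0), ← zpow_one_add₀ h0, ← zpow_neg]
  congr 2
  omega

/-- The functional equation of `ζ`, for rational functions. -/
theorem invHom_zetaFunc (h₁ : q₁ ≠ 0) (h₂ : q₂ ≠ 0) {n n' : ℤ} (h : n + n' = -1) :
    invHom (zetaFunc q₁ q₂ ((q₁ * q₂) ^ n)) = zetaFunc q₁ q₂ ((q₁ * q₂) ^ n') := by
  have h0 : q₁ * q₂ ≠ 0 := mul_ne_zero h₁ h₂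
  have hC : ∀ a : K, a ≠ 0 → RatFunc.C a ≠ 0 := fun a ha => (map_ne_zero _).mpr ha
  have e1 : ∀ x : RatFunc K, invHom (zeta (RatFunc.C q₁) (RatFunc.C q₂) x) =
      zeta (RatFunc.C q₁) (RatFunc.C q₂) (invHom x) := by
    intro x
    simp only [zeta, map_div₀, map_mul, map_sub, map_one, invHom_C]
  rw [zetaFunc, zetaFunc, e1, map_mul, invHom_C, invHom_X,
    ← zeta_inv (hC _ h₁) (hC _ h₂) (mul_ne_zero (hC _ (zpow_ne_zero n' h0)) RatFunc.X_ne_zero)]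
  congr 1
  rw [← mul_assoc, mul_inv, ← map_mul, ← map_mul, ← map_inv₀, ← zpow_one_add₀ h0, ← zpow_neg]
  congr 3
  omega

theorem theta_one : theta q₁ q₂ 1 = (1 - q₁) * (1 - q₂) / (1 - q₁ * q₂) := by
  simp [theta]

theorem theta_succ {s : ℕ} (hs : 1 ≤ s) :
    theta q₁ q₂ (s + 1) = theta q₁ q₂ s * zeta q₁ q₂ ((q₁ * q₂) ^ s) := by
  rw [theta, theta, Finset.prod_Ico_succ_top hs, mul_assoc]

variable [CharZero K]

theorem one_sub_q_zpow_ne_zero (hq : AlgebraicIndependent ℚ ![q₁, q₂]) {n : ℤ} (hn : n ≠ 0) :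
    1 - (q₁ * q₂) ^ n ≠ 0 :=
  sub_ne_zero.mpr (q_zpow_ne_one hq hn).symm

theorem zeta_q_zpow_ne_zero (hq : AlgebraicIndependent ℚ ![q₁, q₂]) {n : ℤ} (hn : n ≠ 0)
    (hn' : n ≠ -1) : zeta q₁ q₂ ((q₁ * q₂) ^ n) ≠ 0 := by
  have h1 := q₁_ne_zero hq
  have h2 := q₂_ne_zero hq
  have e1 : q₁ * (q₁ * q₂) ^ n = q₁ ^ (n + 1) * q₂ ^ n := by
    rw [mul_zpow, zpow_add_one₀ h1]
    ring
  have e2 : q₂ * (q₁ * q₂) ^ n = q₁ ^ n * q₂ ^ (n + 1) := by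
    rw [mul_zpow, zpow_add_one₀ h2]
    ring
  have e3 : q₁ * q₂ * (q₁ * q₂) ^ n = (q₁ * q₂) ^ (n + 1) := by
    rw [zpow_add_one₀ (q_ne_zero hq), mul_comm]
  rw [zeta, e1, e2, e3]
  refine div_ne_zero (mul_ne_zero ?_ ?_) (mul_ne_zero ?_ ?_)
  · exact sub_ne_zero.mpr (zpow_mul_zpow_ne_one hq (by omega)).symm
  · exact sub_ne_zero.mpr (zpow_mul_zpow_ne_one hq (by omega)).symm
  · exact one_sub_q_zpow_ne_zero hq hn
  · exact one_sub_q_zpow_ne_zero hq (by omega)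

theorem regAt_zetaFunc (hq : AlgebraicIndependent ℚ ![q₁, q₂]) {m n j : ℤ} (h : j + m = n)
    (hn : n ≠ 0) (hn' : n ≠ -1) :
    RegAt ((q₁ * q₂) ^ m) (zetaFunc q₁ q₂ ((q₁ * q₂) ^ j)) (zeta q₁ q₂ ((q₁ * q₂) ^ n)) := by
  have h0 := q_ne_zero hq
  subst h
  have h1 := ((regAt_one_sub (q₁ * (q₁ * q₂) ^ j) ((q₁ * q₂) ^ m)).mul
    (regAt_one_sub (q₂ * (q₁ * q₂) ^ j) ((q₁ * q₂) ^ m))).div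
    ((regAt_one_sub ((q₁ * q₂) ^ j) ((q₁ * q₂) ^ m)).mul
    (regAt_one_sub (q₁ * q₂ * (q₁ * q₂) ^ j) ((q₁ * q₂) ^ m)))
  rw [← zetaFunc_eq] at h1
  simp only [mul_assoc (_ : K) ((q₁ * q₂) ^ j) ((q₁ * q₂) ^ m), ← zpow_add₀ h0] at h1
  refine h1 (mul_ne_zero (one_sub_q_zpow_ne_zero hq hn) ?_)
  rw [← zpow_one_add₀ h0]
  exact one_sub_q_zpow_ne_zero hq (by omega)

/-- The residue of `ζ` at `1`.  Residues of `R` at `c` are normalized as values of `(1 - z / c) R`. -/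
theorem regAt_mul_zetaFunc (hq : AlgebraicIndependent ℚ ![q₁, q₂]) {m j : ℤ} (h : j + m = 0) :
    RegAt ((q₁ * q₂) ^ m) ((1 - RatFunc.C ((q₁ * q₂) ^ (-m)) * RatFunc.X) *
      zetaFunc q₁ q₂ ((q₁ * q₂) ^ j)) (theta q₁ q₂ 1) := by
  have h0 := q_ne_zero hq
  obtain rfl : j = -m := by omega
  have e : (1 - RatFunc.C ((q₁ * q₂) ^ (-m)) * RatFunc.X) * zetaFunc q₁ q₂ ((q₁ * q₂) ^ (-m)) =
      (1 - RatFunc.C (q₁ * (q₁ * q₂) ^ (-m)) * RatFunc.X) *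
        (1 - RatFunc.C (q₂ * (q₁ * q₂) ^ (-m)) * RatFunc.X) /
          (1 - RatFunc.C (q₁ * q₂ * (q₁ * q₂) ^ (-m)) * RatFunc.X) := by
    rw [zetaFunc_eq, ← mul_div_assoc, mul_div_mul_left _ _ (ratFunc_one_sub_ne_zero _)]
  rw [e, theta_one]
  have h1 := ((regAt_one_sub (q₁ * (q₁ * q₂) ^ (-m)) ((q₁ * q₂) ^ m)).mul
    (regAt_one_sub (q₂ * (q₁ * q₂) ^ (-m)) ((q₁ * q₂) ^ m))).div
    (regAt_one_sub (q₁ * q₂ * (q₁ * q₂) ^ (-m)) ((q₁ * q₂) ^ m))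
  simp only [mul_assoc (_ : K) ((q₁ * q₂) ^ (-m)) ((q₁ * q₂) ^ m), ← zpow_add₀ h0, neg_add_cancel,
    zpow_zero, mul_one] at h1
  refine h1 ?_
  simpa using one_sub_q_zpow_ne_zero hq one_ne_zero

/-- The residue of `ζ` at `q⁻¹`, opposite to that at `1` by the functional equation. -/
theorem regAt_mul_zetaFunc' (hq : AlgebraicIndependent ℚ ![q₁, q₂]) {m j : ℤ} (h : j + m = -1) :
    RegAt ((q₁ * q₂) ^ m) ((1 - RatFunc.C ((q₁ * q₂) ^ (-m)) * RatFunc.X) *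
      zetaFunc q₁ q₂ ((q₁ * q₂) ^ j)) (-theta q₁ q₂ 1) := by
  have h0 := q_ne_zero hq
  have h1 := q₁_ne_zero hq
  have h2 := q₂_ne_zero hq
  have hm : (-m) = 1 + j := by omega
  have e : (1 - RatFunc.C ((q₁ * q₂) ^ (-m)) * RatFunc.X) * zetaFunc q₁ q₂ ((q₁ * q₂) ^ j) =
      (1 - RatFunc.C (q₁ * (q₁ * q₂) ^ j) * RatFunc.X) *
        (1 - RatFunc.C (q₂ * (q₁ * q₂) ^ j) * RatFunc.X) /
          (1 - RatFunc.C ((q₁ * q₂) ^ j) * RatFunc.X) := by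
    rw [zetaFunc_eq, hm, zpow_one_add₀ h0, ← mul_div_assoc, mul_comm, mul_div_mul_right _ _
      (ratFunc_one_sub_ne_zero _)]
  have h3 := ((regAt_one_sub (q₁ * (q₁ * q₂) ^ j) ((q₁ * q₂) ^ m)).mul
    (regAt_one_sub (q₂ * (q₁ * q₂) ^ j) ((q₁ * q₂) ^ m))).div
    (regAt_one_sub ((q₁ * q₂) ^ j) ((q₁ * q₂) ^ m))
  simp only [mul_assoc (_ : K) ((q₁ * q₂) ^ j) ((q₁ * q₂) ^ m), ← zpow_add₀ h0, h] at h3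
  rw [e]
  have h4 := h3 (one_sub_q_zpow_ne_zero hq (by omega))
  have h5 : 1 - q₁ * q₂ ≠ 0 := by simpa using one_sub_q_zpow_ne_zero hq one_ne_zero
  have e2 : -theta q₁ q₂ 1 = (1 - q₁ * (q₁ * q₂) ^ (-1 : ℤ)) * (1 - q₂ * (q₁ * q₂) ^ (-1 : ℤ)) /
      (1 - (q₁ * q₂) ^ (-1 : ℤ)) := by
    have h6 := one_sub_q_zpow_ne_zero hq (n := -1) (by omega)
    rw [theta_one, eq_div_iff h6, ← neg_div, div_mul_eq_mul_div, div_eq_iff h5, zpow_neg_one]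
    field_simp
    ring
  rw [e2]
  exact h4

end ZetaValues

/-! ### Values of the factor of one colour -/

section StepValues

variable {K : Type*} [Field K] {r : ℕ} (q₁ q₂ : K) (u : Fin r → K)

/-- The value of `stepFactor q₁ q₂ u l i s y e e'` at `z = q^m`, where `x = s + m`. -/
def stepValue (l : Idx r →₀ ℕ) (i : Fin r) (x y : ℤ) (e e' : Bool) : K :=
  ((if e then u i else 1) * (if e' then u i else 1)) *
    MvPowerSeries.coeff (colourPart l i) (mvExp K fun g =>
      (if e then (q₁ * q₂) ^ (mode g * x) / ((mode g).natAbs : K) else 0) +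
        (if e' then (q₁ * q₂) ^ (mode g * y) / ((mode g).natAbs : K) else 0))

/-- At `y = x q^m` the factors `Λ^i(x / q^s)` and `Λ^i(y / q^t)` lie at points exchanged by
`(s, t) ↦ (t - m, s + m)`. -/
theorem stepValue_symm (l : Idx r →₀ ℕ) (i : Fin r) (x y : ℤ) (e e' : Bool) :
    stepValue q₁ q₂ u l i x y e e' = stepValue q₁ q₂ u l i y x e' e := by
  rw [stepValue, stepValue, mul_comm (if e then u i else 1)]
  congr 4
  funext g
  exact add_comm _ _

variable {q₁ q₂}

theorem regAt_coeff_mvExp {c : K} {γ : Idx r → RatFunc K} {v : Idx r → K}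
    (h : ∀ g, RegAt c (γ g) (v g)) (l : Idx r →₀ ℕ) :
    RegAt c (MvPowerSeries.coeff l (mvExp K γ)) (MvPowerSeries.coeff l (mvExp K v)) := by
  rw [coeff_mvExp, coeff_mvExp]
  exact RegAt.prod _ fun g _ => (regAt_C _ _).mul ((h g).pow _)

theorem regAt_stepFactor (h0 : q₁ * q₂ ≠ 0) (l : Idx r →₀ ℕ) (i : Fin r) (s t : ℤ) (e e' : Bool)
    {m x : ℤ} (hx : s + m = x) :
    RegAt ((q₁ * q₂) ^ m) (stepFactor q₁ q₂ u l i s t e e')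
      (stepValue q₁ q₂ u l i x t e e') := by
  subst hx
  refine (regAt_C _ _).mul (regAt_coeff_mvExp (fun g => ?_) _)
  refine RegAt.add ?_ ?_
  · cases e
    · simpa using regAt_zero _
    · have h1 := ((regAt_X ((q₁ * q₂) ^ m)).zpow (zpow_ne_zero m h0) (mode g)).mul (regAt_C
        ((q₁ * q₂) ^ m) ((q₁ * q₂) ^ (mode g * s) / ((mode g).natAbs : K)))
      have h2 : ((q₁ * q₂) ^ m) ^ mode g * ((q₁ * q₂) ^ (mode g * s) / ((mode g).natAbs : K)) =
          (q₁ * q₂) ^ (mode g * (s + m)) / ((mode g).natAbs : K) := by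
        rw [← mul_div_assoc, ← zpow_mul, ← zpow_add₀ h0]
        congr 2
        ring
      rw [h2] at h1
      exact h1
  · cases e'
    · simpa using regAt_zero _
    · exact regAt_C _ _

/-- Exchanging `x` and `y` in the factor of one colour. -/
theorem X_zpow_mul_invHom_stepFactor (l : Idx r →₀ ℕ) (i : Fin r) (s t : ℤ) (e e' : Bool) :
    RatFunc.X ^ weight r (colourPart l i) * invHom (stepFactor q₁ q₂ u l i t s e' e) =
      stepFactor q₁ q₂ u l i s t e e' := by
  have h1 : ((colourPart l i).prod fun g k => (RatFunc.X ^ mode g : RatFunc K) ^ k) =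
      RatFunc.X ^ weight r (colourPart l i) := by
    rw [weight_eq_sum, Finsupp.prod, Finsupp.sum]
    induction (colourPart l i).support using Finset.cons_induction with
    | empty => simp
    | cons g s hg ih =>
      rw [Finset.prod_cons, Finset.sum_cons, ih, zpow_add₀ RatFunc.X_ne_zero, ← zpow_natCast,
        ← zpow_mul, mul_comm (mode g)]
  have h2 : stepCoeff q₁ q₂ s t e e' = fun g : Idx r => RatFunc.X ^ mode g *
      invHom (stepCoeff q₁ q₂ t s e' e g) := by
    funext g
    have hX : (RatFunc.X ^ mode g * (RatFunc.X⁻¹) ^ mode g : RatFunc K) = 1 := by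
      rw [← mul_zpow, mul_inv_cancel₀ RatFunc.X_ne_zero, one_zpow]
    unfold stepCoeff
    rw [map_add]
    cases e <;> cases e' <;>
      simp only [if_true, if_false, Bool.false_eq_true, map_zero, map_mul, map_zpow₀, invHom_C,
        invHom_X, mul_add, add_zero, zero_add, mul_zero]
    · rw [← mul_assoc, hX, one_mul]
    · rw [← mul_assoc, hX, one_mul, add_comm]
  rw [stepFactor, stepFactor, map_mul, invHom_C, map_coeff_mvExp, h2, coeff_mvExp_mul, h1,
    mul_comm (if e' then u i else 1)]
  ring

end StepValues

/-! ### Poles and residues of the path sums -/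

section Poles

variable {K : Type*} [Field K] {r : ℕ} {q₁ q₂ : K} (u : Fin r → K)

/-- The recursion of `θ` with integer arguments. -/
theorem theta_toNat_succ {E : ℤ} (hE : 1 ≤ E) :
    theta q₁ q₂ (E + 1).toNat = theta q₁ q₂ E.toNat * zeta q₁ q₂ ((q₁ * q₂) ^ E) := by
  obtain ⟨n, rfl⟩ := Int.eq_ofNat_of_zero_le (show 0 ≤ E by omega)
  have h : ((n : ℤ) + 1).toNat = n + 1 := by omega
  rw [h, theta_succ (by omega), Int.toNat_natCast, zpow_natCast]

/-- The poles of the path sums at the points `q^m`, `m ≥ 0`.  The path sum of `(s, t)` is regular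
there when `s - t ≤ -m`; otherwise it has at most a simple pole, whose residue is a multiple of
the value of the path sum of `(t - m, s + m)`.

Both path sums satisfy the same recursion over colours: at `z = q^m` the local factors are exchanged
by `stepValue_symm`, the case of a colour in `I` only being swapped with that of a colour in `J` only,
and the factors `ζ` agree by the functional equation and the recursion of `θ`. -/
theorem regAt_pathSum [CharZero K] (hq : AlgebraicIndependent ℚ ![q₁, q₂]) (l : Idx r →₀ ℕ) {m : ℤ}
    (hm : 0 ≤ m) (i : ℕ) (hi : i ≤ r) (s t : ℤ) :
    (s - t ≤ -m → ∃ v, RegAt ((q₁ * q₂) ^ m) (pathSum (stepWeight q₁ q₂ u l) i s t) v) ∧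
    (-m < s - t → ∃ v,
      RegAt ((q₁ * q₂) ^ m) (pathSum (stepWeight q₁ q₂ u l) i (t - m) (s + m)) v ∧
      RegAt ((q₁ * q₂) ^ m) ((1 - RatFunc.C ((q₁ * q₂) ^ (-m)) * RatFunc.X) *
        pathSum (stepWeight q₁ q₂ u l) i s t) (theta q₁ q₂ (s - t + m).toNat * v)) := by
  have h0 := q_ne_zero hq
  induction i generalizing s t with
  | zero =>
    simp only [pathSum_zero]
    refine ⟨fun _ => ?_, fun h => ⟨0, ?_, ?_⟩⟩
    · split_ifs
      · exact ⟨1, regAt_one _⟩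
      · exact ⟨0, regAt_zero _⟩
    · rw [if_neg (by omega)]
      exact regAt_zero _
    · have h1 := regAt_one_sub ((q₁ * q₂) ^ (-m)) ((q₁ * q₂) ^ m)
      rw [← zpow_add₀ h0, neg_add_cancel, zpow_zero, sub_self] at h1
      split_ifs
      · simpa using h1
      · simpa using regAt_zero _
  | succ i ih =>
    have hir : i < r := hi
    have ih := ih (by omega)
    set A := pathSum (stepWeight q₁ q₂ u l) i with hA
    set c := (q₁ * q₂) ^ m with hc
    set ε : RatFunc K := 1 - RatFunc.C ((q₁ * q₂) ^ (-m)) * RatFunc.X with hε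
    have hS := fun (s t : ℤ) (e e' : Bool) {x : ℤ} (hx : s + m = x) =>
      regAt_stepFactor u h0 l ⟨i, hir⟩ s t e e' hx
    have hrec : ∀ s t, pathSum (stepWeight q₁ q₂ u l) (i + 1) s t =
        A s t * stepFactor q₁ q₂ u l ⟨i, hir⟩ s t false false +
        A s (t - 1) * stepFactor q₁ q₂ u l ⟨i, hir⟩ s (t - 1) false true +
        (A (s - 1) t * (zetaFunc q₁ q₂ ((q₁ * q₂) ^ (s - 1 - t)) *
          stepFactor q₁ q₂ u l ⟨i, hir⟩ (s - 1) t true false) +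
        A (s - 1) (t - 1) * stepFactor q₁ q₂ u l ⟨i, hir⟩ (s - 1) (t - 1) true true) := by
      intro s t
      rw [pathSum_succ _ hir]
      simp [stepWeight, hA]
    simp only [hrec]
    refine ⟨fun h => ?_, fun h => ?_⟩
    · obtain ⟨v1, hv1⟩ := (ih s t).1 h
      obtain ⟨v3, hv3⟩ := (ih (s - 1) t).1 (by omega)
      obtain ⟨v4, hv4⟩ := (ih (s - 1) (t - 1)).1 (by omega)
      have r1 := hv1.mul (hS s t false false rfl)
      have r4 := hv4.mul (hS (s - 1) (t - 1) true true rfl)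
      rcases eq_or_ne (s - t) (-m) with hst | hst
      · -- The poles of the two middle terms cancel.
        obtain ⟨v2, hv2, hv2'⟩ := (ih s (t - 1)).2 (by omega)
        have e1 : t - 1 - m = s - 1 := by omega
        have e2 : s + m = t := by omega
        have e3 : (s - (t - 1) + m).toNat = 1 := by omega
        rw [e1, e2] at hv2
        rw [e3] at hv2'
        obtain rfl := hv2.unique hv3
        have r2 := hv2'.mul (hS s (t - 1) false true e2)
        have r3 := (regAt_mul_zetaFunc' hq (m := m) (j := s - 1 - t) (by omega)).mul
          (hv3.mul (hS (s - 1) t true false (x := t - 1) (by omega)))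
        have r23 := r2.add r3
        rw [stepValue_symm q₁ q₂ u l _ t (t - 1)] at r23
        have e4 : ε * A s (t - 1) * stepFactor q₁ q₂ u l ⟨i, hir⟩ s (t - 1) false true +
            ε * zetaFunc q₁ q₂ ((q₁ * q₂) ^ (s - 1 - t)) *
              (A (s - 1) t * stepFactor q₁ q₂ u l ⟨i, hir⟩ (s - 1) t true false) =
            ε * (A s (t - 1) * stepFactor q₁ q₂ u l ⟨i, hir⟩ s (t - 1) false true +
              A (s - 1) t * (zetaFunc q₁ q₂ ((q₁ * q₂) ^ (s - 1 - t)) *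
                stepFactor q₁ q₂ u l ⟨i, hir⟩ (s - 1) t true false)) := by ring
        rw [e4] at r23
        have e5 : ∀ a b c : K, a * b * c + -a * (b * c) = 0 := fun a b c => by ring
        rw [e5] at r23
        obtain ⟨v, hv⟩ := regAt_of_mul_one_sub (by
          rw [← zpow_add₀ h0, neg_add_cancel, zpow_zero]) r23
        refine ⟨_, (RegAt.congr_left ?_ ((r1.add hv).add r4))⟩
        ring
      -- Away from the boundary all terms of the recursion are regular.
      · obtain ⟨v2, hv2⟩ := (ih s (t - 1)).1 (by omega)
        have r2 := hv2.mul (hS s (t - 1) false true rfl)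
        have r3 := hv3.mul ((regAt_zetaFunc hq (m := m) (j := s - 1 - t) rfl (by omega)
          (by omega)).mul (hS (s - 1) t true false rfl))
        exact ⟨_, (r1.add r2).add (r3.add r4)⟩
    · obtain ⟨E, hE⟩ : ∃ E : ℤ, E = s - t + m := ⟨_, rfl⟩
      obtain ⟨v1, hv1, hv1'⟩ := (ih s t).2 h
      obtain ⟨v2, hv2, hv2'⟩ := (ih s (t - 1)).2 (by omega)
      obtain ⟨v4, hv4, hv4'⟩ := (ih (s - 1) (t - 1)).2 (by omega)
      have e1 : s - (t - 1) + m = E + 1 := by omega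
      have e2 : s - 1 - (t - 1) + m = E := by omega
      rw [← hE] at hv1'
      rw [e1, theta_toNat_succ (by omega)] at hv2'
      rw [e2] at hv4'
      have h3 : ∃ v3, RegAt c (A (t - m) (s + m - 1)) v3 ∧
          RegAt c (ε * (A (s - 1) t * zetaFunc q₁ q₂ ((q₁ * q₂) ^ (s - 1 - t))))
            (theta q₁ q₂ E.toNat * v3) := by
        -- For `E = 1` the pole is that of `ζ` and the path sum is regular; for `E > 1` it is the other
        -- way around, and the value of `ζ` turns `θ(E - 1)` into `θ(E)`.
        rcases eq_or_ne E 1 with hE1 | hE1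
        · obtain ⟨v3, hv3⟩ := (ih (s - 1) t).1 (by omega)
          have e3 : t - m = s - 1 := by omega
          have e4 : s + m - 1 = t := by omega
          have e5 : E.toNat = 1 := by omega
          refine ⟨v3, by rwa [e3, e4], ?_⟩
          rw [e5]
          refine RegAt.congr_left ?_
            ((regAt_mul_zetaFunc hq (m := m) (j := s - 1 - t) (by omega)).mul hv3)
          ring
        · obtain ⟨v3, hv3, hv3'⟩ := (ih (s - 1) t).2 (by omega)
          have e3 : s - 1 + m = s + m - 1 := by omega
          have e4 : s - 1 - t + m = E - 1 := by omega
          rw [e3] at hv3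
          rw [e4] at hv3'
          refine ⟨v3, hv3, ?_⟩
          have e5 : theta q₁ q₂ E.toNat = theta q₁ q₂ (E - 1).toNat *
              zeta q₁ q₂ ((q₁ * q₂) ^ (E - 1)) := by
            rw [← theta_toNat_succ (by omega), sub_add_cancel]
          have r := hv3'.mul (regAt_zetaFunc hq (m := m) (j := s - 1 - t) e4 (by omega) (by omega))
          exact (RegAt.congr_left (mul_assoc _ _ _).symm r).congr_right (by rw [e5, mul_right_comm])
      obtain ⟨v3, hv3, hv3'⟩ := h3
      have e6 : s - 1 + m = s + m - 1 := by omega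
      have e7 : t - 1 - m = t - m - 1 := by omega
      have e8 : t - m - 1 + m = t - 1 := by omega
      rw [e6] at hv4
      rw [e7] at hv2 hv4
      have hz : zeta q₁ q₂ ((q₁ * q₂) ^ (-E - 1)) = zeta q₁ q₂ ((q₁ * q₂) ^ E) :=
        zeta_zpow_neg (q₁_ne_zero hq) (q₂_ne_zero hq) (by omega)
      have a1 := hv1.mul (hS (t - m) (s + m) false false (x := t) (by omega))
      have a2 := hv3.mul (hS (t - m) (s + m - 1) false true (x := t) (by omega))
      have a3 := hv2.mul ((regAt_zetaFunc hq (m := m) (j := t - m - 1 - (s + m)) (n := -E - 1)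
        (by omega) (by omega) (by omega)).mul
          (hS (t - m - 1) (s + m) true false (x := t - 1) (by omega)))
      have a4 := hv4.mul (hS (t - m - 1) (s + m - 1) true true (x := t - 1) (by omega))
      have b1 := hv1'.mul (hS s t false false rfl)
      have b2 := hv2'.mul (hS s (t - 1) false true rfl)
      have b3 := hv3'.mul (hS (s - 1) t true false e6)
      have b4 := hv4'.mul (hS (s - 1) (t - 1) true true e6)
      refine ⟨_, (a1.add a2).add (a3.add a4), ?_⟩
      refine (RegAt.congr_left ?_ ((b1.add b2).add (b3.add b4))).congr_right ?_
      · ring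
      · rw [← hE, hz, stepValue_symm q₁ q₂ u l _ (s + m) t, stepValue_symm q₁ q₂ u l _ (s + m) (t - 1),
          stepValue_symm q₁ q₂ u l _ (s + m - 1) t, stepValue_symm q₁ q₂ u l _ (s + m - 1) (t - 1)]
        ring

theorem polesIn_coeff_mvExp {S : Set K} {γ : Idx r → RatFunc K} (h : ∀ g, PolesIn S (γ g))
    (l : Idx r →₀ ℕ) : PolesIn S (MvPowerSeries.coeff l (mvExp K γ)) := by
  rw [coeff_mvExp]
  exact PolesIn.prod _ fun g _ => (polesIn_C _).mul ((h g).pow _)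

/-- The poles of the path sums are powers of `q`. -/
theorem polesIn_pathSum (h0 : q₁ * q₂ ≠ 0) (l : Idx r →₀ ℕ) (i : ℕ) (s t : ℤ) :
    PolesIn (Set.range fun m : ℤ => ((q₁ * q₂) ^ m)⁻¹)
      (pathSum (stepWeight q₁ q₂ u l) i s t) := by
  have hmem : ∀ j : ℤ, (q₁ * q₂) ^ j ∈ Set.range fun m : ℤ => ((q₁ * q₂) ^ m)⁻¹ := fun j =>
    ⟨-j, by simp⟩
  refine PolesIn.sum _ fun I _ => PolesIn.sum _ fun J _ => ?_
  split_ifs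
  · refine PolesIn.prod _ fun j _ => PolesIn.mul ?_ ((polesIn_C _).mul
      (polesIn_coeff_mvExp (fun g => PolesIn.add ?_ ?_) _))
    · split_ifs
      · rw [zetaFunc_eq, div_eq_mul_inv, mul_inv]
        refine ((polesIn_one_sub _).mul (polesIn_one_sub _)).mul
          ((polesIn_inv_one_sub (hmem _)).mul (polesIn_inv_one_sub ?_))
        rw [← zpow_one_add₀ h0]
        exact hmem _
      · simpa using polesIn_C (1 : K)
    · split_ifs
      · exact (polesIn_X_zpow _).mul (polesIn_C _)
      · simpa using polesIn_C (0 : K)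
    · split_ifs
      · exact polesIn_C _
      · simpa using polesIn_C (0 : K)
  · simpa using polesIn_C (0 : K)

end Poles

/-! ### The symmetry exchanging the two currents -/

section Symmetry

variable {K : Type*} [Field K] {r : ℕ} (q₁ q₂ : K) (u : Fin r → K)

/-- The product of the functions `ζ(q^j z)` over `0 ≤ j < n`, continued to negative `n`. -/
def zetaProd (n : ℤ) : RatFunc K :=
  (∏ j ∈ Finset.range n.toNat, zetaFunc q₁ q₂ ((q₁ * q₂) ^ (j : ℤ))) /
    ∏ j ∈ Finset.range (-n).toNat, zetaFunc q₁ q₂ ((q₁ * q₂) ^ (-(j : ℤ) - 1))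

theorem zetaProd_zero : zetaProd q₁ q₂ 0 = 1 := by
  simp [zetaProd]

theorem zetaProd_add_one (n : ℤ) :
    zetaProd q₁ q₂ (n + 1) = zetaProd q₁ q₂ n * zetaFunc q₁ q₂ ((q₁ * q₂) ^ n) := by
  rcases lt_or_ge n 0 with h | h
  · obtain ⟨k, rfl⟩ : ∃ k : ℕ, n = -(k : ℤ) - 1 := ⟨(-n - 1).toNat, by omega⟩
    have e1 : (-(k : ℤ) - 1 + 1).toNat = 0 := by omega
    have e2 : (-(k : ℤ) - 1).toNat = 0 := by omega
    have e3 : (-(-(k : ℤ) - 1 + 1)).toNat = k := by omega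
    have e4 : (-(-(k : ℤ) - 1)).toNat = k + 1 := by omega
    rw [zetaProd, zetaProd, e1, e2, e3, e4, Finset.prod_range_succ, div_mul_eq_mul_div,
      mul_div_mul_right _ _ (zetaFunc_ne_zero q₁ q₂ _)]
  · obtain ⟨k, rfl⟩ := Int.eq_ofNat_of_zero_le h
    have e1 : ((k : ℤ) + 1).toNat = k + 1 := by omega
    have e2 : (k : ℤ).toNat = k := by omega
    have e3 : (-((k : ℤ) + 1)).toNat = 0 := by omega
    have e4 : (-(k : ℤ)).toNat = 0 := by omega
    rw [zetaProd, zetaProd, e1, e2, e3, e4, Finset.prod_range_succ]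
    simp

variable {q₁ q₂}

/-- The symmetry of the path sums under `z ↦ z⁻¹`. -/
theorem pathSum_symm (h₁ : q₁ ≠ 0) (h₂ : q₂ ≠ 0) (l : Idx r →₀ ℕ) (i : ℕ) (hi : i ≤ r) (s t : ℤ) :
    pathSum (stepWeight q₁ q₂ u l) i s t =
      RatFunc.X ^ (∑ j ∈ lowColours r i, weight r (colourPart l j)) *
        invHom (pathSum (stepWeight q₁ q₂ u l) i t s) * zetaProd q₁ q₂ (s - t) := by
  induction i generalizing s t with
  | zero =>
    have : lowColours r 0 = ∅ := by simp [lowColours]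
    rw [pathSum_zero, pathSum_zero, this, Finset.sum_empty, zpow_zero, one_mul]
    by_cases h : s = 0 ∧ t = 0
    · rw [if_pos h, if_pos h.symm, h.1, h.2, sub_self, zetaProd_zero, map_one, one_mul]
    · rw [if_neg h, if_neg (fun h' => h h'.symm), map_zero, zero_mul]
  | succ i ih =>
    have hir : i < r := hi
    have ih := ih (by omega)
    set A := pathSum (stepWeight q₁ q₂ u l) i with hA
    have hrec : ∀ s t, pathSum (stepWeight q₁ q₂ u l) (i + 1) s t =
        A s t * stepFactor q₁ q₂ u l ⟨i, hir⟩ s t false false +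
        A s (t - 1) * stepFactor q₁ q₂ u l ⟨i, hir⟩ s (t - 1) false true +
        (A (s - 1) t * (zetaFunc q₁ q₂ ((q₁ * q₂) ^ (s - 1 - t)) *
          stepFactor q₁ q₂ u l ⟨i, hir⟩ (s - 1) t true false) +
        A (s - 1) (t - 1) * stepFactor q₁ q₂ u l ⟨i, hir⟩ (s - 1) (t - 1) true true) := by
      intro s t
      rw [pathSum_succ _ hir]
      simp [stepWeight, hA]
    have z1 : invHom (zetaFunc q₁ q₂ ((q₁ * q₂) ^ (t - 1 - s))) =
        zetaFunc q₁ q₂ ((q₁ * q₂) ^ (s - t)) := invHom_zetaFunc h₁ h₂ (by omega)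
    have z2 : zetaProd q₁ q₂ (s - (t - 1)) =
        zetaProd q₁ q₂ (s - t) * zetaFunc q₁ q₂ ((q₁ * q₂) ^ (s - t)) := by
      rw [← zetaProd_add_one]
      congr 1
      omega
    have z3 : zetaProd q₁ q₂ (s - t) =
        zetaProd q₁ q₂ (s - 1 - t) * zetaFunc q₁ q₂ ((q₁ * q₂) ^ (s - 1 - t)) := by
      rw [← zetaProd_add_one]
      congr 1
      omega
    have z4 : zetaProd q₁ q₂ (s - 1 - (t - 1)) = zetaProd q₁ q₂ (s - t) := by
      congr 1
      omega
    rw [hrec s t, hrec t s, lowColours_succ hir, Finset.sum_insert (notMem_lowColours hir),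
      zpow_add₀ RatFunc.X_ne_zero, ih s t, ih s (t - 1), ih (s - 1) t, ih (s - 1) (t - 1),
      z2, z4]
    simp only [map_add, map_mul, z1]
    simp only [← X_zpow_mul_invHom_stepFactor u l ⟨i, hir⟩ s, ← X_zpow_mul_invHom_stepFactor u l
      ⟨i, hir⟩ (s - 1)]
    rw [z3]
    ring

/-- Exchanging `x` and `y`. -/
theorem currentFunc_symm (h₁ : q₁ ≠ 0) (h₂ : q₂ ≠ 0) (l : Idx r →₀ ℕ) (k k' : ℕ) :
    currentFunc q₁ q₂ u k k' l =
      RatFunc.X ^ weight r l * invHom (currentFunc q₁ q₂ u k' k l) := by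
  have key : ∀ a b : ℕ, zetaProd q₁ q₂ ((a : ℤ) - b) /
      ∏ s ∈ Finset.range (a - b), zetaFunc q₁ q₂ ((q₁ * q₂) ^ s) =
      (invHom (∏ s ∈ Finset.range (b - a), zetaFunc q₁ q₂ ((q₁ * q₂) ^ s)))⁻¹ := by
    intro a b
    have e1 : ((a : ℤ) - b).toNat = a - b := by omega
    have e2 : (-((a : ℤ) - b)).toNat = b - a := by omega
    have e3 : ∀ s : ℕ, invHom (zetaFunc q₁ q₂ ((q₁ * q₂) ^ s)) =
        zetaFunc q₁ q₂ ((q₁ * q₂) ^ (-(s : ℤ) - 1)) := by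
      intro s
      rw [← zpow_natCast]
      exact invHom_zetaFunc h₁ h₂ (by omega)
    rw [zetaProd, e1, e2, map_prod]
    simp only [e3, zpow_natCast]
    rw [div_right_comm, div_self, one_div]
    exact Finset.prod_ne_zero_iff.mpr fun s _ => zetaFunc_ne_zero q₁ q₂ _
  rw [currentFunc, currentFunc, map_div₀, pairSum_eq_pathSum, pairSum_eq_pathSum,
    pathSum_symm u h₁ h₂ l r le_rfl, lowColours_self, sum_weight_colourPart, mul_div_assoc, key,
    mul_assoc, ← div_eq_mul_inv]

end Symmetry

/-! ### The quadratic relation -/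

section QuadraticRelation

variable {K : Type*} [Field K] {r : ℕ} {q₁ q₂ : K} (u : Fin r → K)

/-- For `k ≤ k'` there are no factors `ζ` to divide out. -/
theorem currentFunc_eq_pathSum {k k' : ℕ} (h : k ≤ k') (l : Idx r →₀ ℕ) :
    currentFunc q₁ q₂ u k k' l = pathSum (stepWeight q₁ q₂ u l) r k k' := by
  rw [currentFunc, Nat.sub_eq_zero_of_le h, Finset.prod_range_zero, div_one, pairSum_eq_pathSum]

/-- The values of `ζ` divided out when `k > k'` shorten `θ(k - k' + m)` to `θ(m)`. -/
theorem theta_mul_prod_zeta {m : ℕ} (hm : 1 ≤ m) (d : ℕ) :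
    theta q₁ q₂ m * ∏ s ∈ Finset.range d, zeta q₁ q₂ ((q₁ * q₂) ^ ((s : ℤ) + m)) =
      theta q₁ q₂ (m + d) := by
  induction d with
  | zero => simp
  | succ d ih =>
    rw [Finset.prod_range_succ, ← mul_assoc, ih, ← add_assoc, theta_succ (by omega),
      ← zpow_natCast]
    congr 3
    push_cast
    ring

variable (q₁ q₂)

/-- The restriction of `W_k(x) W_{k'}(y) f_{k k'}(y / x)` to `y / x = q^i`. -/
def restriction (k k' i : ℕ) (d : ℤ) : HeisHat K r := fun l =>
  if weight r l = d then (currentFunc q₁ q₂ u k k' l).eval (RingHom.id K) ((q₁ * q₂) ^ i) else 0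

theorem coeff_restriction (k k' i : ℕ) (d : ℤ) (l : Idx r →₀ ℕ) :
    MvPowerSeries.coeff l (restriction q₁ q₂ u k k' i d) = if weight r l = d then
      (currentFunc q₁ q₂ u k k' l).eval (RingHom.id K) ((q₁ * q₂) ^ i) else 0 := rfl

variable {q₁ q₂}

variable [CharZero K]

/-- The residues of the coefficients of `W_k(x) W_{k'}(y) f_{k k'}(y / x)` at the points
`y / x = q^m`. -/
theorem regAt_mul_currentFunc (hq : AlgebraicIndependent ℚ ![q₁, q₂]) (l : Idx r →₀ ℕ)
    {k k' m : ℕ} (hm : 1 ≤ m) (hkm : k' - k < m) :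
    ∃ v, RegAt ((q₁ * q₂) ^ (m : ℤ))
        (pathSum (stepWeight q₁ q₂ u l) r ((k' : ℤ) - m) ((k : ℤ) + m)) v ∧
      RegAt ((q₁ * q₂) ^ (m : ℤ)) ((1 - RatFunc.C ((q₁ * q₂) ^ (-(m : ℤ))) * RatFunc.X) *
        currentFunc q₁ q₂ u k k' l) (theta q₁ q₂ (min m (k + m - k')) * v) := by
  obtain ⟨v, hv, hv'⟩ := (regAt_pathSum u hq l (m := m) (by omega) r le_rfl k k').2 (by omega)
  refine ⟨v, hv, ?_⟩
  rcases le_total k k' with h | h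
  · have e : min m (k + m - k') = ((k : ℤ) - k' + m).toNat := by omega
    rwa [e, currentFunc_eq_pathSum u h]
  · have e1 : min m (k + m - k') = m := by omega
    have e2 : ((k : ℤ) - k' + m).toNat = m + (k - k') := by omega
    have hz : ∏ s ∈ Finset.range (k - k'), zeta q₁ q₂ ((q₁ * q₂) ^ ((s : ℤ) + m)) ≠ 0 :=
      Finset.prod_ne_zero_iff.mpr fun s _ => zeta_q_zpow_ne_zero hq (by omega) (by omega)
    have h1 := hv'.div (RegAt.prod (Finset.range (k - k')) fun s _ =>
      regAt_zetaFunc hq (m := m) (j := (s : ℤ)) rfl (by omega) (by omega)) hz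
    rw [e2, ← theta_mul_prod_zeta hm, mul_right_comm, mul_div_cancel_right₀ _ hz, mul_div_assoc,
      ← pairSum_eq_pathSum] at h1
    simp only [zpow_natCast (q₁ * q₂) (_ : ℕ)] at h1 ⊢
    rw [e1]
    exact h1

/-- The restrictions of products of currents to `y / x = q^i` exist in the range where the path sums
are regular. -/
theorem isRestriction_restriction (hq : AlgebraicIndependent ℚ ![q₁, q₂]) {k k' i : ℕ}
    (h : k + i ≤ k') :
    IsRestriction (currentMul q₁ q₂ (wMode q₁ q₂ u k) (wMode q₁ q₂ u k') (fSeries q₁ q₂ k k'))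
      ((q₁ * q₂) ^ i) (restriction q₁ q₂ u k k' i) := by
  intro d l
  by_cases hl : weight r l = d
  · refine ⟨currentFunc q₁ q₂ u k k' l, fun a => ?_, ?_, ?_⟩
    · rw [coeff_currentMul_wMode q₁ q₂ u hq, if_pos (by omega)]
    · obtain ⟨v, hv⟩ := (regAt_pathSum u hq l (m := i) (by omega) r le_rfl k k').1 (by omega)
      rw [zpow_natCast, ← currentFunc_eq_pathSum u (by omega)] at hv
      exact hv.denom_ne_zero
    · rw [coeff_restriction, if_pos hl]
  -- The coefficient of a basis vector of another weight vanishes identically.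
  · refine ⟨0, fun a => ?_, ?_, ?_⟩
    · rw [coeff_currentMul_wMode q₁ q₂ u hq, if_neg (by omega), map_zero, HahnSeries.coeff_zero]
    · rw [RatFunc.denom_zero, Polynomial.eval_one]
      exact one_ne_zero
    · rw [coeff_restriction, if_neg hl, RatFunc.eval_zero]

/-- The residue of `W_k(x) W_{k'}(y) f_{k k'}(y / x)` at `y / x = q^i` is a multiple of the
restriction of `W_{k'-i}(x) W_{k+i}(y) f_{k'-i,k+i}(y / x)`. -/
theorem regAt_mul_currentFunc_eval (hq : AlgebraicIndependent ℚ ![q₁, q₂]) (l : Idx r →₀ ℕ)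
    {k k' i : ℕ} (hi : i ∈ Finset.Icc (k' - k + 1) k') :
    RegAt ((q₁ * q₂) ^ (i : ℤ)) ((1 - RatFunc.C ((q₁ * q₂) ^ (-(i : ℤ))) * RatFunc.X) *
        currentFunc q₁ q₂ u k k' l) (theta q₁ q₂ (min i (k + i - k')) *
      (currentFunc q₁ q₂ u (k' - i) (k + i) l).eval (RingHom.id K) ((q₁ * q₂) ^ i)) := by
  rw [Finset.mem_Icc] at hi
  obtain ⟨v, hv, hv'⟩ := regAt_mul_currentFunc u hq l (k := k) (k' := k') (m := i)
    (by omega) (by omega)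
  have e : pathSum (stepWeight q₁ q₂ u l) r ((k' : ℤ) - i) ((k : ℤ) + i) =
      currentFunc q₁ q₂ u (k' - i) (k + i) l := by
    rw [currentFunc_eq_pathSum u (by omega)]
    congr 1
    omega
  rw [e, zpow_natCast] at hv
  rwa [hv.eval_eq]

/-- There is no pole at `q^i` for `i > k'`: the residue involves a path sum of a negative size. -/
theorem regAt_currentFunc_of_lt (hq : AlgebraicIndependent ℚ ![q₁, q₂]) (l : Idx r →₀ ℕ)
    {k k' i : ℕ} (hi : k' < i) :
    ∃ v, RegAt ((q₁ * q₂) ^ (i : ℤ)) (currentFunc q₁ q₂ u k k' l) v := by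
  obtain ⟨v, hv, hv'⟩ := regAt_mul_currentFunc u hq l (k := k) (k' := k') (m := i)
    (by omega) (by omega)
  rw [pathSum_of_neg _ _ (by omega)] at hv
  rw [hv.unique (regAt_zero _), mul_zero] at hv'
  exact regAt_of_mul_one_sub (by rw [← zpow_add₀ (q_ne_zero hq), neg_add_cancel, zpow_zero]) hv'

/-- Poles of the coefficients of `W_k(x) W_{k'}(y) f_{k k'}(y / x)` at negative powers of `q`,
obtained by exchanging `x` and `y`. -/
theorem RegAt.currentFunc_neg (hq : AlgebraicIndependent ℚ ![q₁, q₂]) {l : Idx r →₀ ℕ}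
    {k k' : ℕ} {i : ℤ} {ρ : K} (h : RegAt ((q₁ * q₂) ^ i)
      ((1 - RatFunc.C ((q₁ * q₂) ^ (-i)) * RatFunc.X) * currentFunc q₁ q₂ u k' k l) ρ) :
    RegAt ((q₁ * q₂) ^ (-i)) ((1 - RatFunc.C ((q₁ * q₂) ^ i) * RatFunc.X) *
      currentFunc q₁ q₂ u k k' l) (-((q₁ * q₂) ^ (-(i * weight r l)) * ρ)) := by
  have h0 := q_ne_zero hq
  have h1 := h.invHom (zpow_ne_zero i h0)
  rw [← zpow_neg] at h1
  have h2 := (((regAt_C _ ((q₁ * q₂) ^ i)).mul (regAt_X ((q₁ * q₂) ^ (-i)))).mul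
    ((regAt_X ((q₁ * q₂) ^ (-i))).zpow (zpow_ne_zero (-i) h0) (weight r l))).neg.mul h1
  refine (RegAt.congr_left ?_ h2).congr_right ?_
  · rw [currentFunc_symm u (q₁_ne_zero hq) (q₂_ne_zero hq) l k k', map_mul, map_sub, map_one,
      map_mul, invHom_C, invHom_X]
    have e1 : (RatFunc.C ((q₁ * q₂) ^ i) * RatFunc.C ((q₁ * q₂) ^ (-i)) : RatFunc K) = 1 := by
      rw [← map_mul, ← zpow_add₀ h0, add_neg_cancel, zpow_zero, map_one]
    have e2 := mul_inv_cancel₀ (RatFunc.X_ne_zero (K := K))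
    linear_combination (-(RatFunc.X ^ weight r l * DeformedW.invHom (currentFunc q₁ q₂ u k' k l))) * e1 -
      (RatFunc.X ^ weight r l * DeformedW.invHom (currentFunc q₁ q₂ u k' k l) *
        (RatFunc.C ((q₁ * q₂) ^ i) * RatFunc.C ((q₁ * q₂) ^ (-i)))) * e2
  · rw [← zpow_add₀ h0, add_neg_cancel, zpow_zero, one_mul, ← zpow_mul, neg_mul, neg_mul]

/-- By the symmetry, the product in the opposite order is the expansion at infinity of the same
rational function. -/
theorem coeff_currentMul_sub (hq : AlgebraicIndependent ℚ ![q₁, q₂]) (k k' : ℕ) (a b : ℤ)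
    {l : Idx r →₀ ℕ} (hl : weight r l = a + b) :
    MvPowerSeries.coeff l (currentMul q₁ q₂ (wMode q₁ q₂ u k) (wMode q₁ q₂ u k')
        (fSeries q₁ q₂ k k') a b) -
      MvPowerSeries.coeff l (currentMul q₁ q₂ (wMode q₁ q₂ u k') (wMode q₁ q₂ u k)
        (fSeries q₁ q₂ k' k) b a) = expansionDiff a (currentFunc q₁ q₂ u k k' l) := by
  rw [coeff_currentMul_wMode q₁ q₂ u hq, coeff_currentMul_wMode q₁ q₂ u hq, if_pos hl,
    if_pos (by omega), expansionDiff, ← toLaurent_apply, ← toLaurent_apply,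
    currentFunc_symm u (q₁_ne_zero hq) (q₂_ne_zero hq) l k' k, map_mul, map_zpow₀, toLaurent_X,
    ← RatFunc.single_zpow, HahnSeries.coeff_single_mul, one_mul]
  congr 2
  omega

/-- Each coefficient of the left-hand side is the difference of the two expansions of one rational
function, whose poles `q^i` and `q^{-i}` give the two sums of delta functions. -/
theorem quadratic_relation_of_le (hq : AlgebraicIndependent ℚ ![q₁, q₂]) {k k' : ℕ} (h : k ≤ k')
    (a b : ℤ) :
    currentMul q₁ q₂ (wMode q₁ q₂ u k) (wMode q₁ q₂ u k') (fSeries q₁ q₂ k k') a b -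
        currentMul q₁ q₂ (wMode q₁ q₂ u k') (wMode q₁ q₂ u k) (fSeries q₁ q₂ k' k) b a =
      ∑ i ∈ Finset.Icc (k' - k + 1) k', theta q₁ q₂ (min i (k + i - k')) •
          deltaMul ((q₁ * q₂) ^ i) (restriction q₁ q₂ u (k' - i) (k + i) i) a b -
        ∑ i ∈ Finset.Icc (k - k' + 1) k, theta q₁ q₂ (min i (k' + i - k)) •
          deltaMul ((q₁ * q₂) ^ i) (restriction q₁ q₂ u (k - i) (k' + i) i) b a := by
  have h0 := q_ne_zero hq
  ext l
  rw [map_sub, map_sub, map_sum, map_sum]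
  simp only [map_smul, deltaMul, coeff_restriction, smul_eq_mul, add_comm b a]
  by_cases hl : weight r l = a + b
  · rw [coeff_currentMul_sub u hq k k' a b hl]
    simp only [if_pos hl]
    set R := currentFunc q₁ q₂ u k k' l with hR
    set V : ℕ → ℕ → ℕ → K := fun k k' i =>
      (currentFunc q₁ q₂ u k k' l).eval (RingHom.id K) ((q₁ * q₂) ^ i) with hV
    -- The exponents of the poles: positive powers of `q` from the first sum, negative ones from the
    -- second.
    set T₁ := (Finset.Icc (k' - k + 1) k').image fun i : ℕ => (i : ℤ) with hT₁
    set T₂ := (Finset.Icc (k - k' + 1) k).image fun i : ℕ => -(i : ℤ) with hT₂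
    have hdisj : Disjoint T₁ T₂ := by
      rw [Finset.disjoint_left]
      intro m h1 h2
      simp only [hT₁, hT₂, Finset.mem_image, Finset.mem_Icc] at h1 h2
      omega
    have hpoles : PolesIn (Set.range fun m : ℤ => ((q₁ * q₂) ^ m)⁻¹) R := by
      rw [hR, currentFunc_eq_pathSum u h]
      exact polesIn_pathSum u h0 l r _ _
    have key := expansionDiff_eq_sum (q_zpow_injective hq) (fun m => zpow_ne_zero m h0) hpoles
      (T₁ ∪ T₂) (fun m => if 0 < m then theta q₁ q₂ (min m.toNat (k + m.toNat - k')) *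
          V (k' - m.toNat) (k + m.toNat) m.toNat
        else -((q₁ * q₂) ^ (m * weight r l) *
          (theta q₁ q₂ (min (-m).toNat (k' + (-m).toNat - k)) *
          V (k - (-m).toNat) (k' + (-m).toNat) (-m).toNat))) ?_ ?_ a
    · rw [key, Finset.sum_union hdisj, Finset.sum_image (by simp), Finset.sum_image (by simp),
        sub_eq_add_neg, ← Finset.sum_neg_distrib]
      refine congrArg₂ _ (Finset.sum_congr rfl fun i hi => ?_)
        (Finset.sum_congr rfl fun i hi => ?_)
      · rw [Finset.mem_Icc] at hi
        rw [if_pos (by omega), Int.toNat_natCast, zpow_natCast]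
        ring
      · rw [Finset.mem_Icc] at hi
        rw [if_neg (by omega), neg_neg, Int.toNat_natCast, hl]
        have e : (q₁ * q₂) ^ (-(i : ℤ) * (a + b)) * ((q₁ * q₂) ^ (-(i : ℤ))) ^ (-a) =
            ((q₁ * q₂) ^ i) ^ (-b) := by
          rw [← zpow_natCast, ← zpow_mul, ← zpow_mul, ← zpow_add₀ h0]
          congr 1
          ring
        rw [← e]
        ring
    · intro m hm
      rw [← zpow_neg]
      rcases Finset.mem_union.mp hm with h1 | h1
      · obtain ⟨i, hi, rfl⟩ := Finset.mem_image.mp h1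
        have h2 := Finset.mem_Icc.mp hi
        rw [if_pos (by omega), Int.toNat_natCast]
        exact regAt_mul_currentFunc_eval u hq l hi
      · obtain ⟨i, hi, rfl⟩ := Finset.mem_image.mp h1
        have h2 := Finset.mem_Icc.mp hi
        rw [if_neg (by omega), neg_neg, Int.toNat_natCast, neg_mul]
        exact RegAt.currentFunc_neg u hq (regAt_mul_currentFunc_eval u hq l hi)
    · intro m hm
      simp only [hT₁, hT₂, Finset.mem_union, Finset.mem_image, Finset.mem_Icc, not_or] at hm
      rcases lt_or_ge m 0 with hm0 | hm0
      · obtain ⟨i, rfl⟩ : ∃ i : ℕ, m = -(i : ℤ) := ⟨(-m).toNat, by omega⟩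
        have hi : k < i := by
          by_contra hc
          exact hm.2 ⟨i, by omega, rfl⟩
        obtain ⟨v, hv⟩ := regAt_currentFunc_of_lt u hq l (k := k') hi
        have h1 := (regAt_one_sub ((q₁ * q₂) ^ (-(i : ℤ))) ((q₁ * q₂) ^ (i : ℤ))).mul hv
        rw [← zpow_add₀ h0, neg_add_cancel, zpow_zero, sub_self, zero_mul] at h1
        have h2 := RegAt.currentFunc_neg u hq h1
        rw [mul_zero, neg_zero] at h2
        exact regAt_of_mul_one_sub (by rw [← zpow_add₀ h0, add_neg_cancel, zpow_zero]) h2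
      -- The point `q^0 = 1` is covered by the second of the following cases, as `k ≤ k'`.
      · obtain ⟨i, rfl⟩ := Int.eq_ofNat_of_zero_le hm0
        rcases lt_or_ge k' i with hi | hi
        · exact regAt_currentFunc_of_lt u hq l hi
        · have hi' : i ≤ k' - k := by
            by_contra hc
            exact hm.1 ⟨i, by omega, rfl⟩
          rw [hR, currentFunc_eq_pathSum u h]
          exact (regAt_pathSum u hq l (m := i) (by omega) r le_rfl k k').1 (by omega)
  · rw [coeff_currentMul_wMode q₁ q₂ u hq, coeff_currentMul_wMode q₁ q₂ u hq, if_neg hl,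
      if_neg (by omega)]
    simp [hl]

/-- The case `k > k'` follows by exchanging the two currents, as both sides are antisymmetric. -/
theorem quadratic_relation (hq : AlgebraicIndependent ℚ ![q₁, q₂]) (k k' : ℕ) (a b : ℤ) :
    currentMul q₁ q₂ (wMode q₁ q₂ u k) (wMode q₁ q₂ u k') (fSeries q₁ q₂ k k') a b -
        currentMul q₁ q₂ (wMode q₁ q₂ u k') (wMode q₁ q₂ u k) (fSeries q₁ q₂ k' k) b a =
      ∑ i ∈ Finset.Icc (k' - k + 1) k', theta q₁ q₂ (min i (k + i - k')) •
          deltaMul ((q₁ * q₂) ^ i) (restriction q₁ q₂ u (k' - i) (k + i) i) a b -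
        ∑ i ∈ Finset.Icc (k - k' + 1) k, theta q₁ q₂ (min i (k' + i - k)) •
          deltaMul ((q₁ * q₂) ^ i) (restriction q₁ q₂ u (k - i) (k' + i) i) b a := by
  rcases le_total k k' with h | h
  · exact quadratic_relation_of_le u hq h a b
  · rw [← neg_sub, quadratic_relation_of_le u hq h b a, neg_sub]

end QuadraticRelation

end

end DeformedW


theorem proposition5p2 {K : Type*} [Field K] [CharZero K] (q₁ q₂ : K)
    (hq : AlgebraicIndependent ℚ ![q₁, q₂]) (r : ℕ) (u : Fin r → K) :
    -- all products in the commutators with the bosons are well defined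
    (∀ (k : ℕ) (d : ℤ) (n : Mode),
      StarSummable q₁ q₂ (wMode q₁ q₂ u k d) (toHat q₁ q₂ (boson q₁ q₂ r n)) ∧
      StarSummable q₁ q₂ (toHat q₁ q₂ (boson q₁ q₂ r n)) (wMode q₁ q₂ u k d)) ∧
    -- the coefficient of `x^{-d}` in the relation for `[W_k(x), p_{-n}]`
    (∀ (k : ℕ) (d : ℤ) (n : ℕ) (hn : (n : ℤ) ≠ 0),
      starComm q₁ q₂ (wMode q₁ q₂ u k d)
          (toHat q₁ q₂ (boson q₁ q₂ r ⟨-(n : ℤ), neg_ne_zero.mpr hn⟩)) =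
        (-((1 - q₁ ^ n) * (1 - q₂ ^ n) * (1 - (q₁ * q₂) ^ (k * n)) / (1 - (q₁ * q₂) ^ n))) •
          wMode q₁ q₂ u k (d - n)) ∧
    -- the coefficient of `x^{-d}` in the relation for `[W_k(x), p_n]`, with `c = q ^ r`
    (∀ (k : ℕ) (d : ℤ) (n : ℕ) (hn : (n : ℤ) ≠ 0),
      starComm q₁ q₂ (wMode q₁ q₂ u k d) (toHat q₁ q₂ (boson q₁ q₂ r ⟨(n : ℤ), hn⟩)) =
        ((1 - q₁ ^ n) * (1 - q₂ ^ n) * ((q₁ * q₂) ^ (-((k : ℤ) * n)) - 1) *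
            ((q₁ * q₂) ^ r) ^ n / (1 - (q₁ * q₂) ^ n)) •
          wMode q₁ q₂ u k (d + n)) ∧
    -- the products of two currents are well defined
    (∀ k k' : ℕ,
      CurrentSummable q₁ q₂ (wMode q₁ q₂ u k) (wMode q₁ q₂ u k') (fSeries q₁ q₂ k k')) ∧
    -- the quadratic relation between `W_k(x)` and `W_{k'}(y)`
    (∀ k k' : ℕ, ∃ Z Z' : ℕ → ℤ → HeisHat K r,
      (∀ i ∈ Finset.Icc (k' - k + 1) k',
        IsRestriction (currentMul q₁ q₂ (wMode q₁ q₂ u (k' - i)) (wMode q₁ q₂ u (k + i))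
          (fSeries q₁ q₂ (k' - i) (k + i))) ((q₁ * q₂) ^ i) (Z i)) ∧
      (∀ i ∈ Finset.Icc (k - k' + 1) k,
        IsRestriction (currentMul q₁ q₂ (wMode q₁ q₂ u (k - i)) (wMode q₁ q₂ u (k' + i))
          (fSeries q₁ q₂ (k - i) (k' + i))) ((q₁ * q₂) ^ i) (Z' i)) ∧
      ∀ a b : ℤ,
        currentMul q₁ q₂ (wMode q₁ q₂ u k) (wMode q₁ q₂ u k') (fSeries q₁ q₂ k k') a b -
            currentMul q₁ q₂ (wMode q₁ q₂ u k') (wMode q₁ q₂ u k) (fSeries q₁ q₂ k' k) b a =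
          ∑ i ∈ Finset.Icc (k' - k + 1) k',
              theta q₁ q₂ (min i (k + i - k')) • deltaMul ((q₁ * q₂) ^ i) (Z i) a b -
            ∑ i ∈ Finset.Icc (k - k' + 1) k,
              theta q₁ q₂ (min i (k' + i - k)) • deltaMul ((q₁ * q₂) ^ i) (Z' i) b a) := by
  refine ⟨fun k d n => ?_, fun k d n hn => ?_, fun k d n hn => ?_, fun k k' => ?_,
    fun k k' => ⟨fun i => restriction q₁ q₂ u (k' - i) (k + i) i,
      fun i => restriction q₁ q₂ u (k - i) (k' + i) i, fun i hi => ?_, fun i hi => ?_,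
      quadratic_relation u hq k k'⟩⟩
  · exact ⟨(isHomogeneous_wMode q₁ q₂ u k d).starSummable q₁ q₂ (isHomogeneous_boson q₁ q₂ n),
      (isHomogeneous_boson q₁ q₂ n).starSummable q₁ q₂ (isHomogeneous_wMode q₁ q₂ u k d)⟩
  · exact starComm_wMode_boson_neg hq u k d n hn
  · exact starComm_wMode_boson_pos hq u k d n hn
  · exact currentSummable_wMode q₁ q₂ u _ k k'
  · rw [Finset.mem_Icc] at hi
    exact isRestriction_restriction u hq (by omega)
  · rw [Finset.mem_Icc] at hi
    exact isRestriction_restriction u hq (by omega)
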